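/- Let $K$ be a field of characteristic $0$, let $t\in K^\times$ not be a root of unity, let $n\ge 2$ and $q=t^{-2}$. Let $\widehat{\mathfrak S}_n$ be the extended affine symmetric group, i.e. the group of bijections $w$ of $\mathbb Z$ with $w(i+n)=w(i)+n$; it is generated by the simple reflections $s_i$ ($i\in\mathbb Z/n$), where $s_i$ exchanges $i+kn$ and $i+1+kn$ for all $k$, and by $\pi: i\mapsto i+1$. The length of $w$ is the least $m$ with $w=s_{i_1}\cdots s_{i_m}\pi^k$, and such an expression is then called reduced. Let $\mathfrak S_n\subset\widehat{\mathfrak S}_n$ be generated by $s_1,\dots,s_{n-1}$, and let $W_J=\langle s_i: i\in J\rangle$ for $J\subseteq\{1,\dots,n-1\}$. Let $\mathbb H$ be the double affine Hecke algebra of type $GL_n$ over $K$ with loop parameter $q=t^{-2}$: generators $T_i$, $Y_i^{\pm1}$ ($i\in\mathbb Z$, with $T_{i+n}=T_i$, $Y_{i+n}=q^{-1}Y_i$) and $\pi^{\pm1}$; relations $(T_i-t)(T_i+t^{-1})=0$, $T_iT_{i+1}T_i=T_{i+1}T_iT_{i+1}$ (dropped if $n=2$), $T_iT_j=T_jT_i$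 for $j\not\equiv i\pm1 \bmod n$, $\pi T_i\pi^{-1}=T_{i+1}$, $Y_iY_j=Y_jY_i$, $T_iY_iT_i=Y_{i+1}$, $T_iY_j=Y_jT_i$ for $j\not\equiv i,i+1 \bmod n$, $\pi Y_i\pi^{-1}=Y_{i+1}$. Write $T_w=T_{i_1}\cdots T_{i_m}\pi^k$ for a reduced expression of $w$, and $K[\mathcal Y]=K[Y_1^{\pm1},\dots,Y_n^{\pm1}]$. Let $K[\widetilde{\mathcal Y}]$ and $\widetilde{\mathbb H}$ be the localizations of $K[\mathcal Y]$ and $\mathbb H$ at all $f_{ij}=tY_i-t^{-1}Y_j$ with $i\not\equiv j\bmod n$. Put $\nu_i=(T_iY_i-Y_iT_i)f_{i,i+1}^{-1}\in\widetilde{\mathbb H}$ and $\nu_w=\nu_{i_1}\cdots\nu_{i_m}\pi^k$ for a reduced expression of $w$. The normal ordering of $h\in\widetilde{\mathbb H}$ is its expression $\sum_x T_xg_x$ as a finite sum with $g_x\in K[\widetilde{\mathcal Y}]$, $x\in\widehat{\mathfrak S}_n$; if no $g_x$ has a pole at $a\in(K^\times)^n$, put ${:}h{:}|_a=\sum_x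 g_x(a)T_x\in\mathbb H$. Let $a=(a_1,\dots,a_n)\in(K^\times)^n$ be such that - $a$ is descending: if $i<j$ and $a_i/a_j=t^{2z}$ with $z\in\mathbb Z$, then $z\ge0$; - entries in the same $t^2$-line (entries whose ratio is an integral power of $t^2$) are in consecutive position; - $a$ is transverse: $a_i\ne a_j$ for $i\ne j$. Extend $a$ to $\mathbb Z$ by $a_{i+mn}=q^{-m}a_i$, let $\widehat{\mathfrak S}_n$ act by $(w\cdot a)_i=a_{w^{-1}(i)}$, and let $\operatorname{Stab}(a)\subseteq\widehat{\mathfrak S}_n$ be the stabilizer. Let $\operatorname{Ind}_{\mathcal Y}^{\mathbb H}a=\mathbb H\otimes_{K[\mathcal Y]}Kv$, where $Y_i$ acts on $v$ by $a_i$ ($1\le i\le n$). **Theorem.** There are $J\subseteq\{1,\dots,n-1\}$ and $\gamma\in\widehat{\mathfrak S}_n$ with $\gamma\operatorname{Stab}(a)\gamma^{-1}=W_J$, and $\gamma$ can be taken of minimal length among all elements that conjugate $\operatorname{Stab}(a)$ to a standard parabolic subgroup of $\mathfrak S_n$. For every such pair $(J,\gamma)$ (of minimal length or not) and every $w\in W_J$,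 the element $\nu_{\gamma^{-1}w\gamma}$ has a unique normal ordering, whose coefficients have no pole at $a$, and $$\Phi_w(h\otimes v)=\bigl(h\,{:}\nu_{\gamma^{-1}w\gamma}{:}|_a\bigr)\otimes v\qquad(h\in\mathbb H)$$ defines a $K$-algebra isomorphism $$\Phi: K[W_J]^{\mathrm{op}}\to\operatorname{End}_{\mathbb H}(\operatorname{Ind}_{\mathcal Y}^{\mathbb H}a),\qquad w\mapsto\Phi_w .$$ -/

import Mathlib

noncomputable section

namespace DAHA

/-! ### The extended affine symmetric group -/

/-- The extended affine symmetric group: bijections `w` of `ℤ` with `w (i + n) = w i + n`. -/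
def AffPerm (n : ℕ) : Subgroup (Equiv.Perm ℤ) where
  carrier := {w | ∀ i, w (i + n) = w i + n}
  mul_mem' := by
    intro v w hv hw i
    change ∀ i, v (i + n) = v i + n at hv
    change ∀ i, w (i + n) = w i + n at hw
    simp only [Equiv.Perm.mul_apply, hw, hv]
  one_mem' := fun i => rfl
  inv_mem' := by
    intro w hw i
    change ∀ i, w (i + n) = w i + n at hw
    rw [Equiv.Perm.inv_eq_iff_eq, hw]
    exact congrArg (· + (n : ℤ)) (w.apply_symm_apply i).symm

/-- The underlying function of the simple reflection `s_i`: for every `k` it exchanges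
`i + k n` and `i + 1 + k n`, and it fixes all other integers. -/
def simpleFun (n : ℕ) (i j : ℤ) : ℤ :=
  if (n : ℤ) ∣ j - i then j + 1 else if (n : ℤ) ∣ j - (i + 1) then j - 1 else j

theorem two_le (n : ℕ) [n.AtLeastTwo] : 2 ≤ n := Nat.AtLeastTwo.prop

theorem not_dvd_one (n : ℕ) [n.AtLeastTwo] : ¬ (n : ℤ) ∣ 1 := by
  have h2 := two_le n
  intro h
  have := Int.le_of_dvd one_pos h
  omega

theorem simpleFun_invol (n : ℕ) [n.AtLeastTwo] (i : ℤ) :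
    Function.Involutive (simpleFun n i) := by
  have h1 := not_dvd_one n
  intro j
  unfold simpleFun
  by_cases hA : (n : ℤ) ∣ j - i
  · have hB : ¬ (n : ℤ) ∣ j + 1 - i := fun h => h1 (by
      have := dvd_sub h hA
      rwa [show j + 1 - i - (j - i) = 1 by ring] at this)
    have hC : (n : ℤ) ∣ j + 1 - (i + 1) := by
      rwa [show j + 1 - (i + 1) = j - i by ring]
    simp [hA, hB]
  · by_cases hB : (n : ℤ) ∣ j - (i + 1)
    · have hC : (n : ℤ) ∣ j - 1 - i := by
        rwa [show j - 1 - i = j - (i + 1) by ring]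
      simp [hA, hB, hC]
    · simp [hA, hB]

/-- The simple reflection `s_i` (`i ∈ ℤ`, depending only on `i` modulo `n`). -/
def s (n : ℕ) [n.AtLeastTwo] (i : ℤ) : AffPerm n :=
  ⟨(simpleFun_invol n i).toPerm, by
    intro j
    have e1 : j + n - i = (j - i) + n := by ring
    have e2 : j + n - (i + 1) = (j - (i + 1)) + n := by ring
    simp only [Function.Involutive.coe_toPerm, simpleFun, e1, e2, dvd_add_self_right]
    split_ifs <;> ring⟩

/-- The element `π`: `i ↦ i + 1`. -/
def rot (n : ℕ) : AffPerm n :=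
  ⟨Equiv.addRight 1, by intro i; simp only [Equiv.coe_addRight]; ring⟩

/-- The affine permutation `s_{i_1} ⋯ s_{i_m} π ^ k` spelled by the word `([i_1, …, i_m], k)`. -/
def wordVal (n : ℕ) [n.AtLeastTwo] (p : List ℤ × ℤ) : AffPerm n :=
  (p.1.map (s n)).prod * rot n ^ p.2

/-- The length: the least number of simple reflections in a word for `w`. -/
def len {n : ℕ} [n.AtLeastTwo] (w : AffPerm n) : ℕ :=
  sInf {m | ∃ p : List ℤ × ℤ, wordVal n p = w ∧ p.1.length = m}

def IsReduced {n : ℕ} [n.AtLeastTwo] (w : AffPerm n) (p : List ℤ × ℤ) : Prop :=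
  wordVal n p = w ∧ p.1.length = len w

/-- A chosen reduced word of `w`. The elements `T_w` and `ν_w` below do not depend on this
choice, because of the braid relations. -/
def redWord {n : ℕ} [n.AtLeastTwo] (w : AffPerm n) : List ℤ × ℤ :=
  Classical.epsilon (IsReduced w)

/-- The standard parabolic subgroup `W_J`, generated by the `s_i`, `i ∈ J`. -/
def parabolic (n : ℕ) [n.AtLeastTwo] (J : Set ℤ) : Subgroup (AffPerm n) :=
  Subgroup.closure (s n '' J)

/-! ### Quasi-periodic sequences and tuples -/

/-- The position, counted from `0`, of the residue of `i` in the window `1, …, n`. -/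
def idx (n : ℕ) [n.AtLeastTwo] (i : ℤ) : Fin n :=
  ⟨((i - 1) % n).toNat, by
    have h2 := two_le n
    have := Int.emod_nonneg (i - 1) (b := (n : ℤ)) (by omega)
    have := Int.emod_lt_of_pos (i - 1) (b := (n : ℤ)) (by omega)
    omega⟩

variable {K : Type*} [Field K]

/-- The extension of the tuple `(b_1, …, b_n)` (here `b_i` is `b (i - 1)`) to all subscripts in
`ℤ` with `b_{i + m n} = q ^ (-m) b_i`. -/
def ext {M : Type*} [SMul K M] {n : ℕ} [n.AtLeastTwo] (q : Kˣ) (b : Fin n → M) (i : ℤ) : M :=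
  ((q ^ (-((i - 1) / n)) : Kˣ) : K) • b (idx n i)

/-- The tuple `a`, extended to subscripts in `ℤ`. -/
def extTuple {n : ℕ} [n.AtLeastTwo] (q : Kˣ) (a : Fin n → Kˣ) : ℤ → K :=
  ext q fun k => (a k : K)

/-- The stabilizer of `a` in the extended affine symmetric group, for the action
`(w · a)_i = a_{w⁻¹ i}` on tuples extended to subscripts in `ℤ`. -/
def stab {n : ℕ} [n.AtLeastTwo] (q : Kˣ) (a : Fin n → Kˣ) : Subgroup (AffPerm n) where
  carrier := {w | ∀ i : ℤ, extTuple q a (((w⁻¹ : AffPerm n) : Equiv.Perm ℤ) i) = extTuple q a i}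
  mul_mem' := by
    intro v w hv hw i
    have hv' : ∀ i : ℤ, _ = _ := hv
    have hw' : ∀ i : ℤ, _ = _ := hw
    simp only [mul_inv_rev, Subgroup.coe_mul, Equiv.Perm.mul_apply, hw', hv']
  one_mem' := by
    intro i
    simp
  inv_mem' := by
    intro w hw i
    have h : extTuple q a ((w : Equiv.Perm ℤ).symm ((w : Equiv.Perm ℤ) i)) = _ :=
      hw ((w : Equiv.Perm ℤ) i)
    rw [Equiv.symm_apply_apply] at h
    rw [inv_inv, h]

/-- `x` and `y` are in the same `r`-line. -/
def SameLine (r x y : Kˣ) : Prop := ∃ z : ℤ, x / y = r ^ z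

def IsDescending {n : ℕ} (t : Kˣ) (a : Fin n → Kˣ) : Prop :=
  ∀ i j : Fin n, i < j → ∀ z : ℤ, a i / a j = t ^ (2 * z) → 0 ≤ z

/-- Entries in the same `t ^ 2`-line stand in consecutive positions. -/
def LinesConsecutive {n : ℕ} (t : Kˣ) (a : Fin n → Kˣ) : Prop :=
  ∀ i j k : Fin n, i ≤ j → j ≤ k → SameLine (t ^ 2) (a i) (a k) → SameLine (t ^ 2) (a i) (a j)

/-- `γ` conjugates the stabilizer of `a` to the standard parabolic subgroup `W_J` of the
finite symmetric group, which is generated by `s_1, …, s_{n-1}`. -/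
def Conjugates {n : ℕ} [n.AtLeastTwo] (q : Kˣ) (a : Fin n → Kˣ) (J : Set ℤ)
    (γ : AffPerm n) : Prop :=
  J ⊆ Set.Icc 1 ((n : ℤ) - 1) ∧
    (stab q a).map (MulAut.conj γ).toMonoidHom = parabolic n J

/-! ### The double affine Hecke algebra of type `GL_n` -/

/-- Generators; as usual the subscripts of `T` and `Y` are extended to `ℤ`. -/
inductive Gen : Type
  | T (i : ℤ)
  | pi
  | piInv
  | Y (i : ℤ)
  | YInv (i : ℤ)

open FreeAlgebra in
/-- The defining relations. With subscripts in `ℤ` subject to `T_{i+n} = T_i` and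
`Y_{i+n} = q⁻¹ Y_i`, the relations that involve `T_0` or cross the end of the window `1, …, n`
(such as `T_0 Y_n T_0 = q⁻¹ Y_1` and `π Y_n π⁻¹ = q⁻¹ Y_1`) take the same form as the others. -/
inductive Rel (n : ℕ) (q t : Kˣ) : FreeAlgebra K Gen → FreeAlgebra K Gen → Prop
  | T_periodic (i : ℤ) : Rel n q t (ι K (Gen.T (i + n))) (ι K (Gen.T i))
  | Y_periodic (i : ℤ) :
      Rel n q t (ι K (Gen.Y (i + n))) (((q⁻¹ : Kˣ) : K) • ι K (Gen.Y i))
  | quadratic (i : ℤ) :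
      Rel n q t ((ι K (Gen.T i) - algebraMap K _ (t : K)) *
        (ι K (Gen.T i) + algebraMap K _ ((t⁻¹ : Kˣ) : K))) 0
  | braid (i : ℤ) (hn : n ≠ 2) :
      Rel n q t (ι K (Gen.T i) * ι K (Gen.T (i + 1)) * ι K (Gen.T i))
        (ι K (Gen.T (i + 1)) * ι K (Gen.T i) * ι K (Gen.T (i + 1)))
  | T_comm (i j : ℤ) (h₁ : ¬ (n : ℤ) ∣ j - (i + 1)) (h₂ : ¬ (n : ℤ) ∣ j - (i - 1)) :
      Rel n q t (ι K (Gen.T i) * ι K (Gen.T j)) (ι K (Gen.T j) * ι K (Gen.T i))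
  | pi_mul_piInv : Rel n q t (ι K Gen.pi * ι K Gen.piInv) 1
  | piInv_mul_pi : Rel n q t (ι K Gen.piInv * ι K Gen.pi) 1
  | pi_T (i : ℤ) :
      Rel n q t (ι K Gen.pi * ι K (Gen.T i)) (ι K (Gen.T (i + 1)) * ι K Gen.pi)
  | Y_mul_YInv (i : ℤ) : Rel n q t (ι K (Gen.Y i) * ι K (Gen.YInv i)) 1
  | YInv_mul_Y (i : ℤ) : Rel n q t (ι K (Gen.YInv i) * ι K (Gen.Y i)) 1
  | Y_comm (i j : ℤ) :
      Rel n q t (ι K (Gen.Y i) * ι K (Gen.Y j)) (ι K (Gen.Y j) * ι K (Gen.Y i))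
  | T_Y_T (i : ℤ) :
      Rel n q t (ι K (Gen.T i) * ι K (Gen.Y i) * ι K (Gen.T i)) (ι K (Gen.Y (i + 1)))
  | T_Y_comm (i j : ℤ) (h₁ : ¬ (n : ℤ) ∣ j - i) (h₂ : ¬ (n : ℤ) ∣ j - (i + 1)) :
      Rel n q t (ι K (Gen.T i) * ι K (Gen.Y j)) (ι K (Gen.Y j) * ι K (Gen.T i))
  | pi_Y (i : ℤ) :
      Rel n q t (ι K Gen.pi * ι K (Gen.Y i)) (ι K (Gen.Y (i + 1)) * ι K Gen.pi)

/-- The double affine Hecke algebra `ℍ_n(q, t)` of type `GL_n`. -/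
abbrev H (n : ℕ) (q t : Kˣ) : Type _ := RingQuot (Rel n q t)

/-- The image of a generator in `ℍ`. -/
def gen (n : ℕ) (q t : Kˣ) (g : Gen) : H n q t :=
  RingQuot.mkAlgHom K (Rel n q t) (FreeAlgebra.ι K g)

def piUnit (n : ℕ) (q t : Kˣ) : (H n q t)ˣ where
  val := gen n q t Gen.pi
  inv := gen n q t Gen.piInv
  val_inv := by
    simpa [gen] using RingQuot.mkAlgHom_rel K (Rel.pi_mul_piInv (n := n) (q := q) (t := t))
  inv_val := by
    simpa [gen] using RingQuot.mkAlgHom_rel K (Rel.piInv_mul_pi (n := n) (q := q) (t := t))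

def yUnit (n : ℕ) (q t : Kˣ) (i : ℤ) : (H n q t)ˣ where
  val := gen n q t (Gen.Y i)
  inv := gen n q t (Gen.YInv i)
  val_inv := by
    simpa [gen] using RingQuot.mkAlgHom_rel K (Rel.Y_mul_YInv (n := n) (q := q) (t := t) i)
  inv_val := by
    simpa [gen] using RingQuot.mkAlgHom_rel K (Rel.YInv_mul_Y (n := n) (q := q) (t := t) i)

theorem yUnit_comm (n : ℕ) (q t : Kˣ) (i j : ℤ) :
    Commute (yUnit n q t i) (yUnit n q t j) := by
  apply Units.ext
  simpa [gen, yUnit] using RingQuot.mkAlgHom_rel K (Rel.Y_comm (n := n) (q := q) (t := t) i j)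

/-- `T_w = T_{i_1} ⋯ T_{i_m} π ^ k` for a reduced word `w = s_{i_1} ⋯ s_{i_m} π ^ k`. -/
def Tw {n : ℕ} [n.AtLeastTwo] (q t : Kˣ) (w : AffPerm n) : H n q t :=
  ((redWord w).1.map fun i => gen n q t (Gen.T i)).prod *
    ((piUnit n q t ^ (redWord w).2 : (H n q t)ˣ) : H n q t)

/-! ### Laurent polynomials in `Y_1, …, Y_n` and their localization -/

/-- The Laurent polynomial ring `K[𝒴] = K[Y_1^{±1}, …, Y_n^{±1}]`, as the group algebra of
`ℤ^n`. -/
abbrev Laurent (K : Type*) [Field K] (n : ℕ) : Type _ :=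
  MonoidAlgebra K (Fin n → Multiplicative ℤ)

/-- The variable `Y_i`, `i ∈ ℤ`, as a Laurent polynomial. -/
def yL {n : ℕ} [n.AtLeastTwo] (q : Kˣ) (i : ℤ) : Laurent K n :=
  ext q (fun k => MonoidAlgebra.of K _ (Pi.mulSingle k (Multiplicative.ofAdd 1))) i

/-- `f_{ij} = t Y_i - t⁻¹ Y_j`. -/
def fL (n : ℕ) [n.AtLeastTwo] (q t : Kˣ) (i j : ℤ) : Laurent K n :=
  (t : K) • yL q i - ((t⁻¹ : Kˣ) : K) • yL q j

/-- The multiplicative set generated by the `f_{ij}` with `i ≢ j` modulo `n`. -/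
def fSet (n : ℕ) [n.AtLeastTwo] (q t : Kˣ) : Submonoid (Laurent K n) :=
  Submonoid.closure {f | ∃ i j : ℤ, ¬ (n : ℤ) ∣ i - j ∧ f = fL n q t i j}

/-- The localized ring `K[𝒴~]`. -/
abbrev LaurentLoc (n : ℕ) [n.AtLeastTwo] (q t : Kˣ) : Type _ := Localization (fSet n q t)

/-- Evaluation of Laurent polynomials at `a`, i.e. the action of `K[𝒴]` on the one-dimensional
module `a`. -/
def evalAt {n : ℕ} (a : Fin n → Kˣ) : Laurent K n →ₐ[K] K :=
  MonoidAlgebra.lift K K (Fin n → Multiplicative ℤ)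
    { toFun := fun β => ∏ k, ((a k ^ (β k).toAdd : Kˣ) : K)
      map_one' := by simp
      map_mul' := by
        intro β δ
        simp [zpow_add, Finset.prod_mul_distrib] }

/-- `g ∈ K[𝒴~]` has no pole at `a`, and its value there is `c`: `g` is a fraction `P / Q` of
Laurent polynomials with `Q(a) ≠ 0` and `c = P(a) / Q(a)`. -/
def HasValueAt {n : ℕ} [n.AtLeastTwo] {q t : Kˣ} (a : Fin n → Kˣ) (g : LaurentLoc n q t)
    (c : K) : Prop :=
  ∃ P Q : Laurent K n, evalAt a Q ≠ 0 ∧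
    g * algebraMap (Laurent K n) (LaurentLoc n q t) Q =
      algebraMap (Laurent K n) (LaurentLoc n q t) P ∧
    c = evalAt a P / evalAt a Q

/-- The inclusion of the Laurent polynomials in `ℍ`. -/
def laurentToH (n : ℕ) [n.AtLeastTwo] (q t : Kˣ) : Laurent K n →ₐ[K] H n q t :=
  MonoidAlgebra.lift K (H n q t) (Fin n → Multiplicative ℤ)
    ((Units.coeHom (H n q t)).comp
      (MonoidHom.noncommPiCoprod
        (fun k : Fin n => zpowersHom (H n q t)ˣ (yUnit n q t ((k : ℤ) + 1)))
        (by
          intro k l _ x y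
          simp only [zpowersHom_apply]
          exact (yUnit_comm n q t _ _).zpow_zpow _ _)))

/-! ### The localization of `ℍ` -/

/-- The generators of the localized algebra: those of `ℍ`, and an inverse of `f_{ij}` for all
`i ≢ j` modulo `n`. -/
abbrev LGen (n : ℕ) : Type := Gen ⊕ {p : ℤ × ℤ // ¬ (n : ℤ) ∣ p.1 - p.2}

def liftGen (K : Type*) [Field K] (n : ℕ) : FreeAlgebra K Gen →ₐ[K] FreeAlgebra K (LGen n) :=
  FreeAlgebra.lift K fun g => FreeAlgebra.ι K (Sum.inl g)

/-- `f_{ij}` as an element of the free algebra. -/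
def fFree (t : Kˣ) (i j : ℤ) : FreeAlgebra K Gen :=
  (t : K) • FreeAlgebra.ι K (Gen.Y i) - ((t⁻¹ : Kˣ) : K) • FreeAlgebra.ι K (Gen.Y j)

inductive LRel (n : ℕ) (q t : Kˣ) : FreeAlgebra K (LGen n) → FreeAlgebra K (LGen n) → Prop
  | of_rel {x y : FreeAlgebra K Gen} (h : Rel n q t x y) :
      LRel n q t (liftGen K n x) (liftGen K n y)
  | f_mul_inv (p : {p : ℤ × ℤ // ¬ (n : ℤ) ∣ p.1 - p.2}) :
      LRel n q t (liftGen K n (fFree t p.1.1 p.1.2) * FreeAlgebra.ι K (Sum.inr p)) 1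
  | inv_mul_f (p : {p : ℤ × ℤ // ¬ (n : ℤ) ∣ p.1 - p.2}) :
      LRel n q t (FreeAlgebra.ι K (Sum.inr p) * liftGen K n (fFree t p.1.1 p.1.2)) 1

/-- The localization `ℍ~` of `ℍ` at the `f_{ij}`, `i ≢ j` modulo `n`: the universal algebra under
`ℍ` in which these elements are invertible. -/
abbrev HLoc (n : ℕ) (q t : Kˣ) : Type _ := RingQuot (LRel n q t)

/-- The canonical map from `ℍ` to its localization. -/
def toLoc (n : ℕ) (q t : Kˣ) : H n q t →ₐ[K] HLoc n q t :=
  RingQuot.liftAlgHom K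
    ⟨(RingQuot.mkAlgHom K (LRel n q t)).comp (liftGen K n), fun _ _ h =>
      RingQuot.mkAlgHom_rel K (LRel.of_rel h)⟩

theorem gen_periodic (n : ℕ) (q t : Kˣ) (i m : ℤ) :
    gen n q t (Gen.Y (i + m * n)) = ((q ^ (-m) : Kˣ) : K) • gen n q t (Gen.Y i) := by
  have step : ∀ j : ℤ, gen n q t (Gen.Y (j + n)) =
      ((q⁻¹ : Kˣ) : K) • gen n q t (Gen.Y j) := by
    intro j
    simpa only [gen, map_smul] using
      RingQuot.mkAlgHom_rel K (Rel.Y_periodic (n := n) (q := q) (t := t) j)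
  induction m using Int.induction_on with
  | zero => simp
  | succ m ih =>
    rw [show i + ((m : ℤ) + 1) * n = (i + m * n) + n by ring, step, ih, smul_smul,
      ← Units.val_mul]
    congr 2
    rw [neg_add, zpow_add, zpow_neg_one, mul_comm]
  | pred m ih =>
    have h := step (i + (-(m : ℤ) - 1) * n)
    rw [show i + (-(m : ℤ) - 1) * n + n = i + -(m : ℤ) * n by ring, ih] at h
    have h' := congrArg (fun x => (q : K) • x) h
    simp only [smul_smul, ← Units.val_mul, mul_inv_cancel, Units.val_one, one_smul] at h'
    rw [← h']
    congr 2
    rw [show -(-(m : ℤ) - 1) = 1 + - -(m : ℤ) by ring, zpow_add, zpow_one]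

theorem laurentToH_yL (n : ℕ) [n.AtLeastTwo] (q t : Kˣ) (i : ℤ) :
    laurentToH n q t (yL q i) = gen n q t (Gen.Y i) := by
  have h2 := two_le n
  have e : ((idx n i : Fin n) : ℤ) + 1 + ((i - 1) / n) * n = i := by
    have h0 := Int.emod_nonneg (i - 1) (b := (n : ℤ)) (by omega)
    have h1 := Int.emod_add_mul_ediv (i - 1) n
    have h3 : (((idx n i : Fin n) : ℕ) : ℤ) = (i - 1) % n := by
      simp only [idx]
      exact Int.toNat_of_nonneg h0
    rw [h3]
    linarith [mul_comm ((i - 1) / (n : ℤ)) (n : ℤ)]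
  conv_rhs => rw [← e, gen_periodic]
  unfold yL ext
  rw [map_smul]
  congr 1
  simp only [laurentToH, MonoidAlgebra.lift_of, MonoidHom.comp_apply]
  simp [yUnit]

theorem isUnit_fL (n : ℕ) [n.AtLeastTwo] (q t : Kˣ) (i j : ℤ) (h : ¬ (n : ℤ) ∣ i - j) :
    IsUnit (toLoc n q t (laurentToH n q t (fL n q t i j))) := by
  have hg : ∀ m : ℤ, toLoc n q t (gen n q t (Gen.Y m)) =
      RingQuot.mkAlgHom K (LRel n q t) (liftGen K n (FreeAlgebra.ι K (Gen.Y m))) :=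
    fun m => RingQuot.liftAlgHom_mkAlgHom_apply K _ _ _
  have key : toLoc n q t (laurentToH n q t (fL n q t i j)) =
      RingQuot.mkAlgHom K (LRel n q t) (liftGen K n (fFree t i j)) := by
    simp only [fL, map_sub, map_smul, laurentToH_yL, fFree, hg]
  rw [key]
  refine ⟨⟨_, RingQuot.mkAlgHom K (LRel n q t) (FreeAlgebra.ι K (Sum.inr ⟨(i, j), h⟩)), ?_, ?_⟩,
    rfl⟩
  · simpa using RingQuot.mkAlgHom_rel K (LRel.f_mul_inv (n := n) (q := q) (t := t) ⟨(i, j), h⟩)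
  · simpa using RingQuot.mkAlgHom_rel K (LRel.inv_mul_f (n := n) (q := q) (t := t) ⟨(i, j), h⟩)

/-- The composite `K[𝒴] → ℍ → ℍ~`. -/
def laurentToHLoc (n : ℕ) [n.AtLeastTwo] (q t : Kˣ) : Laurent K n →+* HLoc n q t :=
  ((toLoc n q t).comp (laurentToH n q t)).toRingHom

theorem isUnit_fSet (n : ℕ) [n.AtLeastTwo] (q t : Kˣ) (f : fSet n q t) :
    IsUnit ((laurentToHLoc n q t : Laurent K n →* HLoc n q t).comp (fSet n q t).subtype f) := by
  obtain ⟨f, hf⟩ := f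
  change IsUnit (toLoc n q t (laurentToH n q t f))
  induction hf using Submonoid.closure_induction with
  | mem x hx =>
    obtain ⟨i, j, h, rfl⟩ := hx
    exact isUnit_fL n q t i j h
  | one => simp
  | mul x y _ _ hx hy =>
    rw [map_mul, map_mul]
    exact hx.mul hy

/-- The canonical map `K[𝒴~] → ℍ~`. -/
def laurentLocToHLoc (n : ℕ) [n.AtLeastTwo] (q t : Kˣ) :
    LaurentLoc n q t →+* HLoc n q t :=
  OreLocalization.universalHom (laurentToHLoc n q t)
    (IsUnit.liftRight ((laurentToHLoc n q t : Laurent K n →* HLoc n q t).comp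
      (fSet n q t).subtype) (isUnit_fSet n q t))
    (fun f => (IsUnit.coe_liftRight _ (isUnit_fSet n q t) f).symm)

/-! ### Intertwiners and normal ordering -/

/-- Cherednik's intertwiner `φ_i = T_i Y_i - Y_i T_i`. -/
def phi (n : ℕ) (q t : Kˣ) (i : ℤ) : H n q t :=
  gen n q t (Gen.T i) * gen n q t (Gen.Y i) - gen n q t (Gen.Y i) * gen n q t (Gen.T i)

/-- The renormalized intertwiner `ν_i = φ_i f_{i,i+1}⁻¹`. Here `f_{i,i+1}` is a unit of `ℍ~`, and
`Ring.inverse` is its inverse. -/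
def nu (n : ℕ) [n.AtLeastTwo] (q t : Kˣ) (i : ℤ) : HLoc n q t :=
  toLoc n q t (phi n q t i) *
    Ring.inverse (toLoc n q t (laurentToH n q t (fL n q t i (i + 1))))

/-- `ν_w = ν_{i_1} ⋯ ν_{i_m} π ^ k` for a reduced word `w = s_{i_1} ⋯ s_{i_m} π ^ k`. -/
def nuW {n : ℕ} [n.AtLeastTwo] (q t : Kˣ) (w : AffPerm n) : HLoc n q t :=
  ((redWord w).1.map (nu n q t)).prod *
    toLoc n q t ((piUnit n q t ^ (redWord w).2 : (H n q t)ˣ) : H n q t)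

/-- `g` gives the normal ordering of `h ∈ ℍ~`: `h = ∑_x T_x g_x` with `g_x ∈ K[𝒴~]`. -/
def IsNormalOrdering {n : ℕ} [n.AtLeastTwo] {q t : Kˣ} (h : HLoc n q t)
    (g : AffPerm n →₀ LaurentLoc n q t) : Prop :=
  h = g.sum fun x c => toLoc n q t (Tw q t x) * laurentLocToHLoc n q t c

/-! ### The induced module -/

/-- The left ideal of `ℍ` generated by the `Y_i - a_i`, `1 ≤ i ≤ n`. -/
def indIdeal {n : ℕ} (q t : Kˣ) (a : Fin n → Kˣ) : Ideal (H n q t) :=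
  Ideal.span (Set.range fun k : Fin n =>
    gen n q t (Gen.Y ((k : ℤ) + 1)) - algebraMap K (H n q t) (a k : K))

/-- The induced module `Ind_𝒴^ℍ a = ℍ ⊗_{K[𝒴]} a`, as the quotient of `ℍ` by the left ideal
generated by the `Y_i - a_i`. -/
abbrev Ind {n : ℕ} (q t : Kˣ) (a : Fin n → Kˣ) : Type _ := H n q t ⧸ indIdeal q t a

/-- The element `h ⊗ v` of the induced module. -/
def tmulV {n : ℕ} {q t : Kˣ} (a : Fin n → Kˣ) (h : H n q t) : Ind q t a :=
  Submodule.Quotient.mk h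

end DAHA

end

noncomputable section
set_option linter.unusedSectionVars false
namespace DAHA

/-! ### Affine permutations: inversions and length -/

section AffinePermutations

variable {n : ℕ}

/-! An endomorphism of the induced module is determined by the image of `1 ⊗ v`, which may be any
vector of weight `a`. So what is needed is a basis of the weight space indexed by Stab(a), together
with its multiplication.

Over the field of rational functions this is easy. The localized algebra acts on a space with basis
`e_v`, where v runs over affine permutations, by Y_i e_v = Y_{v⁻¹ i} e_v and ν_i e_v = e_{s_i v}
(`rep`, `repL_nu`). Hence ν_w e_1 = e_w for every word of w. The vector T_x e_1 is a nonzero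
multiple `kap x` of e_x plus terms of smaller length (`rep_Tw_sub_mem`), so these vectors are
independent (`theta_injective`). This gives the PBW basis and the uniqueness of normal orderings,
and the normal ordering of ν_u becomes the expansion of e_u in the T_x e_1. Right translations
commute with the algebra (`rightT_rep`) and send e_u to e_{u u'}.

The heart of the proof is that e_u has no pole at `a` when u lies in Stab(a). Let i < j be
neighbouring subscripts with a_i = a_j. Simple reflections lead from 1 to some v with v j = v i + 1.
Along this path e_v stays regular, while e_1 is expressed through e_v with at most a simple pole
along Y_i = Y_j (`PathInv.step`). Adding to e_1 its translate by the reflection (i j) cancels that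
pole (`Generic.reg_rightT_add`), so the reflection itself gives a regular vector. Other reflections
and products follow (`Generic.reg_refl`, `Reg.ev_mul`).

The values z_u of the e_u at `a` are weight vectors. Zeros and poles of `kap u` at `a` cancel in
pairs (`Generic.val_kap`), so z_u has leading term T_u. Conversely the leading term of any weight
vector is indexed by Stab(a). So the z_u form a basis (`Generic.linearIndependent`,
`Generic.span_eq`). Evaluation at `a` is invariant under Stab(a), so right translations specialize
and the endomorphisms multiply in reversed order (`endOf_mul`).

On the group side, a translation makes all entries of each line equal, and the stabilizer of such a
block tuple is standard parabolic (`exists_conjugates`). -/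

instance : CoeFun (AffPerm n) fun _ => ℤ → ℤ := ⟨fun w => (w : Equiv.Perm ℤ)⟩

theorem AffPerm.ext' {v w : AffPerm n} (h : ∀ i, v i = w i) : v = w :=
  Subtype.ext (Equiv.ext h)

@[simp] theorem mul_apply' (v w : AffPerm n) (i : ℤ) : (v * w) i = v (w i) := rfl

@[simp] theorem one_apply' (i : ℤ) : (1 : AffPerm n) i = i := rfl

@[simp] theorem inv_apply_self' (w : AffPerm n) (i : ℤ) : w⁻¹ (w i) = i :=
  (w : Equiv.Perm ℤ).symm_apply_apply i

@[simp] theorem apply_inv_self' (w : AffPerm n) (i : ℤ) : w (w⁻¹ i) = i :=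
  (w : Equiv.Perm ℤ).apply_symm_apply i

theorem inv_apply_eq (w : AffPerm n) {i j : ℤ} : w⁻¹ i = j ↔ i = w j := by
  constructor
  · rintro rfl; simp
  · rintro rfl; simp

theorem apply_injective (w : AffPerm n) : Function.Injective (w : ℤ → ℤ) :=
  (w : Equiv.Perm ℤ).injective

theorem apply_add_n (w : AffPerm n) (i : ℤ) : w (i + n) = w i + n := w.2 i

theorem apply_add_mul (w : AffPerm n) (i k : ℤ) : w (i + k * n) = w i + k * n := by
  induction k using Int.induction_on with
  | zero => simp
  | succ k ih =>
    rw [show i + ((k : ℤ) + 1) * n = (i + k * n) + n by ring, apply_add_n, ih]; ring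
  | pred k ih =>
    have := apply_add_n w (i + (-(k : ℤ) - 1) * n)
    rw [show i + (-(k : ℤ) - 1) * n + n = i + -(k : ℤ) * n by ring, ih] at this
    linarith

theorem dvd_apply_sub (w : AffPerm n) {i j : ℤ} (h : (n : ℤ) ∣ i - j) : (n : ℤ) ∣ w i - w j := by
  obtain ⟨k, hk⟩ := h
  rw [show i = j + k * n by linarith, apply_add_mul]
  exact ⟨k, by ring⟩

theorem dvd_apply_sub_iff (w : AffPerm n) {i j : ℤ} :
    (n : ℤ) ∣ w i - w j ↔ (n : ℤ) ∣ i - j :=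
  ⟨fun h => by simpa using dvd_apply_sub w⁻¹ h, dvd_apply_sub w⟩

theorem rot_apply (i : ℤ) : rot n i = i + 1 := rfl

theorem rot_zpow_apply (k i : ℤ) : (rot n ^ k) i = i + k := by
  induction k using Int.induction_on generalizing i with
  | zero => simp
  | succ k ih => rw [zpow_add_one, mul_apply', ih, rot_apply]; ring
  | pred k ih =>
    rw [zpow_sub_one, mul_apply', ih, (inv_apply_eq (rot n) (j := i - 1)).2 (by simp [rot_apply])]
    ring

variable [n.AtLeastTwo]

theorem n_pos : 0 < (n : ℤ) := by have := two_le n; omega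

theorem s_apply (i j : ℤ) : s n i j = simpleFun n i j := rfl

theorem s_apply_of_dvd {i j : ℤ} (h : (n : ℤ) ∣ j - i) : s n i j = j + 1 := by
  rw [s_apply, simpleFun, if_pos h]

theorem s_apply_of_dvd_succ {i j : ℤ} (h : (n : ℤ) ∣ j - (i + 1)) : s n i j = j - 1 := by
  have h1 := not_dvd_one n
  have : ¬ (n : ℤ) ∣ j - i := fun h' => h1 (by
    have := dvd_sub h' h
    rwa [show j - i - (j - (i + 1)) = 1 by ring] at this)
  rw [s_apply, simpleFun, if_neg this, if_pos h]

theorem s_apply_of_not {i j : ℤ} (h : ¬ (n : ℤ) ∣ j - i) (h' : ¬ (n : ℤ) ∣ j - (i + 1)) :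
    s n i j = j := by
  rw [s_apply, simpleFun, if_neg h, if_neg h']

@[simp] theorem s_self (i : ℤ) : s n i i = i + 1 := s_apply_of_dvd (by simp)

@[simp] theorem s_succ (i : ℤ) : s n i (i + 1) = i := by
  rw [s_apply_of_dvd_succ (by simp)]; ring

@[simp] theorem s_mul_self (i : ℤ) : s n i * s n i = 1 :=
  AffPerm.ext' fun j => simpleFun_invol n i j

@[simp] theorem s_mul_self_mul (i : ℤ) (w : AffPerm n) : s n i * (s n i * w) = w := by
  rw [← mul_assoc, s_mul_self, one_mul]

@[simp] theorem s_inv (i : ℤ) : (s n i)⁻¹ = s n i := inv_eq_of_mul_eq_one_left (s_mul_self i)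

theorem s_congr {i j : ℤ} (h : (n : ℤ) ∣ i - j) : s n i = s n j := by
  refine AffPerm.ext' fun x => ?_
  have e1 : (n : ℤ) ∣ x - i ↔ (n : ℤ) ∣ x - j := by
    rw [show x - j = (x - i) + (i - j) by ring, dvd_add_left h]
  have e2 : (n : ℤ) ∣ x - (i + 1) ↔ (n : ℤ) ∣ x - (j + 1) := by
    rw [show x - (j + 1) = (x - (i + 1)) + (i - j) by ring, dvd_add_left h]
  simp only [s_apply, simpleFun, e1, e2]

theorem rot_mul_s (i : ℤ) : rot n * s n i = s n (i + 1) * rot n := by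
  refine AffPerm.ext' fun x => ?_
  simp only [mul_apply', rot_apply, s_apply, simpleFun,
    show x + 1 - (i + 1) = x - i by ring, show x + 1 - (i + 1 + 1) = x - (i + 1) by ring]
  split_ifs <;> ring

/-- The reflection exchanging `i + k n` and `j + k n` for all `k`. -/
def reflFun (n : ℕ) (i j x : ℤ) : ℤ :=
  if (n : ℤ) ∣ x - i then x + (j - i) else if (n : ℤ) ∣ x - j then x - (j - i) else x

theorem reflFun_invol {i j : ℤ} (h : ¬ (n : ℤ) ∣ j - i) :
    Function.Involutive (reflFun n i j) := by
  intro x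
  unfold reflFun
  by_cases hA : (n : ℤ) ∣ x - i
  · have hB : ¬ (n : ℤ) ∣ x + (j - i) - i := fun h' => h (by
      have := dvd_sub h' hA
      rwa [show x + (j - i) - i - (x - i) = j - i by ring] at this)
    have hC : (n : ℤ) ∣ x + (j - i) - j := by rwa [show x + (j - i) - j = x - i by ring]
    simp [hA, hB, hC]
  · by_cases hB : (n : ℤ) ∣ x - j
    · have hC : (n : ℤ) ∣ x - (j - i) - i := by rwa [show x - (j - i) - i = x - j by ring]
      simp [hA, hB, hC]
    · simp [hA, hB]

/-- The affine reflection exchanging `i + k n` and `j + k n` for all `k`. -/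
def refl {i j : ℤ} (h : ¬ (n : ℤ) ∣ j - i) : AffPerm n :=
  ⟨(reflFun_invol h).toPerm, by
    intro x
    have e1 : x + n - i = (x - i) + n := by ring
    have e2 : x + n - j = (x - j) + n := by ring
    simp only [Function.Involutive.coe_toPerm, reflFun, e1, e2, dvd_add_self_right]
    split_ifs <;> ring⟩

theorem refl_apply {i j : ℤ} (h : ¬ (n : ℤ) ∣ j - i) (x : ℤ) : refl h x = reflFun n i j x := rfl

theorem refl_of_dvd {i j : ℤ} (h : ¬ (n : ℤ) ∣ j - i) {x : ℤ} (hx : (n : ℤ) ∣ x - i) :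
    refl h x = x + (j - i) := by rw [refl_apply, reflFun, if_pos hx]

theorem refl_of_dvd' {i j : ℤ} (h : ¬ (n : ℤ) ∣ j - i) {x : ℤ} (hx : (n : ℤ) ∣ x - j) :
    refl h x = x - (j - i) := by
  have : ¬ (n : ℤ) ∣ x - i := fun h' => h (by
    have := dvd_sub h' hx
    rwa [show x - i - (x - j) = j - i by ring] at this)
  rw [refl_apply, reflFun, if_neg this, if_pos hx]

theorem refl_of_not {i j : ℤ} (h : ¬ (n : ℤ) ∣ j - i) {x : ℤ} (hx : ¬ (n : ℤ) ∣ x - i)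
    (hx' : ¬ (n : ℤ) ∣ x - j) : refl h x = x := by
  rw [refl_apply, reflFun, if_neg hx, if_neg hx']

@[simp] theorem refl_left {i j : ℤ} (h : ¬ (n : ℤ) ∣ j - i) : refl h i = j := by
  rw [refl_of_dvd h (by simp)]; ring

@[simp] theorem refl_right {i j : ℤ} (h : ¬ (n : ℤ) ∣ j - i) : refl h j = i := by
  rw [refl_of_dvd' h (by simp)]; ring

@[simp] theorem refl_mul_self {i j : ℤ} (h : ¬ (n : ℤ) ∣ j - i) : refl h * refl h = 1 :=
  AffPerm.ext' fun x => reflFun_invol h x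

@[simp] theorem refl_inv {i j : ℤ} (h : ¬ (n : ℤ) ∣ j - i) : (refl h)⁻¹ = refl h :=
  inv_eq_of_mul_eq_one_left (refl_mul_self h)

theorem not_dvd_succ_sub (i : ℤ) : ¬ (n : ℤ) ∣ i + 1 - i := by
  rw [show i + 1 - i = 1 by ring]; exact not_dvd_one n

theorem s_eq_refl (i : ℤ) : s n i = refl (not_dvd_succ_sub i) := by
  refine AffPerm.ext' fun x => ?_
  simp only [s_apply, refl_apply, simpleFun, reflFun, show i + 1 - i = 1 by ring]

theorem not_dvd_apply (w : AffPerm n) {i j : ℤ} (h : ¬ (n : ℤ) ∣ j - i) :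
    ¬ (n : ℤ) ∣ w j - w i := fun h' => h ((dvd_apply_sub_iff w).1 h')

/-- In this form the braid and commutation relations, and the factorization of long reflections,
reduce to computing the images of two integers. -/
theorem mul_refl (w : AffPerm n) {i j : ℤ} (h : ¬ (n : ℤ) ∣ j - i) :
    w * refl h = refl (not_dvd_apply w h) * w := by
  refine AffPerm.ext' fun x => ?_
  simp only [mul_apply']
  by_cases hA : (n : ℤ) ∣ x - i
  · rw [refl_of_dvd h hA, refl_of_dvd _ (dvd_apply_sub w hA)]
    obtain ⟨k, hk⟩ := hA
    rw [show x + (j - i) = j + k * n by linarith, show x = i + k * n by linarith,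
      apply_add_mul, apply_add_mul]
    ring
  · by_cases hB : (n : ℤ) ∣ x - j
    · rw [refl_of_dvd' h hB, refl_of_dvd' _ (dvd_apply_sub w hB)]
      obtain ⟨k, hk⟩ := hB
      rw [show x - (j - i) = i + k * n by linarith, show x = j + k * n by linarith,
        apply_add_mul, apply_add_mul]
      ring
    · rw [refl_of_not h hA hB, refl_of_not]
      · rwa [dvd_apply_sub_iff]
      · rwa [dvd_apply_sub_iff]

theorem mul_refl_of_eq (w : AffPerm n) {i j k l : ℤ} (h : ¬ (n : ℤ) ∣ j - i)
    (h' : ¬ (n : ℤ) ∣ l - k) (hk : w i = k) (hl : w j = l) : w * refl h = refl h' * w := by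
  subst hk hl; exact mul_refl w h

/-- Both sides are the reflection exchanging i and i + 2, which exists because n does not divide 2.
-/
theorem s_braid (hn : n ≠ 2) (i : ℤ) :
    s n i * s n (i + 1) * s n i = s n (i + 1) * s n i * s n (i + 1) := by
  have h2 := two_le n
  have n2 : ¬ (n : ℤ) ∣ 2 := fun h => by have := Int.le_of_dvd (by norm_num) h; omega
  have h : ¬ (n : ℤ) ∣ i + 1 + 1 - i := by rwa [show i + 1 + 1 - i = 2 by ring]
  have e1 : s n i * s n (i + 1) = refl h * s n i := by
    rw [s_eq_refl (i + 1)]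
    refine mul_refl_of_eq _ _ _ (by simp) (s_apply_of_not ?_ ?_)
    · exact h
    · rw [show i + 1 + 1 - (i + 1) = 1 by ring]; exact not_dvd_one n
  have e2 : s n (i + 1) * s n i = refl h * s n (i + 1) := by
    rw [s_eq_refl i]
    refine mul_refl_of_eq _ _ _ (s_apply_of_not ?_ ?_) (by simp)
    · rw [show i - (i + 1) = -1 by ring, dvd_neg]; exact not_dvd_one n
    · rw [show i - (i + 1 + 1) = -2 by ring, dvd_neg]; exact n2
  rw [e1, e2, mul_assoc, mul_assoc, s_mul_self, s_mul_self]

theorem s_comm {i j : ℤ} (h₁ : ¬ (n : ℤ) ∣ j - (i + 1)) (h₂ : ¬ (n : ℤ) ∣ j - (i - 1)) :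
    s n i * s n j = s n j * s n i := by
  by_cases h : (n : ℤ) ∣ i - j
  · rw [s_congr h]
  · have h' : ¬ (n : ℤ) ∣ j - i := by rwa [← dvd_neg, neg_sub]
    rw [s_eq_refl j]
    refine mul_refl_of_eq _ _ _ (s_apply_of_not h' h₁) (s_apply_of_not ?_ ?_)
    · rwa [show j + 1 - i = j - (i - 1) by ring]
    · rwa [show j + 1 - (i + 1) = j - i by ring]

/-! ### Inversions -/

/-- The inversions `(p, r)` of `w`, normalized by `1 ≤ p ≤ n`. -/
def invSet (w : AffPerm n) : Set (ℤ × ℤ) :=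
  {x | (1 ≤ x.1 ∧ x.1 ≤ n) ∧ x.1 < x.2 ∧ w x.2 < w x.1}

/-- The translate of a pair of integers by a multiple of `n` with first entry in `1, …, n`. -/
def normPair (n : ℕ) (p r : ℤ) : ℤ × ℤ := (p - (p - 1) / n * n, r - (p - 1) / n * n)

theorem normPair_fst (p r : ℤ) : 1 ≤ (normPair n p r).1 ∧ (normPair n p r).1 ≤ n := by
  have h := n_pos (n := n)
  have h0 := Int.emod_nonneg (p - 1) h.ne'
  have h1 := Int.emod_lt_of_pos (p - 1) h
  have h2 := Int.emod_add_mul_ediv (p - 1) n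
  simp only [normPair]
  constructor <;> linarith [mul_comm ((p - 1) / (n : ℤ)) (n : ℤ)]

theorem eq_of_window {x y : ℤ} (hx : 1 ≤ x ∧ x ≤ n) (hy : 1 ≤ y ∧ y ≤ n)
    (h : (n : ℤ) ∣ x - y) : x = y := by
  have := Int.eq_zero_of_abs_lt_dvd h (by rw [abs_lt]; constructor <;> linarith)
  linarith

/-- Write r = r' + k n with r' in the window. Then k ≥ 0, and w r = w r' + k n < w p bounds k by w p
- w r'. -/
theorem finite_invSet (w : AffPerm n) : (invSet w).Finite := by
  have hfin : (⋃ p ∈ Set.Icc (1 : ℤ) n, ⋃ r ∈ Set.Icc (1 : ℤ) n,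
      (fun k : ℤ => (p, r + k * n)) '' Set.Icc 0 (w p - w r)).Finite :=
    (Set.finite_Icc _ _).biUnion fun p _ => (Set.finite_Icc _ _).biUnion fun r _ =>
      (Set.finite_Icc _ _).image _
  refine hfin.subset ?_
  rintro ⟨p, r⟩ ⟨hp, hpr, hw⟩
  simp only at hp hpr hw
  have hn := n_pos (n := n)
  simp only [Set.mem_iUnion]
  have hr := normPair_fst (n := n) r r
  set k := (r - 1) / (n : ℤ) with hk
  have hrk : r - k * n + k * n = r := by ring
  have hk0 : 0 ≤ k := Int.ediv_nonneg (by linarith) hn.le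
  refine ⟨p, hp, r - k * n, hr, k, ⟨hk0, ?_⟩, by simp⟩
  have : w r = w (r - k * n) + k * n := by rw [← apply_add_mul, hrk]
  nlinarith

/-- A simple reflection moves integers by at most one, so it can reverse the order only of two
adjacent integers that it swaps. -/
theorem s_lt_iff {i x y : ℤ} (h : x < y) :
    s n i y < s n i x ↔ (n : ℤ) ∣ x - i ∧ y = x + 1 := by
  constructor
  · intro hs
    by_cases hx : (n : ℤ) ∣ x - i
    · refine ⟨hx, ?_⟩
      rw [s_apply_of_dvd hx] at hs
      by_cases h1 : (n : ℤ) ∣ y - i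
      · rw [s_apply_of_dvd h1] at hs; omega
      · by_cases h2 : (n : ℤ) ∣ y - (i + 1)
        · rw [s_apply_of_dvd_succ h2] at hs
          omega
        · rw [s_apply_of_not h1 h2] at hs; omega
    · exfalso
      have hx' : s n i x ≤ x := by
        by_cases h2 : (n : ℤ) ∣ x - (i + 1)
        · rw [s_apply_of_dvd_succ h2]; omega
        · rw [s_apply_of_not hx h2]
      by_cases h2 : (n : ℤ) ∣ y - (i + 1)
      · rw [s_apply_of_dvd_succ h2] at hs
        obtain rfl : y = x + 1 := by omega
        exact hx (by rwa [show x + 1 - (i + 1) = x - i by ring] at h2)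
      · have : y ≤ s n i y := by
          by_cases h1 : (n : ℤ) ∣ y - i
          · rw [s_apply_of_dvd h1]; omega
          · rw [s_apply_of_not h1 h2]
        omega
  · rintro ⟨hx, rfl⟩
    rw [s_apply_of_dvd hx, s_apply_of_dvd_succ]
    · omega
    · rwa [show x + 1 - (i + 1) = x - i by ring]

theorem inv_apply_add_mul (w : AffPerm n) (i k : ℤ) : w⁻¹ (i + k * n) = w⁻¹ i + k * n :=
  apply_add_mul w⁻¹ i k

theorem inv_apply_sub_mul (w : AffPerm n) (i k : ℤ) : w⁻¹ (i - k * n) = w⁻¹ i - k * n := by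
  have := apply_add_mul w⁻¹ i (-k)
  rw [show i + -k * n = i - k * n by ring] at this
  rw [this]; ring

theorem apply_sub_mul (w : AffPerm n) (i k : ℤ) : w (i - k * n) = w i - k * n := by
  simpa using inv_apply_sub_mul w⁻¹ i k

/-- By `s_lt_iff` only the values i and i + 1, up to translation, change their order. They stand at
the positions w⁻¹ i and w⁻¹ (i + 1), which have a single translate in the window. -/
theorem invSet_s_mul {w : AffPerm n} {i : ℤ} (h : w⁻¹ i < w⁻¹ (i + 1)) :
    invSet (s n i * w) = insert (normPair n (w⁻¹ i) (w⁻¹ (i + 1))) (invSet w) := by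
  ext ⟨p, r⟩
  simp only [Set.mem_insert_iff]
  constructor
  · rintro ⟨hp, hpr, hs⟩
    simp only [mul_apply'] at hp hpr hs
    rcases lt_trichotomy (w r) (w p) with hw | hw | hw
    · exact Or.inr ⟨hp, hpr, hw⟩
    · exact absurd (apply_injective w hw) hpr.ne'
    · left
      obtain ⟨⟨k, hk⟩, h2⟩ := (s_lt_iff hw).1 hs
      have e1 : p = w⁻¹ i + k * n := by
        rw [← inv_apply_add_mul, eq_comm, inv_apply_eq]; linarith
      have e2 : r = w⁻¹ (i + 1) + k * n := by
        rw [← inv_apply_add_mul, eq_comm, inv_apply_eq]; linarith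
      have hN := normPair_fst (n := n) (w⁻¹ i) (w⁻¹ (i + 1))
      have e3 : p = (normPair n (w⁻¹ i) (w⁻¹ (i + 1))).1 := by
        apply eq_of_window hp hN
        simp only [normPair]
        exact ⟨k + (w⁻¹ i - 1) / n, by linarith⟩
      have e4 : k * n = -((w⁻¹ i - 1) / n * n) := by
        simp only [normPair] at e3; linarith
      ext
      · exact e3
      · simp only [normPair]; linarith
  · rintro (heq | ⟨hp, hpr, hw⟩)
    · have hN := normPair_fst (n := n) (w⁻¹ i) (w⁻¹ (i + 1))
      rw [heq]
      refine ⟨hN, by simp only [normPair]; linarith, ?_⟩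
      simp only [normPair, mul_apply', apply_sub_mul, apply_inv_self', s_self, s_succ]
      linarith
    · simp only at hp hpr hw
      refine ⟨hp, hpr, ?_⟩
      simp only [mul_apply']
      rcases lt_trichotomy (s n i (w r)) (s n i (w p)) with hs | hs | hs
      · exact hs
      · exact absurd (apply_injective w (apply_injective _ hs)) hpr.ne'
      · exfalso
        obtain ⟨⟨k, hk⟩, h2⟩ := (s_lt_iff hw).1 hs
        have e1 : r = w⁻¹ i + k * n := by
          rw [← inv_apply_add_mul, eq_comm, inv_apply_eq]; linarith
        have e2 : p = w⁻¹ (i + 1) + k * n := by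
          rw [← inv_apply_add_mul, eq_comm, inv_apply_eq]; linarith
        linarith

theorem normPair_notMem_invSet {w : AffPerm n} {i : ℤ} :
    w⁻¹ i < w⁻¹ (i + 1) → normPair n (w⁻¹ i) (w⁻¹ (i + 1)) ∉ invSet w := by
  rintro h ⟨-, -, h3⟩
  simp only [normPair, apply_sub_mul, apply_inv_self'] at h3
  linarith

theorem ncard_invSet_s_mul {w : AffPerm n} {i : ℤ} (h : w⁻¹ i < w⁻¹ (i + 1)) :
    (invSet (s n i * w)).ncard = (invSet w).ncard + 1 := by
  rw [invSet_s_mul h, Set.ncard_insert_of_notMem (normPair_notMem_invSet h) (finite_invSet w)]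

theorem inv_s_mul_apply (w : AffPerm n) (i j : ℤ) : (s n i * w)⁻¹ j = w⁻¹ (s n i j) := by
  rw [mul_inv_rev, s_inv, mul_apply']

theorem ncard_invSet_s_mul_of_desc {w : AffPerm n} {i : ℤ} (h : w⁻¹ (i + 1) < w⁻¹ i) :
    (invSet (s n i * w)).ncard + 1 = (invSet w).ncard := by
  have := ncard_invSet_s_mul (w := s n i * w) (i := i) (by simpa [inv_s_mul_apply] using h)
  rw [s_mul_self_mul] at this
  exact this.symm

theorem asc_or_desc (w : AffPerm n) (i : ℤ) : w⁻¹ i < w⁻¹ (i + 1) ∨ w⁻¹ (i + 1) < w⁻¹ i := by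
  rcases lt_trichotomy (w⁻¹ i) (w⁻¹ (i + 1)) with h | h | h
  · exact Or.inl h
  · exact absurd (apply_injective w⁻¹ h) (by omega)
  · exact Or.inr h

/-- An increasing bijection of the integers cannot skip the value w i + 1. These shifts are the
elements of length zero. -/
theorem eq_rot_of_strictMono {w : AffPerm n} (h : StrictMono (w : ℤ → ℤ)) : w = rot n ^ (w 0) := by
  have key : ∀ i, w (i + 1) = w i + 1 := by
    intro i
    have h1 := h (show i < i + 1 by omega)
    by_contra hne
    have h2 : w i < w (w⁻¹ (w i + 1)) := by simp
    have h3 : w (w⁻¹ (w i + 1)) < w (i + 1) := by rw [apply_inv_self']; omega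
    rw [h.lt_iff_lt] at h2 h3
    omega
  refine AffPerm.ext' fun i => ?_
  rw [rot_zpow_apply]
  induction i using Int.induction_on with
  | zero => simp
  | succ k ih => rw [key, ih]; ring
  | pred k ih =>
    have := key (-(k : ℤ) - 1)
    rw [sub_add_cancel, ih] at this
    linarith

theorem strictMono_of_forall_asc {w : AffPerm n} (h : ∀ i, w⁻¹ i < w⁻¹ (i + 1)) :
    StrictMono (w : ℤ → ℤ) := by
  have h1 : StrictMono (w⁻¹ : AffPerm n) := strictMono_int_of_lt_succ h
  intro x y hxy
  rw [← h1.lt_iff_lt]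
  simpa using hxy

@[simp] theorem invSet_rot_zpow (k : ℤ) : invSet (rot n ^ k) = ∅ := by
  ext ⟨p, r⟩
  simp only [invSet, rot_zpow_apply, Set.mem_ofPred_eq, Set.mem_empty_iff_false, iff_false]
  omega

theorem exists_desc {w : AffPerm n} (h : (invSet w).ncard ≠ 0) :
    ∃ i, w⁻¹ (i + 1) < w⁻¹ i := by
  by_contra! hc
  have hasc : ∀ i, w⁻¹ i < w⁻¹ (i + 1) := fun i =>
    (asc_or_desc w i).resolve_right (not_lt.2 (hc i))
  rw [eq_rot_of_strictMono (strictMono_of_forall_asc hasc)] at h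
  simp at h

/-! ### Reduced words, and length as the number of inversions. -/

@[simp] theorem wordVal_nil (k : ℤ) : wordVal n ([], k) = rot n ^ k := by simp [wordVal]

@[simp] theorem wordVal_cons (i : ℤ) (l : List ℤ) (k : ℤ) :
    wordVal n (i :: l, k) = s n i * wordVal n (l, k) := by simp [wordVal, mul_assoc]

theorem ncard_invSet_wordVal_le (l : List ℤ) (k : ℤ) :
    (invSet (wordVal n (l, k))).ncard ≤ l.length := by
  induction l with
  | nil => simp
  | cons i l ih =>
    rw [wordVal_cons, List.length_cons]
    rcases asc_or_desc (wordVal n (l, k)) i with h | h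
    · rw [ncard_invSet_s_mul h]; omega
    · have := ncard_invSet_s_mul_of_desc h; omega

theorem eq_rot_of_ncard_eq_zero {w : AffPerm n} (h : (invSet w).ncard = 0) :
    w = rot n ^ (w 0) := by
  apply eq_rot_of_strictMono
  apply strictMono_of_forall_asc
  intro i
  rcases asc_or_desc w i with h' | h'
  · exact h'
  · have := ncard_invSet_s_mul_of_desc h'; omega

theorem exists_word (w : AffPerm n) :
    ∃ p : List ℤ × ℤ, wordVal n p = w ∧ p.1.length = (invSet w).ncard := by
  induction hm : (invSet w).ncard generalizing w with
  | zero => exact ⟨([], w 0), by rw [wordVal_nil, ← eq_rot_of_ncard_eq_zero hm], rfl⟩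
  | succ m ih =>
    obtain ⟨i, hi⟩ := exists_desc (w := w) (by omega)
    obtain ⟨⟨l, k⟩, h1, h2⟩ := ih (s n i * w) (by
      have := ncard_invSet_s_mul_of_desc hi; omega)
    exact ⟨(i :: l, k), by simp [h1], by simpa using h2⟩

/-- Each letter changes the number of inversions by exactly one, and descents can be stripped off
until a power of `rot` is left. -/
theorem len_eq_ncard (w : AffPerm n) : len w = (invSet w).ncard := by
  apply le_antisymm
  · exact Nat.sInf_le (exists_word w)
  · refine le_csInf ⟨_, exists_word w⟩ ?_
    rintro m ⟨⟨l, k⟩, rfl, rfl⟩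
    exact ncard_invSet_wordVal_le l k

theorem len_s_mul {w : AffPerm n} {i : ℤ} (h : w⁻¹ i < w⁻¹ (i + 1)) :
    len (s n i * w) = len w + 1 := by
  simp only [len_eq_ncard, ncard_invSet_s_mul h]

theorem len_s_mul_of_desc {w : AffPerm n} {i : ℤ} (h : w⁻¹ (i + 1) < w⁻¹ i) :
    len (s n i * w) + 1 = len w := by
  simp only [len_eq_ncard, ncard_invSet_s_mul_of_desc h]

theorem isReduced_redWord (w : AffPerm n) : IsReduced w (redWord w) :=
  Classical.epsilon_spec (p := IsReduced w)
    (let ⟨p, h1, h2⟩ := exists_word w; ⟨p, h1, by rw [h2, len_eq_ncard]⟩)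

theorem wordVal_redWord (w : AffPerm n) : wordVal n (redWord w) = w := (isReduced_redWord w).1

theorem len_wordVal_le (l : List ℤ) (k : ℤ) : len (wordVal n (l, k)) ≤ l.length := by
  rw [len_eq_ncard]; exact ncard_invSet_wordVal_le l k

theorem IsReduced.desc {w : AffPerm n} {i : ℤ} {l : List ℤ} {k : ℤ}
    (h : IsReduced w (i :: l, k)) : w⁻¹ (i + 1) < w⁻¹ i := by
  obtain ⟨h1, h2⟩ := h
  rcases asc_or_desc w i with h' | h'
  · exfalso
    have h3 := len_s_mul h'
    have h4 := len_wordVal_le (n := n) l k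
    rw [← h1, wordVal_cons, s_mul_self_mul] at h3
    rw [← h1, wordVal_cons] at h2
    simp only [List.length_cons] at h2
    omega
  · exact h'

theorem IsReduced.tail {w : AffPerm n} {i : ℤ} {l : List ℤ} {k : ℤ}
    (h : IsReduced w (i :: l, k)) : IsReduced (s n i * w) (l, k) := by
  have h3 := len_s_mul_of_desc h.desc
  obtain ⟨h1, h2⟩ := h
  refine ⟨by rw [← h1, wordVal_cons, s_mul_self_mul], ?_⟩
  simp only [List.length_cons] at h2 ⊢
  omega

theorem IsReduced.cons {w : AffPerm n} {i : ℤ} {l : List ℤ} {k : ℤ}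
    (h : IsReduced (s n i * w) (l, k)) (hd : w⁻¹ (i + 1) < w⁻¹ i) :
    IsReduced w (i :: l, k) := by
  have h3 := len_s_mul_of_desc hd
  obtain ⟨h1, h2⟩ := h
  refine ⟨by rw [wordVal_cons, h1, s_mul_self_mul], ?_⟩
  simp only [List.length_cons] at h2 ⊢
  omega

theorem exists_isReduced (w : AffPerm n) : ∃ l k, IsReduced w (l, k) :=
  ⟨_, _, isReduced_redWord w⟩

theorem len_rot_mul (w : AffPerm n) : len (rot n * w) = len w := by
  have key : ∀ w : AffPerm n, invSet (rot n * w) = invSet w := by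
    intro w
    ext ⟨p, r⟩
    simp only [invSet, mul_apply', rot_apply, Set.mem_ofPred_eq, add_lt_add_iff_right]
  rw [len_eq_ncard, len_eq_ncard, key]

theorem wordVal_shift (l : List ℤ) (k : ℤ) :
    wordVal n (l.map (· + 1), k + 1) = rot n * wordVal n (l, k) := by
  induction l with
  | nil => simp [zpow_add_one, ← zpow_one_add, add_comm]
  | cons i l ih =>
    rw [List.map_cons, wordVal_cons, ih, wordVal_cons, ← mul_assoc, ← mul_assoc, rot_mul_s]

theorem IsReduced.shift {w : AffPerm n} {l : List ℤ} {k : ℤ} (h : IsReduced w (l, k)) :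
    IsReduced (rot n * w) (l.map (· + 1), k + 1) :=
  ⟨by rw [wordVal_shift, h.1], by rw [len_rot_mul]; simpa using h.2⟩

end AffinePermutations
end DAHA

namespace DAHA

/-! ### The elements `T_w` of the double affine Hecke algebra -/

section Hecke

variable {K : Type*} [Field K] {n : ℕ} {q t : Kˣ}

local notation "𝐓[" i "]" => gen n q t (Gen.T i)
local notation "𝐘[" i "]" => gen n q t (Gen.Y i)
local notation "𝐘⁻[" i "]" => gen n q t (Gen.YInv i)
local notation "𝛑" => gen n q t Gen.pi
local notation "𝛑⁻" => gen n q t Gen.piInv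

theorem gen_T_periodic (i : ℤ) : 𝐓[i + n] = 𝐓[i] :=
  RingQuot.mkAlgHom_rel K (Rel.T_periodic (n := n) (q := q) (t := t) i)

theorem gen_T_congr {i j : ℤ} (h : (n : ℤ) ∣ i - j) : 𝐓[i] = 𝐓[j] := by
  obtain ⟨k, hk⟩ := h
  rw [show i = j + k * n by linarith]
  induction k using Int.induction_on generalizing i with
  | zero => simp
  | succ k ih =>
    rw [show j + ((k : ℤ) + 1) * n = (j + k * n) + n by ring, gen_T_periodic]
    exact ih (i := j + k * n) (by ring)
  | pred k ih =>
    rw [← gen_T_periodic, show j + (-(k : ℤ) - 1) * n + n = j + -(k : ℤ) * n by ring]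
    exact ih (i := j + -(k : ℤ) * n) (by ring)

theorem gen_quadratic (i : ℤ) :
    (𝐓[i] - algebraMap K _ (t : K)) * (𝐓[i] + algebraMap K _ ((t⁻¹ : Kˣ) : K)) = 0 := by
  simpa [gen] using RingQuot.mkAlgHom_rel K (Rel.quadratic (n := n) (q := q) (t := t) i)

theorem gen_T_mul_self (i : ℤ) :
    𝐓[i] * 𝐓[i] = ((t : K) - (t : K)⁻¹) • 𝐓[i] + 1 := by
  have h := gen_quadratic (n := n) (q := q) (t := t) i
  rw [sub_mul, mul_add, mul_add, ← Algebra.commutes, ← map_mul, ← Units.val_mul,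
    mul_inv_cancel, Units.val_one, map_one, ← Algebra.smul_def, ← Algebra.smul_def] at h
  rw [Units.val_inv_eq_inv_val] at h
  rw [← sub_eq_zero, ← h]
  module

theorem gen_braid (hn : n ≠ 2) (i : ℤ) :
    𝐓[i] * 𝐓[i + 1] * 𝐓[i] = 𝐓[i + 1] * 𝐓[i] * 𝐓[i + 1] := by
  simpa [gen] using RingQuot.mkAlgHom_rel K (Rel.braid (n := n) (q := q) (t := t) i hn)

theorem gen_T_comm {i j : ℤ} (h₁ : ¬ (n : ℤ) ∣ j - (i + 1)) (h₂ : ¬ (n : ℤ) ∣ j - (i - 1)) :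
    𝐓[i] * 𝐓[j] = 𝐓[j] * 𝐓[i] := by
  simpa [gen] using RingQuot.mkAlgHom_rel K (Rel.T_comm (n := n) (q := q) (t := t) i j h₁ h₂)

theorem gen_pi_T (i : ℤ) : 𝛑 * 𝐓[i] = 𝐓[i + 1] * 𝛑 := by
  simpa [gen] using RingQuot.mkAlgHom_rel K (Rel.pi_T (n := n) (q := q) (t := t) i)

theorem gen_pi_Y (i : ℤ) : 𝛑 * 𝐘[i] = 𝐘[i + 1] * 𝛑 := by
  simpa [gen] using RingQuot.mkAlgHom_rel K (Rel.pi_Y (n := n) (q := q) (t := t) i)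

theorem gen_T_Y_T (i : ℤ) : 𝐓[i] * 𝐘[i] * 𝐓[i] = 𝐘[i + 1] := by
  simpa [gen] using RingQuot.mkAlgHom_rel K (Rel.T_Y_T (n := n) (q := q) (t := t) i)

theorem gen_T_Y_comm {i j : ℤ} (h₁ : ¬ (n : ℤ) ∣ j - i) (h₂ : ¬ (n : ℤ) ∣ j - (i + 1)) :
    𝐓[i] * 𝐘[j] = 𝐘[j] * 𝐓[i] := by
  simpa [gen] using RingQuot.mkAlgHom_rel K (Rel.T_Y_comm (n := n) (q := q) (t := t) i j h₁ h₂)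

theorem val_piUnit : (piUnit n q t : H n q t) = 𝛑 := rfl

theorem val_piUnit_inv : ((piUnit n q t)⁻¹ : (H n q t)ˣ) = 𝛑⁻ := rfl

theorem gen_YInv_mul_Y (i : ℤ) : 𝐘⁻[i] * 𝐘[i] = 1 := (yUnit n q t i).inv_val

/-- Moving `Y_j` to the right of `T_i`. -/
theorem gen_Y_mul_T [n.AtLeastTwo] (i j : ℤ) :
    ∃ κ : K, 𝐘[j] * 𝐓[i] = 𝐓[i] * 𝐘[s n i j] + κ • 𝐘[i + 1] := by
  have hc : 𝐘[i + 1] * 𝐓[i] =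
      𝐓[i] * 𝐘[i] + ((t : K) - (t : K)⁻¹) • 𝐘[i + 1] := by
    rw [← gen_T_Y_T, mul_assoc, gen_T_mul_self, mul_add, mul_one, mul_smul_comm, add_comm]
  have hd : 𝐘[i] * 𝐓[i] = 𝐓[i] * 𝐘[i + 1] + (-((t : K) - (t : K)⁻¹)) • 𝐘[i + 1] := by
    have h : 𝐓[i] * 𝐘[i + 1] =
        ((t : K) - (t : K)⁻¹) • 𝐘[i + 1] + 𝐘[i] * 𝐓[i] := by
      rw [← gen_T_Y_T, mul_assoc, ← mul_assoc, gen_T_mul_self, add_mul, one_mul, smul_mul_assoc]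
    rw [h]
    module
  by_cases h1 : (n : ℤ) ∣ j - i
  · obtain ⟨k, hk⟩ := h1
    refine ⟨((q ^ (-k) : Kˣ) : K) * (-((t : K) - (t : K)⁻¹)), ?_⟩
    rw [s_apply_of_dvd ⟨k, hk⟩, show j = i + k * n by linarith,
      show i + k * n + 1 = i + 1 + k * n by ring, gen_periodic, gen_periodic, smul_mul_assoc, hd,
      smul_add, mul_smul_comm, smul_smul]
  · by_cases h2 : (n : ℤ) ∣ j - (i + 1)
    · obtain ⟨k, hk⟩ := h2
      refine ⟨((q ^ (-k) : Kˣ) : K) * ((t : K) - (t : K)⁻¹), ?_⟩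
      rw [s_apply_of_dvd_succ ⟨k, hk⟩, show j = i + 1 + k * n by linarith,
        show i + 1 + k * n - 1 = i + k * n by ring, gen_periodic, gen_periodic, smul_mul_assoc, hc,
        smul_add, mul_smul_comm, smul_smul]
    · exact ⟨0, by rw [s_apply_of_not h1 h2, gen_T_Y_comm h1 h2, zero_smul, add_zero]⟩

variable (n q t) in
/-- The product `T_{i_1} ⋯ T_{i_m} π ^ k` attached to a word. -/
def wordT (p : List ℤ × ℤ) : H n q t :=
  (p.1.map fun i => 𝐓[i]).prod * ((piUnit n q t ^ p.2 : (H n q t)ˣ) : H n q t)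

theorem wordT_cons (i : ℤ) (l : List ℤ) (k : ℤ) :
    wordT n q t (i :: l, k) = 𝐓[i] * wordT n q t (l, k) := by
  simp [wordT, mul_assoc]

theorem wordT_shift (l : List ℤ) (k : ℤ) :
    wordT n q t (l.map (· + 1), k + 1) = 𝛑 * wordT n q t (l, k) := by
  induction l with
  | nil => simp [wordT, add_comm k 1, zpow_one_add, val_piUnit]
  | cons i l ih => rw [List.map_cons, wordT_cons, ih, wordT_cons, ← mul_assoc, ← gen_pi_T, mul_assoc]

variable [n.AtLeastTwo]

theorem Tw_eq_wordT (w : AffPerm n) : Tw q t w = wordT n q t (redWord w) := rfl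

theorem inv_lt_congr {w : AffPerm n} {i j : ℤ} (h : (n : ℤ) ∣ j - i) :
    w⁻¹ (j + 1) < w⁻¹ j ↔ w⁻¹ (i + 1) < w⁻¹ i := by
  obtain ⟨k, hk⟩ := h
  rw [show j = i + k * n by linarith, show i + k * n + 1 = i + 1 + k * n by ring,
    inv_apply_add_mul, inv_apply_add_mul, add_lt_add_iff_right]

/-- The case of adjacent first letters in Matsumoto's argument. If i and i + 1 are both descents, w
starts with s_i s_{i+1} s_i, and the two words are compared through reduced words beginning with the
two sides of the braid relation. -/
theorem wordT_eq_of_braid {w : AffPerm n}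
    (ih : ∀ v : AffPerm n, len v < len w → ∀ p p', IsReduced v p → IsReduced v p' →
      wordT n q t p = wordT n q t p')
    {i j : ℤ} {l l' : List ℤ} {k k' : ℤ} (h : IsReduced w (i :: l, k))
    (h' : IsReduced w (j :: l', k')) (hij : (n : ℤ) ∣ j - (i + 1)) :
    wordT n q t (i :: l, k) = wordT n q t (j :: l', k') := by
  have d1 := h.desc
  have d2 := (inv_lt_congr hij).1 h'.desc
  -- For n = 2 the two descents would give w⁻¹ (i + 2) < w⁻¹ i, against w⁻¹ (i + 2) = w⁻¹ i + 2.
  have hn2 : n ≠ 2 := by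
    rintro rfl
    have := inv_apply_add_mul w i 1
    rw [show i + 1 * ((2 : ℕ) : ℤ) = i + 1 + 1 by push_cast; ring] at this
    omega
  have n3 : ¬ (n : ℤ) ∣ 2 := fun h => by
    have := Int.le_of_dvd (by norm_num) h
    have := two_le n
    omega
  have n1 := not_dvd_one n
  have a1 : s n i (i + 1 + 1) = i + 1 + 1 := s_apply_of_not
    (by rwa [show i + 1 + 1 - i = 2 by ring]) (by rwa [show i + 1 + 1 - (i + 1) = 1 by ring])
  have a2 : s n (i + 1) i = i := s_apply_of_not
    (by rwa [show i - (i + 1) = -1 by ring, dvd_neg])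
    (by rwa [show i - (i + 1 + 1) = -2 by ring, dvd_neg])
  have hs : s n j = s n (i + 1) := s_congr hij
  -- The common tail that remains after the braid prefix is removed.
  obtain ⟨m, c, hm⟩ := exists_isReduced (s n i * (s n (i + 1) * (s n i * w)))
  have r1 : IsReduced (s n i * w) ((i + 1) :: i :: m, c) := by
    refine (hm.cons ?_).cons ?_
    · simp only [inv_s_mul_apply, a1, a2, s_self]; exact d2
    · simp only [inv_s_mul_apply, a1, s_succ]; exact d2.trans d1
  have hm' := hm
  rw [← mul_assoc, ← mul_assoc, s_braid hn2, mul_assoc, mul_assoc] at hm'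
  have r2 : IsReduced (s n (i + 1) * w) (i :: (i + 1) :: m, c) := by
    refine (hm'.cons ?_).cons ?_
    · simp only [inv_s_mul_apply, a1, a2, s_succ]; exact d1
    · simp only [inv_s_mul_apply, a2, s_self]; exact d2.trans d1
  have l1 := len_s_mul_of_desc d1
  have l2 := len_s_mul_of_desc d2
  have e : 𝐓[j] = 𝐓[i + 1] := gen_T_congr hij
  rw [wordT_cons, wordT_cons, ih _ (by omega) _ _ h.tail r1,
    ih _ (by omega) _ _ (hs ▸ h'.tail : IsReduced (s n (i + 1) * w) (l', k')) r2, e]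
  simp only [wordT_cons, ← mul_assoc, gen_braid hn2]

/-- `T_w` does not depend on the choice of a reduced word. -/
theorem wordT_eq_of_isReduced {w : AffPerm n} {p p' : List ℤ × ℤ}
    (h : IsReduced w p) (h' : IsReduced w p') : wordT n q t p = wordT n q t p' := by
  induction hm : len w using Nat.strong_induction_on generalizing w p p' with
  | _ m ih =>
    subst hm
    replace ih : ∀ v : AffPerm n, len v < len w → ∀ p p', IsReduced v p → IsReduced v p' →
      wordT n q t p = wordT n q t p' := fun v hv p p' h1 h2 => ih _ hv h1 h2 rfl
    obtain ⟨l, k⟩ := p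
    obtain ⟨l', k'⟩ := p'
    have hl : l.length = l'.length := h.2.trans h'.2.symm
    match l, l', hl with
    | [], [], _ =>
      have e := h.1.trans h'.1.symm
      have : k = k' := by
        have := congrArg (fun v : AffPerm n => v 0) e
        simpa only [rot_zpow_apply, zero_add, wordVal_nil] using this
      rw [this]
    | i :: l, j :: l', _ =>
      have d1 := h.desc
      have d2 := h'.desc
      have l1 := len_s_mul_of_desc d1
      have l2 := len_s_mul_of_desc d2
      by_cases c1 : (n : ℤ) ∣ i - j
      · rw [wordT_cons, wordT_cons, gen_T_congr c1,
          ih _ (by omega) _ _ h.tail (s_congr c1 ▸ h'.tail)]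
      by_cases c2 : (n : ℤ) ∣ j - (i + 1)
      · exact wordT_eq_of_braid ih h h' c2
      by_cases c3 : (n : ℤ) ∣ j - (i - 1)
      · refine (wordT_eq_of_braid ih h' h ?_).symm
        rwa [← dvd_neg, show -(i - (j + 1)) = j - (i - 1) by ring]
      -- In the remaining case the two first letters commute, and both can be brought to the front
      -- over a common tail.
      have c1' : ¬ (n : ℤ) ∣ j - i := by rwa [← dvd_neg, neg_sub]
      have a1 : s n i j = j := s_apply_of_not c1' c2
      have a2 : s n i (j + 1) = j + 1 := s_apply_of_not
        (by rwa [show j + 1 - i = j - (i - 1) by ring])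
        (by rwa [show j + 1 - (i + 1) = j - i by ring])
      have a3 : s n j i = i := s_apply_of_not c1
        (by rwa [← dvd_neg, show -(i - (j + 1)) = j - (i - 1) by ring])
      have a4 : s n j (i + 1) = i + 1 := s_apply_of_not
        (by rwa [← dvd_neg, show -(i + 1 - j) = j - (i + 1) by ring])
        (by rwa [show i + 1 - (j + 1) = i - j by ring])
      obtain ⟨m, c, hm⟩ := exists_isReduced (s n j * (s n i * w))
      have r1 : IsReduced (s n i * w) (j :: m, c) := hm.cons (by
        simp only [inv_s_mul_apply, a1, a2]; exact d2)
      have hm' := hm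
      rw [← mul_assoc, ← s_comm c2 c3, mul_assoc] at hm'
      have r2 : IsReduced (s n j * w) (i :: m, c) := hm'.cons (by
        simp only [inv_s_mul_apply, a3, a4]; exact d1)
      rw [wordT_cons, wordT_cons, ih _ (by omega) _ _ h.tail r1, ih _ (by omega) _ _ h'.tail r2,
        wordT_cons, wordT_cons, ← mul_assoc, ← mul_assoc, gen_T_comm c2 c3]

theorem Tw_eq_of_isReduced {w : AffPerm n} {p : List ℤ × ℤ} (h : IsReduced w p) :
    Tw q t w = wordT n q t p := wordT_eq_of_isReduced (isReduced_redWord w) h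

theorem gen_T_mul_Tw {w : AffPerm n} {i : ℤ} (h : w⁻¹ i < w⁻¹ (i + 1)) :
    𝐓[i] * Tw q t w = Tw q t (s n i * w) := by
  rw [Tw_eq_wordT, ← wordT_cons]
  refine (Tw_eq_of_isReduced (IsReduced.cons ?_ ?_)).symm
  · rw [s_mul_self_mul]; exact isReduced_redWord w
  · simpa [inv_s_mul_apply] using h

theorem gen_T_mul_Tw_of_desc {w : AffPerm n} {i : ℤ} (h : w⁻¹ (i + 1) < w⁻¹ i) :
    𝐓[i] * Tw q t w = Tw q t (s n i * w) + ((t : K) - (t : K)⁻¹) • Tw q t w := by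
  have h' : Tw q t w = 𝐓[i] * Tw q t (s n i * w) := by
    rw [gen_T_mul_Tw, s_mul_self_mul]
    simpa [inv_s_mul_apply] using h
  rw [h', ← mul_assoc, gen_T_mul_self, add_mul, one_mul, smul_mul_assoc, add_comm]

theorem gen_pi_mul_Tw (w : AffPerm n) : 𝛑 * Tw q t w = Tw q t (rot n * w) := by
  rw [Tw_eq_wordT, ← wordT_shift]
  exact (Tw_eq_of_isReduced (isReduced_redWord w).shift).symm

theorem gen_piInv_mul_Tw (w : AffPerm n) : 𝛑⁻ * Tw q t w = Tw q t ((rot n)⁻¹ * w) := by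
  have h := gen_pi_mul_Tw (q := q) (t := t) ((rot n)⁻¹ * w)
  rw [mul_inv_cancel_left] at h
  rw [← h, ← mul_assoc]
  have : 𝛑⁻ * 𝛑 = 1 := (piUnit n q t).inv_val
  rw [this, one_mul]

theorem Tw_rot_zpow (k : ℤ) :
    Tw q t (rot n ^ k) = ((piUnit n q t ^ k : (H n q t)ˣ) : H n q t) := by
  rw [Tw_eq_of_isReduced (p := ([], k)) ⟨wordVal_nil k, by simp [len_eq_ncard]⟩]
  simp [wordT]

@[simp] theorem Tw_one : Tw q t (1 : AffPerm n) = 1 := by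
  simpa using Tw_rot_zpow (n := n) (q := q) (t := t) 0

end Hecke
end DAHA

namespace DAHA

/-! ### Length filtrations and spanning sets -/

section Filtration

variable {n : ℕ} [n.AtLeastTwo] {A B : Type*} [Ring A] [CommRing B] (j : B →+* A)
  (T : AffPerm n → A)

/-- The span of the `T_x b` with `x` of length less than `m`. -/
def fil (m : ℕ) : AddSubgroup A :=
  AddSubgroup.closure {a | ∃ x b, len x < m ∧ a = T x * j b}

/-- The span of all `T_x b`. -/
def filTop : AddSubgroup A := AddSubgroup.closure {a | ∃ x b, a = T x * j b}

variable {j T}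

theorem mem_fil {m : ℕ} {x : AffPerm n} (h : len x < m) (b : B) : T x * j b ∈ fil j T m :=
  AddSubgroup.subset_closure ⟨x, b, h, rfl⟩

theorem mem_filTop (x : AffPerm n) (b : B) : T x * j b ∈ filTop j T :=
  AddSubgroup.subset_closure ⟨x, b, rfl⟩

theorem mem_fil_one {m : ℕ} {x : AffPerm n} (h : len x < m) : T x ∈ fil j T m := by
  simpa using mem_fil (j := j) (T := T) h 1

theorem fil_mono {m m' : ℕ} (h : m ≤ m') : fil j T m ≤ fil j T m' :=
  AddSubgroup.closure_mono fun _ ⟨x, b, hx, ha⟩ => ⟨x, b, hx.trans_le h, ha⟩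

theorem fil_le_filTop (m : ℕ) : fil j T m ≤ filTop j T :=
  AddSubgroup.closure_mono fun _ ⟨x, b, _, ha⟩ => ⟨x, b, ha⟩

theorem fil_mul_right {m : ℕ} {a : A} (h : a ∈ fil j T m) (b : B) : a * j b ∈ fil j T m := by
  induction h using AddSubgroup.closure_induction with
  | mem a ha =>
    obtain ⟨x, c, hx, rfl⟩ := ha
    rw [mul_assoc, ← map_mul]
    exact mem_fil hx _
  | zero => rw [zero_mul]; exact zero_mem _
  | add a a' _ _ h h' => rw [add_mul]; exact add_mem h h'
  | neg a _ h => rw [neg_mul]; exact neg_mem h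

theorem mul_mem_of_forall {S S' : AddSubgroup A} {G : Set A} (hS : S = AddSubgroup.closure G)
    {z : A} (h : ∀ a ∈ G, z * a ∈ S') {a : A} (ha : a ∈ S) : z * a ∈ S' := by
  subst hS
  induction ha using AddSubgroup.closure_induction with
  | mem a ha => exact h a ha
  | zero => rw [mul_zero]; exact zero_mem _
  | add a a' _ _ h h' => rw [mul_add]; exact add_mem h h'
  | neg a _ h => rw [mul_neg]; exact neg_mem h

theorem mul_mem_fil {m m' : ℕ} {z : A}
    (h : ∀ x : AffPerm n, len x < m → z * T x ∈ fil j T m') {a : A} (ha : a ∈ fil j T m) :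
    z * a ∈ fil j T m' := by
  refine mul_mem_of_forall rfl ?_ ha
  rintro _ ⟨x, b, hx, rfl⟩
  rw [← mul_assoc]
  exact fil_mul_right (h x hx) b

theorem mul_mem_filTop {z : A} (h : ∀ x : AffPerm n, ∃ m, z * T x ∈ fil j T m) {a : A}
    (ha : a ∈ filTop j T) : z * a ∈ filTop j T := by
  refine mul_mem_of_forall rfl ?_ ha
  rintro _ ⟨x, b, rfl⟩
  obtain ⟨m, hm⟩ := h x
  rw [← mul_assoc]
  exact fil_le_filTop m (fil_mul_right hm b)

/-- `y` acts on the `T_x` in a triangular way, with diagonal entries `b x`. -/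
def IsTriangular (j : B →+* A) (T : AffPerm n → A) (y : A) (b : AffPerm n → B) : Prop :=
  ∀ x, y * T x - T x * j (b x) ∈ fil j T (len x)

theorem IsTriangular.mul_T_mem {y : A} {b : AffPerm n → B} (h : IsTriangular j T y b)
    (x : AffPerm n) : y * T x ∈ fil j T (len x + 1) := by
  rw [← sub_add_cancel (y * T x) (T x * j (b x))]
  exact add_mem (fil_mono (Nat.le_succ _) (h x)) (mem_fil (Nat.lt_succ_self _) _)

/-- Solving for z T_x gives T_x b'_x minus z applied to terms of smaller length, so induction on the
length applies. No formula for the inverse is needed. -/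
theorem IsTriangular.inv_mul_T_mem {y z : A} {b b' : AffPerm n → B} (h : IsTriangular j T y b)
    (hb : ∀ x, b x * b' x = 1) (hz : z * y = 1) (x : AffPerm n) :
    z * T x ∈ fil j T (len x + 1) := by
  induction hm : len x using Nat.strong_induction_on generalizing x with
  | _ m ih =>
    subst hm
    have e : z * T x = T x * j (b' x) - z * ((y * T x - T x * j (b x)) * j (b' x)) := by
      have h1 : T x * j (b x) * j (b' x) = T x := by rw [mul_assoc, ← map_mul, hb, map_one, mul_one]
      have h2 : z * (y * T x * j (b' x)) = T x * j (b' x) := by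
        rw [← mul_assoc, ← mul_assoc, hz, one_mul]
      rw [sub_mul, h1, mul_sub, h2]
      abel
    rw [e]
    refine sub_mem (mem_fil (Nat.lt_succ_self _) _) (fil_mono (Nat.le_succ _) ?_)
    exact mul_mem_fil (fun v hv => fil_mono hv (ih _ hv v rfl)) (fil_mul_right (h x) _)

theorem exists_finsupp_of_mem_fil {m : ℕ} {a : A} (h : a ∈ fil j T m) :
    ∃ g : AffPerm n →₀ B, (∀ x, m ≤ len x → g x = 0) ∧ a = g.sum fun x b => T x * j b := by
  classical
  induction h using AddSubgroup.closure_induction with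
  | mem a ha =>
    obtain ⟨x, c, hx, rfl⟩ := ha
    refine ⟨Finsupp.single x c, fun y hy => ?_, by simp⟩
    rw [Finsupp.single_apply, if_neg]
    rintro rfl
    omega
  | zero => exact ⟨0, by simp, by simp⟩
  | add a a' _ _ h h' =>
    obtain ⟨g, h1, rfl⟩ := h
    obtain ⟨g', h1', rfl⟩ := h'
    refine ⟨g + g', fun x hx => by simp [h1 x hx, h1' x hx], ?_⟩
    rw [Finsupp.sum_add_index'] <;> simp [mul_add]
  | neg a _ h =>
    obtain ⟨g, h1, rfl⟩ := h
    refine ⟨-g, fun x hx => by simp [h1 x hx], ?_⟩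
    rw [Finsupp.sum_neg_index] <;> simp [Finsupp.sum]

theorem exists_finsupp_of_mem_filTop {a : A} (h : a ∈ filTop j T) :
    ∃ g : AffPerm n →₀ B, a = g.sum fun x b => T x * j b := by
  classical
  induction h using AddSubgroup.closure_induction with
  | mem a ha =>
    obtain ⟨x, c, rfl⟩ := ha
    exact ⟨Finsupp.single x c, by simp⟩
  | zero => exact ⟨0, by simp⟩
  | add a a' _ _ h h' =>
    obtain ⟨g, rfl⟩ := h
    obtain ⟨g', rfl⟩ := h'
    refine ⟨g + g', ?_⟩
    rw [Finsupp.sum_add_index'] <;> simp [mul_add]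
  | neg a _ h =>
    obtain ⟨g, rfl⟩ := h
    refine ⟨-g, ?_⟩
    rw [Finsupp.sum_neg_index] <;> simp [Finsupp.sum]

theorem mem_of_generators {K X : Type*} [Field K] [Algebra K A] (φ : FreeAlgebra K X →ₐ[K] A)
    (hφ : Function.Surjective φ) {S : AddSubgroup A} (hc : ∀ (c : K), ∀ a ∈ S, c • a ∈ S)
    (h1 : (1 : A) ∈ S) (hX : ∀ x, ∀ a ∈ S, φ (FreeAlgebra.ι K x) * a ∈ S) (a : A) : a ∈ S := by
  obtain ⟨z, rfl⟩ := hφ a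
  suffices ∀ a ∈ S, φ z * a ∈ S by simpa using this 1 h1
  induction z using FreeAlgebra.induction with
  | grade0 c =>
    intro a ha
    rw [AlgHom.commutes, ← Algebra.smul_def]
    exact hc c a ha
  | grade1 x => exact hX x
  | mul x y hx hy =>
    intro a ha
    rw [map_mul, mul_assoc]
    exact hx _ (hy _ ha)
  | add x y hx hy =>
    intro a ha
    rw [map_add, add_mul]
    exact add_mem (hx _ ha) (hy _ ha)

end Filtration

/-! ### The elements T_x times Laurent polynomials span the algebra and its localization. -/

section Spanning

variable {K : Type*} [Field K] {n : ℕ} {q t : Kˣ} [n.AtLeastTwo]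

local notation "𝐓[" i "]" => gen n q t (Gen.T i)
local notation "𝐘[" i "]" => gen n q t (Gen.Y i)
local notation "𝐘⁻[" i "]" => gen n q t (Gen.YInv i)
local notation "𝛑" => gen n q t Gen.pi
local notation "𝛑⁻" => gen n q t Gen.piInv

variable (n q t) in
/-- The length filtration of the double affine Hecke algebra. -/
def filH (m : ℕ) : AddSubgroup (H n q t) :=
  fil (laurentToH n q t : Laurent K n →+* H n q t) (Tw q t) m

theorem Tw_mem_filH {m : ℕ} {x : AffPerm n} (h : len x < m) : Tw q t x ∈ filH n q t m :=
  mem_fil_one h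

theorem filH_mul_right {m : ℕ} {a : H n q t} (h : a ∈ filH n q t m) (b : Laurent K n) :
    a * laurentToH n q t b ∈ filH n q t m := fil_mul_right h b

theorem smul_mem_filH {m : ℕ} {a : H n q t} (h : a ∈ filH n q t m) (c : K) :
    c • a ∈ filH n q t m := by
  have := filH_mul_right h (algebraMap K _ c)
  rwa [AlgHom.commutes, ← Algebra.commutes, ← Algebra.smul_def] at this

theorem gen_T_mul_Tw_mem (i : ℤ) (x : AffPerm n) : 𝐓[i] * Tw q t x ∈ filH n q t (len x + 2) := by
  rcases asc_or_desc x i with h | h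
  · rw [gen_T_mul_Tw h]
    exact Tw_mem_filH (by rw [len_s_mul h]; omega)
  · rw [gen_T_mul_Tw_of_desc h]
    have := len_s_mul_of_desc h
    exact add_mem (Tw_mem_filH (by omega)) (smul_mem_filH (Tw_mem_filH (by omega)) _)

theorem gen_T_mul_mem_filH (i : ℤ) {m : ℕ} {a : H n q t} (ha : a ∈ filH n q t m) :
    𝐓[i] * a ∈ filH n q t (m + 1) :=
  mul_mem_fil (fun x hx => fil_mono (by omega) (gen_T_mul_Tw_mem i x)) ha

theorem gen_Y_zpow_pi (i k : ℤ) :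
    𝐘[i] * ((piUnit n q t ^ k : (H n q t)ˣ) : H n q t) =
      ((piUnit n q t ^ k : (H n q t)ˣ) : H n q t) * 𝐘[i - k] := by
  induction k using Int.induction_on generalizing i with
  | zero => simp
  | succ k ih =>
    rw [zpow_add_one, Units.val_mul, ← mul_assoc, ih, mul_assoc, mul_assoc, val_piUnit, gen_pi_Y,
      show i - k = i - (k + 1) + 1 by ring]
  | pred k ih =>
    have h : ∀ i, 𝐘[i] * ((piUnit n q t)⁻¹ : (H n q t)ˣ) = ((piUnit n q t)⁻¹ : (H n q t)ˣ) *
        𝐘[i + 1] := by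
      intro i
      rw [Units.eq_inv_mul_iff_mul_eq, ← mul_assoc, val_piUnit, gen_pi_Y, mul_assoc,
        ← val_piUnit, Units.mul_inv, mul_one]
    rw [zpow_sub_one, Units.val_mul, ← mul_assoc, ih, mul_assoc, mul_assoc, h,
      show i - (-(k : ℤ) - 1) = i - -(k : ℤ) + 1 by ring]

/-- Induction on the length, with x = s_i x'. By `gen_Y_mul_T`, moving Y_j past T_i turns it into
Y_{s_i j} and leaves a multiple of Y_{i+1} T_{x'}, which involves only lengths up to that of x'. -/
theorem isTriangular_Y (j : ℤ) :
    IsTriangular (laurentToH n q t : Laurent K n →+* H n q t) (Tw q t) 𝐘[j]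
      fun x => yL q (x⁻¹ j) := by
  intro x
  change 𝐘[j] * Tw q t x - Tw q t x * laurentToH n q t (yL q (x⁻¹ j)) ∈ filH n q t (len x)
  rw [laurentToH_yL]
  induction hm : len x generalizing x j with
  | zero =>
    have hx := eq_rot_of_ncard_eq_zero (w := x) (by rw [← len_eq_ncard, hm])
    have e : x⁻¹ j = j - x 0 := by
      rw [inv_apply_eq, hx, rot_zpow_apply, rot_zpow_apply]; ring
    rw [e, hx, Tw_rot_zpow, gen_Y_zpow_pi, rot_zpow_apply, zero_add, sub_self]
    exact zero_mem _
  | succ m ih =>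
    obtain ⟨i, hi⟩ := exists_desc (w := x) (by rw [← len_eq_ncard]; omega)
    obtain ⟨x', rfl⟩ : ∃ x', x = s n i * x' := ⟨s n i * x, by simp⟩
    simp only [inv_s_mul_apply, s_self, s_succ] at hi ⊢
    have hl := len_s_mul hi
    rw [← gen_T_mul_Tw hi]
    obtain ⟨κ, hκ⟩ := gen_Y_mul_T (n := n) (q := q) (t := t) i j
    have e : 𝐘[j] * (𝐓[i] * Tw q t x') - 𝐓[i] * Tw q t x' * 𝐘[x'⁻¹ (s n i j)] =
        𝐓[i] * (𝐘[s n i j] * Tw q t x' - Tw q t x' * 𝐘[x'⁻¹ (s n i j)]) +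
          κ • (𝐘[i + 1] * Tw q t x') := by
      rw [← mul_assoc, hκ, add_mul, smul_mul_assoc, mul_sub]
      simp only [mul_assoc]
      abel
    rw [e]
    refine add_mem (gen_T_mul_mem_filH i (ih (s n i j) x' (by omega))) (smul_mem_filH ?_ κ)
    rw [← sub_add_cancel (𝐘[i + 1] * Tw q t x') (Tw q t x' * 𝐘[x'⁻¹ (i + 1)])]
    refine add_mem (fil_mono (by omega) (ih (i + 1) x' (by omega))) ?_
    rw [← laurentToH_yL]
    exact filH_mul_right (Tw_mem_filH (by omega)) _

theorem exists_mul_yL (q : Kˣ) (i : ℤ) : ∃ b : Laurent K n, yL q i * b = 1 := by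
  refine ⟨((q ^ ((i - 1) / n) : Kˣ) : K) •
    MonoidAlgebra.of K _ (Pi.mulSingle (idx n i) (Multiplicative.ofAdd (-1))), ?_⟩
  simp only [yL, ext]
  rw [smul_mul_smul_comm, ← map_mul, ← Pi.mulSingle_mul, ← ofAdd_add, ← Units.val_mul, ← zpow_add]
  simp [MonoidAlgebra.one_def]

/-- The spanning half of PBW: the span contains 1 and is stable under left multiplication by each
generator. For the inverses of the Y_i this stability comes from inverting a triangular operator. -/
theorem mem_filTop_H (h : H n q t) :
    h ∈ filTop (laurentToH n q t : Laurent K n →+* H n q t) (Tw q t) := by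
  refine mem_of_generators (RingQuot.mkAlgHom K (Rel n q t)) (RingQuot.mkAlgHom_surjective K _)
    ?_ ?_ ?_ h
  · intro c a ha
    rw [Algebra.smul_def]
    refine mul_mem_filTop (fun x => ⟨len x + 1, ?_⟩) ha
    rw [← Algebra.smul_def]
    exact smul_mem_filH (Tw_mem_filH (Nat.lt_succ_self _)) c
  · simpa using mem_filTop (j := (laurentToH n q t : Laurent K n →+* H n q t)) (T := Tw q t) 1 1
  · intro g a ha
    refine mul_mem_filTop (fun x => ?_) ha
    change ∃ m, gen n q t g * Tw q t x ∈ filH n q t m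
    match g with
    | .T i => exact ⟨_, gen_T_mul_Tw_mem i x⟩
    | .pi => exact ⟨_, by rw [gen_pi_mul_Tw]; exact Tw_mem_filH (Nat.lt_succ_self _)⟩
    | .piInv => exact ⟨_, by rw [gen_piInv_mul_Tw]; exact Tw_mem_filH (Nat.lt_succ_self _)⟩
    | .Y i => exact ⟨_, (isTriangular_Y i).mul_T_mem x⟩
    | .YInv i =>
      choose b' hb' using fun x : AffPerm n => exists_mul_yL (n := n) q (x⁻¹ i)
      exact ⟨_, (isTriangular_Y i).inv_mul_T_mem hb' (gen_YInv_mul_Y i) x⟩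

/-! ### Existence of normal orderings -/

theorem laurentLocToHLoc_algebraMap (P : Laurent K n) :
    laurentLocToHLoc n q t (algebraMap (Laurent K n) (LaurentLoc n q t) P) =
      toLoc n q t (laurentToH n q t P) :=
  OreLocalization.universalHom_commutes _ _ _

variable (n q t) in
/-- The length filtration of the localized algebra. -/
def filL (m : ℕ) : AddSubgroup (HLoc n q t) :=
  fil (laurentLocToHLoc n q t) (fun x => toLoc n q t (Tw q t x)) m

theorem toLoc_mem_filL {m : ℕ} {a : H n q t} (ha : a ∈ filH n q t m) :
    toLoc n q t a ∈ filL n q t m := by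
  unfold filH fil at ha
  induction ha using AddSubgroup.closure_induction with
  | mem a ha =>
    obtain ⟨x, b, hx, rfl⟩ := ha
    rw [map_mul]
    have := mem_fil (j := laurentLocToHLoc n q t) (T := fun x => toLoc n q t (Tw q t x)) hx
      (algebraMap _ _ b)
    rwa [laurentLocToHLoc_algebraMap] at this
  | zero => rw [map_zero]; exact zero_mem _
  | add a a' _ _ h h' => rw [map_add]; exact add_mem h h'
  | neg a _ h => rw [map_neg]; exact neg_mem h

theorem isTriangular_f (i j : ℤ) :
    IsTriangular (laurentLocToHLoc n q t) (fun x => toLoc n q t (Tw q t x))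
      (toLoc n q t (laurentToH n q t (fL n q t i j)))
      fun x => algebraMap _ _ (fL n q t (x⁻¹ i) (x⁻¹ j)) := by
  intro x
  simp only
  rw [laurentLocToHLoc_algebraMap, ← map_mul, ← map_mul, ← map_sub]
  refine toLoc_mem_filL ?_
  have h1 : (t : K) • (𝐘[i] * Tw q t x - Tw q t x * 𝐘[x⁻¹ i]) ∈ filH n q t (len x) :=
    smul_mem_filH (by rw [← laurentToH_yL n q t (x⁻¹ i)]; exact isTriangular_Y i x) _
  have h2 : ((t⁻¹ : Kˣ) : K) • (𝐘[j] * Tw q t x - Tw q t x * 𝐘[x⁻¹ j]) ∈ filH n q t (len x) :=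
    smul_mem_filH (by rw [← laurentToH_yL n q t (x⁻¹ j)]; exact isTriangular_Y j x) _
  convert sub_mem h1 h2 using 1
  simp only [fL, map_sub, map_smul, laurentToH_yL, sub_mul, mul_sub, smul_mul_assoc,
    mul_smul_comm]
  module

theorem mkAlgHom_LRel_inl (g : Gen) :
    RingQuot.mkAlgHom K (LRel n q t) (FreeAlgebra.ι K (Sum.inl g)) =
      toLoc n q t (gen n q t g) := by
  have : toLoc n q t (gen n q t g) =
      RingQuot.mkAlgHom K (LRel n q t) (liftGen K n (FreeAlgebra.ι K g)) :=
    RingQuot.liftAlgHom_mkAlgHom_apply K _ _ _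
  rw [this, liftGen, FreeAlgebra.lift_ι_apply]

theorem mkAlgHom_liftGen (z : FreeAlgebra K Gen) :
    RingQuot.mkAlgHom K (LRel n q t) (liftGen K n z) =
      toLoc n q t (RingQuot.mkAlgHom K (Rel n q t) z) := by
  have : toLoc n q t (RingQuot.mkAlgHom K (Rel n q t) z) =
      RingQuot.mkAlgHom K (LRel n q t) (liftGen K n z) :=
    RingQuot.liftAlgHom_mkAlgHom_apply K _ _ _
  exact this.symm

theorem mkAlgHom_fFree (i j : ℤ) : RingQuot.mkAlgHom K (Rel n q t) (fFree t i j) =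
    laurentToH n q t (fL n q t i j) := by
  simp only [fL, map_sub, map_smul, laurentToH_yL, fFree]
  rfl

theorem exists_algebraMap_fL_mul {i j : ℤ} (h : ¬ (n : ℤ) ∣ i - j) : ∃ b : LaurentLoc n q t,
    algebraMap (Laurent K n) (LaurentLoc n q t) (fL n q t i j) * b = 1 :=
  (IsLocalization.map_units (LaurentLoc n q t) (⟨fL n q t i j,
    Submonoid.subset_closure ⟨i, j, h, rfl⟩⟩ : fSet n q t)).exists_right_inv

/-- The inverse of f_{ij} is handled as the inverse of a triangular operator. Its diagonal entries
are again of the form f_{kl} with k ≢ l, since x⁻¹ preserves congruence modulo n, and so they are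
invertible in the localized Laurent ring. -/
theorem mem_filTop_HLoc (h : HLoc n q t) :
    h ∈ filTop (laurentLocToHLoc n q t) (fun x => toLoc n q t (Tw q t x)) := by
  have aux : ∀ (y : H n q t) (x : AffPerm n),
      ∃ m, toLoc n q t y * toLoc n q t (Tw q t x) ∈ filL n q t m := by
    intro y x
    have := mem_filTop_H (y * Tw q t x)
    obtain ⟨g, hg⟩ := exists_finsupp_of_mem_filTop this
    rw [← map_mul, hg]
    refine ⟨g.support.sup len + 1, toLoc_mem_filL (sum_mem fun v hv => ?_)⟩
    exact mem_fil (Nat.lt_succ_of_le (Finset.le_sup hv)) _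
  refine mem_of_generators (RingQuot.mkAlgHom K (LRel n q t)) (RingQuot.mkAlgHom_surjective K _)
    ?_ ?_ ?_ h
  · intro c a ha
    rw [Algebra.smul_def, ← (toLoc n q t).commutes]
    exact mul_mem_filTop (aux _) ha
  · simpa using mem_filTop (j := laurentLocToHLoc n q t) (T := fun x => toLoc n q t (Tw q t x)) 1 1
  · intro g a ha
    refine mul_mem_filTop ?_ ha
    match g with
    | .inl g => rw [mkAlgHom_LRel_inl]; exact aux _
    | .inr p =>
      intro x
      choose b' hb' using fun x : AffPerm n => exists_algebraMap_fL_mul (q := q) (t := t)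
        (not_dvd_apply x⁻¹ p.2)
      refine ⟨_, (isTriangular_f p.1.1 p.1.2).inv_mul_T_mem hb' ?_ x⟩
      rw [← mkAlgHom_fFree, ← mkAlgHom_liftGen]
      simpa using RingQuot.mkAlgHom_rel K (LRel.inv_mul_f (n := n) (q := q) (t := t) p)

theorem exists_isNormalOrdering (h : HLoc n q t) : ∃ g, IsNormalOrdering h g :=
  exists_finsupp_of_mem_filTop (mem_filTop_HLoc h)

end Spanning
end DAHA

namespace DAHA

/-! ### Laurent polynomials, their fraction field and the action of affine permutations -/

section LaurentPolynomials

variable {K : Type*} [Field K] {n : ℕ}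

/-- The algebra homomorphism from the Laurent polynomials that sends the variables to given
units. -/
def laurentLift {A : Type*} [CommRing A] [Algebra K A] (u : Fin n → Aˣ) : Laurent K n →ₐ[K] A :=
  MonoidAlgebra.lift K A (Fin n → Multiplicative ℤ)
    { toFun := fun β => ∏ k, ((u k ^ (β k).toAdd : Aˣ) : A)
      map_one' := by simp
      map_mul' := by
        intro β δ
        simp [zpow_add, Finset.prod_mul_distrib] }

theorem prod_zpow_mulSingle {A : Type*} [CommRing A] (u : Fin n → Aˣ) (k : Fin n) :
    ∏ l, ((u l ^ ((Pi.mulSingle k (Multiplicative.ofAdd 1) : Fin n → Multiplicative ℤ)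
      l).toAdd : Aˣ) : A) = u k := by
  rw [Finset.prod_eq_single k]
  · simp
  · intro l _ hl
    simp [Pi.mulSingle_eq_of_ne hl]
  · simp

variable [n.AtLeastTwo]

theorem idx_succ (k : Fin n) : idx n ((k : ℤ) + 1) = k := by
  apply Fin.ext
  have : ((k : ℤ) + 1 - 1) % n = k := by
    rw [add_sub_cancel_right]
    exact Int.emod_eq_of_lt (by omega) (by have := k.2; omega)
  simp only [idx, this]
  omega

theorem ediv_succ (k : Fin n) : ((k : ℤ) + 1 - 1) / n = 0 := by
  rw [add_sub_cancel_right]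
  exact Int.ediv_eq_zero_of_lt (by omega) (by have := k.2; omega)

theorem idx_spec (i : ℤ) : ((idx n i : Fin n) : ℤ) + 1 + (i - 1) / n * n = i := by
  have h := n_pos (n := n)
  have h0 := Int.emod_nonneg (i - 1) h.ne'
  have h1 := Int.emod_add_mul_ediv (i - 1) n
  have h3 : (((idx n i : Fin n) : ℕ) : ℤ) = (i - 1) % n := by
    simp only [idx]
    exact Int.toNat_of_nonneg h0
  rw [h3]
  linarith [mul_comm ((i - 1) / (n : ℤ)) (n : ℤ)]

theorem dvd_sub_idx (i : ℤ) : (n : ℤ) ∣ i - ((idx n i : Fin n) + 1) :=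
  ⟨(i - 1) / n, by linarith [idx_spec (n := n) i, mul_comm ((i - 1) / (n : ℤ)) (n : ℤ)]⟩

theorem ext_add_mul {M : Type*} [AddCommMonoid M] [Module K M] (q : Kˣ) (b : Fin n → M) (i m : ℤ) :
    ext q b (i + m * n) = ((q ^ (-m) : Kˣ) : K) • ext q b i := by
  have h := n_pos (n := n)
  have e1 : (i + m * n - 1) / n = (i - 1) / n + m := by
    rw [show i + m * n - 1 = (i - 1) + m * n by ring, Int.add_mul_ediv_right _ _ h.ne']
  have e2 : idx n (i + m * n) = idx n i := by
    apply Fin.ext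
    simp only [idx]
    rw [show i + m * n - 1 = (i - 1) + m * n by ring, Int.add_mul_emod_self_right]
  rw [ext, ext, e1, e2, smul_smul, ← Units.val_mul, ← zpow_add]
  congr 3
  ring

theorem ext_succ {M : Type*} [AddCommMonoid M] [Module K M] (q : Kˣ) (b : Fin n → M) (k : Fin n) :
    ext q b ((k : ℤ) + 1) = b k := by
  rw [ext, ediv_succ, idx_succ]; simp

theorem yL_add_mul (q : Kˣ) (i m : ℤ) :
    (yL q (i + m * n) : Laurent K n) = ((q ^ (-m) : Kˣ) : K) • yL q i := ext_add_mul q _ i m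

theorem laurentLift_yL_succ {A : Type*} [CommRing A] [Algebra K A] (u : Fin n → Aˣ) (q : Kˣ)
    (k : Fin n) : laurentLift u (yL q ((k : ℤ) + 1) : Laurent K n) = u k := by
  rw [yL, ext_succ, laurentLift, MonoidAlgebra.lift_of]
  exact prod_zpow_mulSingle u k

theorem map_yL {A : Type*} [Semiring A] [Algebra K A] (φ : Laurent K n →ₐ[K] A) (q : Kˣ)
    (Y : ℤ → A) (hY : ∀ i m, Y (i + m * n) = ((q ^ (-m) : Kˣ) : K) • Y i)
    (h : ∀ k : Fin n, φ (yL q ((k : ℤ) + 1)) = Y ((k : ℤ) + 1)) (i : ℤ) :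
    φ (yL q i) = Y i := by
  rw [← idx_spec (n := n) i, yL_add_mul, hY, map_smul, h]

theorem laurent_hom_ext {A : Type*} [Semiring A] [Algebra K A] {φ ψ : Laurent K n →ₐ[K] A}
    (q : Kˣ) (h : ∀ i, φ (yL q i) = ψ (yL q i)) : φ = ψ := by
  refine MonoidAlgebra.algHom_ext' ?_ (Subsingleton.elim _ _)
  refine MonoidHom.pi_ext fun k x => ?_
  have : ((φ : Laurent K n →* A).comp (MonoidAlgebra.of K (Fin n → Multiplicative ℤ))).comp
      (MonoidHom.mulSingle _ k) =
      ((ψ : Laurent K n →* A).comp (MonoidAlgebra.of K (Fin n → Multiplicative ℤ))).comp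
      (MonoidHom.mulSingle _ k) := by
    apply MonoidHom.ext_mint
    have := h ((k : ℤ) + 1)
    rwa [yL, ext_succ] at this
  exact DFunLike.congr_fun this x

theorem evalAt_eq (a : Fin n → Kˣ) : evalAt a = laurentLift a := rfl

theorem evalAt_yL (q : Kˣ) (a : Fin n → Kˣ) (i : ℤ) : evalAt a (yL q i) = extTuple q a i := by
  refine map_yL _ q _ (fun i m => ext_add_mul q _ i m) (fun k => ?_) i
  rw [evalAt_eq, laurentLift_yL_succ, extTuple, ext_succ]

theorem isUnit_yL (q : Kˣ) (i : ℤ) : IsUnit (yL q i : Laurent K n) :=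
  let ⟨_, h⟩ := exists_mul_yL q i; IsUnit.of_mul_eq_one _ h

/-- The action of an affine permutation on the Laurent polynomials: `Y_i ↦ Y_{w i}`. -/
def actL (q : Kˣ) (w : AffPerm n) : Laurent K n →ₐ[K] Laurent K n :=
  laurentLift fun k => (isUnit_yL q (w ((k : ℤ) + 1))).unit

@[simp] theorem actL_yL (q : Kˣ) (w : AffPerm n) (i : ℤ) :
    actL q w (yL q i : Laurent K n) = yL q (w i) := by
  refine map_yL _ q (fun i => yL q (w i)) (fun i m => ?_) (fun k => ?_) i
  · rw [apply_add_mul, yL_add_mul]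
  · rw [actL, laurentLift_yL_succ]; rfl

theorem actL_injective (q : Kˣ) (w : AffPerm n) :
    Function.Injective (actL q w : Laurent K n →ₐ[K] Laurent K n).toRingHom := by
  have : (actL q w⁻¹).comp (actL q w) = AlgHom.id K (Laurent K n) :=
    laurent_hom_ext q fun i => by simp
  exact Function.LeftInverse.injective (g := actL q w⁻¹) fun P => DFunLike.congr_fun this P

theorem yL_coeff (q : Kˣ) (i : ℤ) (k : Fin n) :
    (yL q i : Laurent K n).coeff (Pi.mulSingle k (Multiplicative.ofAdd 1)) =
      if idx n i = k then ((q ^ (-((i - 1) / n)) : Kˣ) : K) else 0 := by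
  classical
  rw [yL, ext, MonoidAlgebra.of_apply, MonoidAlgebra.smul_single, MonoidAlgebra.coeff_single, Finsupp.single_apply,
    smul_eq_mul, mul_one]
  congr 1
  apply propext
  constructor
  · intro h
    by_contra hne
    have := congrFun h k
    rw [Pi.mulSingle_eq_of_ne (Ne.symm hne), Pi.mulSingle_eq_same] at this
    exact absurd this (by decide)
  · rintro rfl; rfl

/-- For i ≢ j the two elements are multiples of different variables, so the coefficient of the first
one survives. Hence f_{ij} and Y_i - Y_j become invertible in the fraction field. -/
theorem smul_yL_sub_ne_zero (q : Kˣ) {α β : K} (hα : α ≠ 0) {i j : ℤ}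
    (h : ¬ (n : ℤ) ∣ i - j) : α • yL q i - β • yL q j ≠ (0 : Laurent K n) := by
  intro h0
  have hne : idx n j ≠ idx n i := by
    intro he
    apply h
    have h1 := dvd_sub_idx (n := n) i
    have h2 := dvd_sub_idx (n := n) j
    rw [he] at h2
    simpa using dvd_sub h1 h2
  have := congrArg (fun P : Laurent K n =>
    P.coeff (Pi.mulSingle (idx n i) (Multiplicative.ofAdd 1))) h0
  simp [yL_coeff, hne, hα] at this
  exact zpow_ne_zero _ q.ne_zero this

variable (K n) in
/-- The field of rational functions in `Y_1, …, Y_n`. -/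
def Frac : Type _ := FractionRing (Laurent K n)

instance : Field (Frac K n) := inferInstanceAs (Field (FractionRing (Laurent K n)))

instance : Algebra (Laurent K n) (Frac K n) :=
  inferInstanceAs (Algebra (Laurent K n) (FractionRing (Laurent K n)))

instance : Algebra K (Frac K n) := inferInstanceAs (Algebra K (FractionRing (Laurent K n)))

instance : IsScalarTower K (Laurent K n) (Frac K n) :=
  inferInstanceAs (IsScalarTower K (Laurent K n) (FractionRing (Laurent K n)))

instance : IsFractionRing (Laurent K n) (Frac K n) :=
  inferInstanceAs (IsFractionRing (Laurent K n) (FractionRing (Laurent K n)))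

/-- The variable `Y_i` in the field of rational functions. -/
def yF (q : Kˣ) (i : ℤ) : Frac K n := algebraMap (Laurent K n) (Frac K n) (yL q i)

/-- Constants in the field of rational functions. -/
abbrev cF : K →+* Frac K n := algebraMap K (Frac K n)

theorem algebraMap_algebraMap_F (c : K) :
    algebraMap (Laurent K n) (Frac K n) (algebraMap K _ c) = cF c :=
  (IsScalarTower.algebraMap_apply _ _ _ _).symm

theorem algebraMap_smul_F (c : K) (P : Laurent K n) :
    algebraMap (Laurent K n) (Frac K n) (c • P) = cF c * algebraMap _ _ P := by
  rw [Algebra.smul_def, map_mul, algebraMap_algebraMap_F]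

theorem algebraMap_F_injective : Function.Injective (algebraMap (Laurent K n) (Frac K n)) :=
  IsFractionRing.injective _ _

theorem yF_add_mul (q : Kˣ) (i m : ℤ) :
    (yF q (i + m * n) : Frac K n) = cF ((q ^ (-m) : Kˣ) : K) * yF q i := by
  rw [yF, yL_add_mul, algebraMap_smul_F, yF]

theorem yF_ne_zero (q : Kˣ) (i : ℤ) : (yF q i : Frac K n) ≠ 0 := by
  rw [yF, Ne, map_eq_zero_iff _ algebraMap_F_injective]
  exact (isUnit_yL q i).ne_zero

theorem mul_yF_sub_ne_zero (q : Kˣ) {α β : K} (hα : α ≠ 0) {i j : ℤ} (h : ¬ (n : ℤ) ∣ i - j) :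
    cF α * yF q i - cF β * yF q j ≠ (0 : Frac K n) := by
  rw [yF, yF, ← algebraMap_smul_F, ← algebraMap_smul_F, ← map_sub, Ne,
    map_eq_zero_iff _ algebraMap_F_injective]
  exact smul_yL_sub_ne_zero q hα h

theorem yF_sub_ne_zero (q : Kˣ) {i j : ℤ} (h : ¬ (n : ℤ) ∣ i - j) :
    (yF q i : Frac K n) - yF q j ≠ 0 := by
  simpa using mul_yF_sub_ne_zero (n := n) q (one_ne_zero (α := K)) (β := 1) h

/-- `f_{ij}` in the field of rational functions. -/
def fF (q t : Kˣ) (i j : ℤ) : Frac K n := cF (t : K) * yF q i - cF ((t : K)⁻¹) * yF q j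

theorem algebraMap_fL (q t : Kˣ) (i j : ℤ) :
    algebraMap (Laurent K n) (Frac K n) (fL n q t i j) = fF q t i j := by
  rw [fL, map_sub, algebraMap_smul_F, algebraMap_smul_F, Units.val_inv_eq_inv_val]; rfl

theorem fF_ne_zero (q t : Kˣ) {i j : ℤ} (h : ¬ (n : ℤ) ∣ i - j) : (fF q t i j : Frac K n) ≠ 0 :=
  mul_yF_sub_ne_zero q t.ne_zero h

/-- The coefficient `f_{ij} / (Y_i - Y_j)`. -/
def cc (q t : Kˣ) (i j : ℤ) : Frac K n := fF q t i j / (yF q i - yF q j)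

theorem cc_ne_zero (q t : Kˣ) {i j : ℤ} (h : ¬ (n : ℤ) ∣ i - j) : (cc q t i j : Frac K n) ≠ 0 :=
  div_ne_zero (fF_ne_zero q t h) (yF_sub_ne_zero q h)

/-- Numerator and denominator are homogeneous of degree one, so the powers of q cancel. -/
theorem cc_add_mul (q t : Kˣ) (i j m : ℤ) :
    (cc q t (i + m * n) (j + m * n) : Frac K n) = cc q t i j := by
  have h : cF ((q ^ (-m) : Kˣ) : K) ≠ (0 : Frac K n) := (map_ne_zero _).2 (Units.ne_zero _)
  rw [cc, cc, ← mul_div_mul_left _ (yF q i - yF q j) h, fF, fF, yF_add_mul, yF_add_mul]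
  congr 1 <;> ring

/-- The action of an affine permutation on the rational functions: `Y_i ↦ Y_{w i}`. -/
def actF (q : Kˣ) (w : AffPerm n) : Frac K n →+* Frac K n :=
  IsFractionRing.map (actL_injective q w)

theorem actF_algebraMap (q : Kˣ) (w : AffPerm n) (P : Laurent K n) :
    actF q w (algebraMap _ _ P) = algebraMap _ _ (actL q w P) :=
  IsLocalization.map_eq (M := nonZeroDivisors (Laurent K n))
    (T := nonZeroDivisors (Laurent K n))
    (nonZeroDivisors_le_comap_nonZeroDivisors_of_injective _ (actL_injective q w)) P

@[simp] theorem actF_yF (q : Kˣ) (w : AffPerm n) (i : ℤ) :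
    actF q w (yF q i : Frac K n) = yF q (w i) := by
  rw [yF, actF_algebraMap, actL_yL, yF]

@[simp] theorem actF_cF (q : Kˣ) (w : AffPerm n) (c : K) :
    actF q w (cF c : Frac K n) = cF c := by
  rw [← algebraMap_algebraMap_F, actF_algebraMap, AlgHom.commutes]

@[simp] theorem actF_cc (q t : Kˣ) (w : AffPerm n) (i j : ℤ) :
    actF q w (cc q t i j : Frac K n) = cc q t (w i) (w j) := by
  simp [cc, fF]

end LaurentPolynomials
end DAHA

namespace DAHA

/-! ### The representation of the double affine Hecke algebra on rational functions -/

/-! ### Rational identities behind the quadratic, T-Y-T and braid relations. -/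

section Identities

variable {E V : Type*} [Field E] [AddCommGroup V] [Module E V] {x y z τ τ' : E}

/-- Here e₁ and e₂ stand for e_v and e_{s_i v}, x and y for the eigenvalues of Y_i and Y_{i+1} on
e_v, and τ, τ' for t and its inverse. -/
theorem quadratic_identity (hxy : x - y ≠ 0) (e₁ e₂ : V) :
    (τ - (τ * x - τ' * y) / (x - y)) •
        ((τ - (τ * x - τ' * y) / (x - y)) • e₁ + ((τ * x - τ' * y) / (x - y)) • e₂) +
      ((τ * x - τ' * y) / (x - y)) •
        ((τ - (τ * y - τ' * x) / (y - x)) • e₂ + ((τ * y - τ' * x) / (y - x)) • e₁) =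
      (τ - τ') • ((τ - (τ * x - τ' * y) / (x - y)) • e₁ + ((τ * x - τ' * y) / (x - y)) • e₂) +
        (τ * τ') • e₁ := by
  have hyx : y - x ≠ 0 := by rwa [← neg_sub, neg_ne_zero]
  match_scalars <;> field_simp <;> ring

theorem T_Y_T_identity (hτ : τ * τ' = 1) (hxy : x - y ≠ 0) (e₁ e₂ : V) :
    (τ - (τ * x - τ' * y) / (x - y)) • x •
        ((τ - (τ * x - τ' * y) / (x - y)) • e₁ + ((τ * x - τ' * y) / (x - y)) • e₂) +
      ((τ * x - τ' * y) / (x - y)) • y •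
        ((τ - (τ * y - τ' * x) / (y - x)) • e₂ + ((τ * y - τ' * x) / (y - x)) • e₁) =
      y • e₁ := by
  have hyx : y - x ≠ 0 := by rwa [← neg_sub, neg_ne_zero]
  match_scalars
  · field_simp
    linear_combination (y * (y - x) ^ 3) * hτ
  · field_simp
    ring

/-- The six vectors stand for the e_{u v} with u in the group generated by s_i and s_{i+1}; x, y, z
are the eigenvalues of Y_i, Y_{i+1}, Y_{i+2} on e_v. -/
theorem braid_identity {c : E → E → E} (hc : ∀ x y, c x y = (τ * x - τ' * y) / (x - y))
    (hxy : x - y ≠ 0) (hyz : y - z ≠ 0) (hxz : x - z ≠ 0) (e e₁ e₂ e₁₂ e₂₁ e₃ : V) :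
    (τ - c x y) •
        ((τ - c y z) • ((τ - c x y) • e + c x y • e₁) + c y z • ((τ - c x z) • e₂ + c x z • e₁₂)) +
      c x y •
        ((τ - c x z) • ((τ - c y x) • e₁ + c y x • e) + c x z • ((τ - c y z) • e₂₁ + c y z • e₃)) =
      (τ - c y z) •
        ((τ - c x y) • ((τ - c y z) • e + c y z • e₂) + c x y • ((τ - c x z) • e₁ + c x z • e₂₁)) +
      c y z •
        ((τ - c x z) • ((τ - c z y) • e₂ + c z y • e) +
          c x z • ((τ - c x y) • e₁₂ + c x y • e₃)) := by
  have hyx : y - x ≠ 0 := by rwa [← neg_sub, neg_ne_zero]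
  have hzy : z - y ≠ 0 := by rwa [← neg_sub, neg_ne_zero]
  simp only [hc]
  match_scalars <;> field_simp <;> ring

theorem quadratic_expand {K A : Type*} [Field K] [Ring A] [Algebra K A] {T : A} {c c' : K}
    (h : T * T = (c - c') • T + 1) (hc : c * c' = 1) :
    (T - algebraMap K A c) * (T + algebraMap K A c') = 0 := by
  rw [sub_mul, mul_add, mul_add, h, ← Algebra.commutes, ← map_mul, hc, map_one,
    ← Algebra.smul_def, ← Algebra.smul_def]
  module

end Identities

/-! ### The representation in which the intertwiners permute a basis. -/

section Representation

variable {K : Type*} [Field K] {n : ℕ} {q t : Kˣ} [n.AtLeastTwo]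

variable (K n) in
/-- The space with basis `e_v`, `v` an affine permutation, over the rational functions. -/
abbrev Mod : Type _ := AffPerm n →₀ Frac K n

/-- The basis vector `e_v`. -/
def ev (v : AffPerm n) : Mod K n := Finsupp.single v 1

variable (K) in
/-- The linear map with given values on the basis. -/
def linMap (f : AffPerm n → Mod K n) : Module.End (Frac K n) (Mod K n) :=
  Finsupp.linearCombination (Frac K n) f

@[simp] theorem linMap_ev (f : AffPerm n → Mod K n) (v : AffPerm n) : linMap K f (ev v) = f v := by
  rw [linMap, ev, Finsupp.linearCombination_single, one_smul]

theorem linMap_ext {φ ψ : Module.End (Frac K n) (Mod K n)} (h : ∀ v, φ (ev v) = ψ (ev v)) :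
    φ = ψ :=
  Finsupp.lhom_ext' fun v => LinearMap.ext_ring (h v)

variable (q t) in
/-- The action of the generators. -/
def genOp : Gen → Module.End (Frac K n) (Mod K n)
  -- Equivalently (T_i - t) e_v = c (e_{s_i v} - e_v). The factor c is chosen so that the commutator
  -- of T_i with Y_i sends e_v to f e_{s_i v}, where f is the eigenvalue of f_{i,i+1} on e_v.
  | .T i => linMap K fun v => (cF (t : K) - cc q t (v⁻¹ i) (v⁻¹ (i + 1)) : Frac K n) • ev v +
      (cc q t (v⁻¹ i) (v⁻¹ (i + 1)) : Frac K n) • ev (s n i * v)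
  | .pi => linMap K fun v => ev (rot n * v)
  | .piInv => linMap K fun v => ev ((rot n)⁻¹ * v)
  | .Y i => linMap K fun v => (yF q (v⁻¹ i) : Frac K n) • ev v
  | .YInv i => linMap K fun v => (yF q (v⁻¹ i) : Frac K n)⁻¹ • ev v

theorem genOp_T (i : ℤ) (v : AffPerm n) : genOp q t (.T i) (ev v : Mod K n) =
    (cF (t : K) - cc q t (v⁻¹ i) (v⁻¹ (i + 1)) : Frac K n) • ev v +
      (cc q t (v⁻¹ i) (v⁻¹ (i + 1)) : Frac K n) • ev (s n i * v) := linMap_ev _ _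

theorem genOp_pi (v : AffPerm n) : genOp q t .pi (ev v : Mod K n) = ev (rot n * v) := linMap_ev _ _

theorem genOp_piInv (v : AffPerm n) :
    genOp q t .piInv (ev v : Mod K n) = ev ((rot n)⁻¹ * v) := linMap_ev _ _

theorem genOp_Y (i : ℤ) (v : AffPerm n) :
    genOp q t (.Y i) (ev v : Mod K n) = (yF q (v⁻¹ i) : Frac K n) • ev v := linMap_ev _ _

theorem genOp_YInv (i : ℤ) (v : AffPerm n) :
    genOp q t (.YInv i) (ev v : Mod K n) = (yF q (v⁻¹ i) : Frac K n)⁻¹ • ev v := linMap_ev _ _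

theorem cF_mul_inv : (cF (t : K) * cF ((t : K)⁻¹) : Frac K n) = 1 := by
  rw [← map_mul, mul_inv_cancel₀ t.ne_zero, map_one]

theorem inv_sub_ne_zero (v : AffPerm n) {i j : ℤ} (h : ¬ (n : ℤ) ∣ i - j) :
    (yF q (v⁻¹ i) : Frac K n) - yF q (v⁻¹ j) ≠ 0 := yF_sub_ne_zero q (not_dvd_apply v⁻¹ h)

theorem not_dvd_sub_succ (i : ℤ) : ¬ (n : ℤ) ∣ i - (i + 1) := by
  rw [show i - (i + 1) = -1 by ring, dvd_neg]; exact not_dvd_one n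

theorem genOp_quadratic (i : ℤ) :
    genOp q t (.T i) * genOp q t (.T i) =
      (cF (t : K) - cF ((t : K)⁻¹) : Frac K n) • genOp q t (.T i) +
        (1 : Module.End (Frac K n) (Mod K n)) := by
  refine linMap_ext fun v => ?_
  have h := quadratic_identity (τ := cF (t : K)) (τ' := cF ((t : K)⁻¹))
    (inv_sub_ne_zero (K := K) (q := q) v (not_dvd_sub_succ i)) (ev v : Mod K n)
    (ev (s n i * v))
  rw [cF_mul_inv, one_smul] at h
  simp only [Module.End.mul_apply, LinearMap.add_apply, LinearMap.smul_apply, Module.End.one_apply,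
    genOp_T, map_add, map_smul, inv_s_mul_apply, s_self, s_succ, s_mul_self_mul]
  exact h

theorem genOp_T_Y_T (i : ℤ) : (genOp q t (.T i) * genOp q t (.Y i) * genOp q t (.T i) :
    Module.End (Frac K n) (Mod K n)) = genOp q t (.Y (i + 1)) := by
  refine linMap_ext fun v => ?_
  have h := T_Y_T_identity (cF_mul_inv (K := K) (t := t))
    (inv_sub_ne_zero (K := K) (q := q) v (not_dvd_sub_succ i)) (ev v : Mod K n)
    (ev (s n i * v))
  simp only [Module.End.mul_apply, genOp_T, genOp_Y, map_add, map_smul, inv_s_mul_apply, s_self,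
    s_succ, s_mul_self_mul]
  exact h

theorem genOp_braid (hn : n ≠ 2) (i : ℤ) :
    (genOp q t (.T i) * genOp q t (.T (i + 1)) * genOp q t (.T i) :
      Module.End (Frac K n) (Mod K n)) =
    genOp q t (.T (i + 1)) * genOp q t (.T i) * genOp q t (.T (i + 1)) := by
  have h2 := two_le n
  have n2 : ¬ (n : ℤ) ∣ 2 := fun h => by have := Int.le_of_dvd (by norm_num) h; omega
  have n1 := not_dvd_one n
  have a1 : s n i (i + 1 + 1) = i + 1 + 1 := s_apply_of_not
    (by rwa [show i + 1 + 1 - i = 2 by ring]) (by rwa [show i + 1 + 1 - (i + 1) = 1 by ring])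
  have a2 : s n (i + 1) i = i := s_apply_of_not
    (by rwa [show i - (i + 1) = -1 by ring, dvd_neg])
    (by rwa [show i - (i + 1 + 1) = -2 by ring, dvd_neg])
  refine linMap_ext fun v => ?_
  have hb : s n (i + 1) * (s n i * (s n (i + 1) * v)) = s n i * (s n (i + 1) * (s n i * v)) := by
    simp only [← mul_assoc, s_braid hn]
  have h := braid_identity (τ := cF (t : K)) (τ' := cF ((t : K)⁻¹)) (fun _ _ => rfl)
    (inv_sub_ne_zero (K := K) (q := q) v (not_dvd_sub_succ i))
    (inv_sub_ne_zero (K := K) (q := q) v (not_dvd_sub_succ (i + 1)))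
    (inv_sub_ne_zero (K := K) (q := q) v (show ¬ (n : ℤ) ∣ i - (i + 1 + 1) by
      rwa [show i - (i + 1 + 1) = -2 by ring, dvd_neg]))
    (ev v : Mod K n) (ev (s n i * v)) (ev (s n (i + 1) * v)) (ev (s n i * (s n (i + 1) * v)))
    (ev (s n (i + 1) * (s n i * v))) (ev (s n i * (s n (i + 1) * (s n i * v))))
  simp only [Module.End.mul_apply, genOp_T, map_add, map_smul, inv_s_mul_apply, s_self,
    s_succ, s_mul_self_mul, a1, a2, hb]
  exact h

theorem genOp_T_comm {i j : ℤ} (h₁ : ¬ (n : ℤ) ∣ j - (i + 1)) (h₂ : ¬ (n : ℤ) ∣ j - (i - 1)) :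
    (genOp q t (.T i) * genOp q t (.T j) : Module.End (Frac K n) (Mod K n)) =
      genOp q t (.T j) * genOp q t (.T i) := by
  refine linMap_ext fun v => ?_
  -- The relation also covers i ≡ j, where the two operators coincide.
  by_cases c1 : (n : ℤ) ∣ i - j
  · obtain ⟨k, hk⟩ := c1
    have e : (genOp q t (.T i) : Module.End (Frac K n) (Mod K n)) = genOp q t (.T j) := by
      refine linMap_ext fun v => ?_
      simp only [genOp_T]
      rw [s_congr ⟨k, hk⟩, show i = j + k * n by linarith,
        show j + k * n + 1 = j + 1 + k * n by ring, inv_apply_add_mul, inv_apply_add_mul,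
        cc_add_mul]
    rw [e]
  · have c1' : ¬ (n : ℤ) ∣ j - i := by rwa [← dvd_neg, neg_sub]
    have a1 : s n i j = j := s_apply_of_not c1' h₁
    have a2 : s n i (j + 1) = j + 1 := s_apply_of_not
      (by rwa [show j + 1 - i = j - (i - 1) by ring])
      (by rwa [show j + 1 - (i + 1) = j - i by ring])
    have a3 : s n j i = i := s_apply_of_not c1
      (by rwa [← dvd_neg, show -(i - (j + 1)) = j - (i - 1) by ring])
    have a4 : s n j (i + 1) = i + 1 := s_apply_of_not
      (by rwa [← dvd_neg, show -(i + 1 - j) = j - (i + 1) by ring])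
      (by rwa [show i + 1 - (j + 1) = i - j by ring])
    have hb : s n i * (s n j * v) = s n j * (s n i * v) := by
      simp only [← mul_assoc, s_comm h₁ h₂]
    simp only [Module.End.mul_apply, genOp_T, map_add, map_smul, inv_s_mul_apply, a1, a2, a3, a4,
      hb]
    module

theorem genOp_T_Y_comm {i j : ℤ} (h₁ : ¬ (n : ℤ) ∣ j - i) (h₂ : ¬ (n : ℤ) ∣ j - (i + 1)) :
    (genOp q t (.T i) * genOp q t (.Y j) : Module.End (Frac K n) (Mod K n)) =
      genOp q t (.Y j) * genOp q t (.T i) := by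
  refine linMap_ext fun v => ?_
  simp only [Module.End.mul_apply, genOp_T, genOp_Y, map_add, map_smul, inv_s_mul_apply,
    s_apply_of_not h₁ h₂]
  module

theorem cF_smul_end (c : K) (φ : Module.End (Frac K n) (Mod K n)) : (cF c : Frac K n) • φ = c • φ :=
  algebraMap_smul _ _ _

/-- The action of the free algebra respects the defining relations. -/
theorem genOp_rel {x y : FreeAlgebra K Gen} (h : Rel n q t x y) :
    FreeAlgebra.lift K (genOp (K := K) (n := n) q t) x = FreeAlgebra.lift K (genOp q t) y := by
  induction h with
  | T_periodic i =>
    simp only [FreeAlgebra.lift_ι_apply]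
    refine linMap_ext fun v => ?_
    have := inv_apply_add_mul v i 1
    have h2 := inv_apply_add_mul v (i + 1) 1
    have h3 := cc_add_mul (n := n) q t (v⁻¹ i) (v⁻¹ (i + 1)) 1
    simp only [one_mul] at this h2 h3
    rw [genOp_T, genOp_T, s_congr (n := n) (i := i + n) (j := i) (by simp), this,
      show i + n + 1 = i + 1 + n by ring, h2, h3]
  | Y_periodic i =>
    simp only [FreeAlgebra.lift_ι_apply, map_smul]
    refine linMap_ext fun v => ?_
    have := inv_apply_add_mul v i 1
    have h3 := yF_add_mul (n := n) q (v⁻¹ i) 1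
    simp only [one_mul, zpow_neg_one] at this h3
    rw [← cF_smul_end, LinearMap.smul_apply, genOp_Y, genOp_Y, this, h3, smul_smul]
  | quadratic i =>
    simp only [map_mul, map_sub, map_add, FreeAlgebra.lift_ι_apply, AlgHom.commutes, map_zero]
    have h := genOp_quadratic (K := K) (n := n) (q := q) (t := t) i
    rw [← map_sub, cF_smul_end, ← Units.val_inv_eq_inv_val] at h
    exact quadratic_expand (A := Module.End (Frac K n) (Mod K n)) h (Units.mul_inv t)
  | braid i hn =>
    simp only [map_mul, FreeAlgebra.lift_ι_apply]
    exact genOp_braid hn i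
  | T_comm i j h₁ h₂ =>
    simp only [map_mul, FreeAlgebra.lift_ι_apply]
    exact genOp_T_comm h₁ h₂
  | pi_mul_piInv =>
    simp only [map_mul, FreeAlgebra.lift_ι_apply, map_one]
    refine linMap_ext fun v => ?_
    rw [Module.End.mul_apply, genOp_piInv, genOp_pi, mul_inv_cancel_left]; rfl
  | piInv_mul_pi =>
    simp only [map_mul, FreeAlgebra.lift_ι_apply, map_one]
    refine linMap_ext fun v => ?_
    rw [Module.End.mul_apply, genOp_pi, genOp_piInv, inv_mul_cancel_left]; rfl
  | pi_T i =>
    simp only [map_mul, FreeAlgebra.lift_ι_apply]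
    refine linMap_ext fun v => ?_
    have h : ∀ j, (rot n * v)⁻¹ (j + 1) = v⁻¹ j := fun j => by
      rw [inv_apply_eq, mul_apply', apply_inv_self', rot_apply]
    simp only [Module.End.mul_apply, genOp_T, genOp_pi, map_add, map_smul, h]
    rw [← mul_assoc, ← mul_assoc, rot_mul_s]
  | Y_mul_YInv i =>
    simp only [map_mul, FreeAlgebra.lift_ι_apply, map_one]
    refine linMap_ext fun v => ?_
    rw [Module.End.mul_apply, genOp_YInv, map_smul, genOp_Y, smul_smul,
      inv_mul_cancel₀ (yF_ne_zero q _), one_smul]; rfl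
  | YInv_mul_Y i =>
    simp only [map_mul, FreeAlgebra.lift_ι_apply, map_one]
    refine linMap_ext fun v => ?_
    rw [Module.End.mul_apply, genOp_Y, map_smul, genOp_YInv, smul_smul,
      mul_inv_cancel₀ (yF_ne_zero q _), one_smul]; rfl
  | Y_comm i j =>
    simp only [map_mul, FreeAlgebra.lift_ι_apply]
    refine linMap_ext fun v => ?_
    simp only [Module.End.mul_apply, genOp_Y, map_smul, smul_smul, mul_comm]
  | T_Y_T i =>
    simp only [map_mul, FreeAlgebra.lift_ι_apply]
    exact genOp_T_Y_T i
  | T_Y_comm i j h₁ h₂ =>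
    simp only [map_mul, FreeAlgebra.lift_ι_apply]
    exact genOp_T_Y_comm h₁ h₂
  | pi_Y i =>
    simp only [map_mul, FreeAlgebra.lift_ι_apply]
    refine linMap_ext fun v => ?_
    have h : ∀ j, (rot n * v)⁻¹ (j + 1) = v⁻¹ j := fun j => by
      rw [inv_apply_eq, mul_apply', apply_inv_self', rot_apply]
    simp only [Module.End.mul_apply, genOp_Y, genOp_pi, map_smul, h]

variable (K n) in
/-- The representation of the double affine Hecke algebra on `Mod`. -/
def rep (q t : Kˣ) : H n q t →ₐ[K] Module.End (Frac K n) (Mod K n) :=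
  RingQuot.liftAlgHom K ⟨FreeAlgebra.lift K (genOp q t), fun _ _ h => genOp_rel h⟩

theorem rep_mkAlgHom (z : FreeAlgebra K Gen) :
    rep K n q t (RingQuot.mkAlgHom K (Rel n q t) z) = FreeAlgebra.lift K (genOp q t) z :=
  RingQuot.liftAlgHom_mkAlgHom_apply K _ _ _

theorem rep_gen (g : Gen) : rep K n q t (gen n q t g) = genOp q t g := by
  rw [gen, rep_mkAlgHom, FreeAlgebra.lift_ι_apply]

theorem rep_fFree (i j : ℤ) (v : AffPerm n) :
    FreeAlgebra.lift K (genOp q t) (fFree t i j) (ev v : Mod K n) =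
      (fF q t (v⁻¹ i) (v⁻¹ j) : Frac K n) • ev v := by
  simp only [fFree, map_sub, map_smul, FreeAlgebra.lift_ι_apply, ← cF_smul_end,
    LinearMap.sub_apply, LinearMap.smul_apply, genOp_Y, smul_smul, Units.val_inv_eq_inv_val]
  rw [← sub_smul]; rfl

variable (q t) in
/-- The action of the generators of the localized algebra. -/
def lgenOp : LGen n → Module.End (Frac K n) (Mod K n) :=
  Sum.elim (genOp q t) fun p => linMap K fun v => (fF q t (v⁻¹ p.1.1) (v⁻¹ p.1.2) : Frac K n)⁻¹ • ev v

theorem lift_lgenOp_liftGen (z : FreeAlgebra K Gen) :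
    FreeAlgebra.lift K (lgenOp (K := K) (n := n) q t) (liftGen K n z) =
      FreeAlgebra.lift K (genOp q t) z := by
  have : (FreeAlgebra.lift K (lgenOp (K := K) (n := n) q t)).comp (liftGen K n) =
      FreeAlgebra.lift K (genOp q t) := by
    apply FreeAlgebra.hom_ext
    funext g
    simp [liftGen, lgenOp]
  exact DFunLike.congr_fun this z

theorem lgenOp_rel {x y : FreeAlgebra K (LGen n)} (h : LRel n q t x y) :
    FreeAlgebra.lift K (lgenOp (K := K) (n := n) q t) x = FreeAlgebra.lift K (lgenOp q t) y := by
  induction h with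
  | of_rel h => rw [lift_lgenOp_liftGen, lift_lgenOp_liftGen, genOp_rel h]
  | f_mul_inv p =>
    rw [map_mul, map_one, lift_lgenOp_liftGen, FreeAlgebra.lift_ι_apply]
    refine linMap_ext fun v => ?_
    rw [Module.End.mul_apply, lgenOp, Sum.elim_inr, linMap_ev, map_smul, rep_fFree, smul_smul,
      inv_mul_cancel₀ (fF_ne_zero q t (not_dvd_apply v⁻¹ p.2)), one_smul]; rfl
  | inv_mul_f p =>
    rw [map_mul, map_one, lift_lgenOp_liftGen, FreeAlgebra.lift_ι_apply]
    refine linMap_ext fun v => ?_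
    rw [Module.End.mul_apply, rep_fFree, lgenOp, Sum.elim_inr, map_smul, linMap_ev, smul_smul,
      mul_inv_cancel₀ (fF_ne_zero q t (not_dvd_apply v⁻¹ p.2)), one_smul]; rfl

variable (K n) in
/-- The representation of the localized algebra on `Mod`. -/
def repL (q t : Kˣ) : HLoc n q t →ₐ[K] Module.End (Frac K n) (Mod K n) :=
  RingQuot.liftAlgHom K ⟨FreeAlgebra.lift K (lgenOp q t), fun _ _ h => lgenOp_rel h⟩

theorem repL_toLoc (h : H n q t) : repL K n q t (toLoc n q t h) = rep K n q t h := by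
  obtain ⟨z, rfl⟩ := RingQuot.mkAlgHom_surjective K (Rel n q t) h
  rw [← mkAlgHom_liftGen, rep_mkAlgHom, ← lift_lgenOp_liftGen]
  exact RingQuot.liftAlgHom_mkAlgHom_apply K _ _ _

end Representation
end DAHA

namespace DAHA

/-! ### Triangularity and the PBW theorem -/

section Triangularity

variable {K : Type*} [Field K] {n : ℕ} {q t : Kˣ} [n.AtLeastTwo]

variable (q t) in
/-- The leading coefficient of `T_x` in the representation. -/
def kap (x : AffPerm n) : Frac K n := ∏ z ∈ (finite_invSet x).toFinset, cc q t z.1 z.2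

/-- An affine permutation is increasing on each residue class, so the two entries of an inversion
are incongruent. -/
theorem kap_ne_zero (x : AffPerm n) : (kap q t x : Frac K n) ≠ 0 := by
  refine Finset.prod_ne_zero_iff.2 fun z hz => cc_ne_zero q t fun hd => ?_
  obtain ⟨-, h2, h3⟩ := (finite_invSet x).mem_toFinset.1 hz
  obtain ⟨k, hk⟩ := hd
  rw [show z.1 = z.2 + k * n by linarith, apply_add_mul] at h3
  have := n_pos (n := n)
  nlinarith

theorem cc_normPair (p r : ℤ) :
    (cc q t (normPair n p r).1 (normPair n p r).2 : Frac K n) = cc q t p r := by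
  rw [← cc_add_mul q t (normPair n p r).1 (normPair n p r).2 ((p - 1) / n)]
  simp only [normPair, sub_add_cancel]

/-- The one new inversion contributes one new factor; normalizing it to the window does not change
that factor. -/
theorem kap_s_mul {x : AffPerm n} {i : ℤ} (h : x⁻¹ i < x⁻¹ (i + 1)) :
    (kap q t (s n i * x) : Frac K n) = cc q t (x⁻¹ i) (x⁻¹ (i + 1)) * kap q t x := by
  classical
  have e : (finite_invSet (s n i * x)).toFinset =
      insert (normPair n (x⁻¹ i) (x⁻¹ (i + 1))) (finite_invSet x).toFinset := by
    ext z
    rw [Set.Finite.mem_toFinset, invSet_s_mul h, Finset.mem_insert, Set.Finite.mem_toFinset,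
      Set.mem_insert_iff]
  rw [kap, e, Finset.prod_insert, cc_normPair, kap]
  rw [Set.Finite.mem_toFinset]
  exact normPair_notMem_invSet h

variable (K n) in
/-- The span of the `e_y` with `y` of length less than `m`. -/
def lowM (m : ℕ) : Submodule (Frac K n) (Mod K n) := Finsupp.supported _ _ {y | len y < m}

theorem mem_lowM {m : ℕ} {r : Mod K n} : r ∈ lowM K n m ↔ ∀ y, m ≤ len y → r y = 0 := by
  rw [lowM, Finsupp.mem_supported']
  simp

theorem ev_mem_lowM {m : ℕ} {y : AffPerm n} (h : len y < m) : (ev y : Mod K n) ∈ lowM K n m :=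
  Finsupp.single_mem_supported _ _ h

theorem len_s_mul_le (i : ℤ) (x : AffPerm n) : len (s n i * x) ≤ len x + 1 := by
  rcases asc_or_desc x i with h | h
  · exact (len_s_mul h).le
  · have := len_s_mul_of_desc h; omega

theorem genOp_T_mem_lowM (i : ℤ) {m : ℕ} {r : Mod K n} (h : r ∈ lowM K n m) :
    genOp q t (.T i) r ∈ lowM K n (m + 1) := by
  rw [lowM, Finsupp.supported_eq_span_single] at h
  induction h using Submodule.span_induction with
  | mem r hr =>
    obtain ⟨y, hy, rfl⟩ := hr
    change genOp q t (.T i) (ev y) ∈ _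
    have hy' : len y < m := hy
    have := len_s_mul_le i y
    rw [genOp_T]
    exact add_mem (Submodule.smul_mem _ _ (ev_mem_lowM (by omega)))
      (Submodule.smul_mem _ _ (ev_mem_lowM (by omega)))
  | zero => rw [map_zero]; exact zero_mem _
  | add r r' _ _ h h' => rw [map_add]; exact add_mem h h'
  | smul c r _ h => rw [map_smul]; exact Submodule.smul_mem _ _ h

theorem rep_piUnit_zpow (k : ℤ) (v : AffPerm n) :
    rep K n q t ((piUnit n q t ^ k : (H n q t)ˣ) : H n q t) (ev v) = ev (rot n ^ k * v) := by
  induction k using Int.induction_on generalizing v with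
  | zero => simp
  | succ k ih =>
    rw [zpow_add_one, Units.val_mul, map_mul, Module.End.mul_apply, val_piUnit, rep_gen, genOp_pi,
      ih, zpow_add_one, mul_assoc]
  | pred k ih =>
    rw [zpow_sub_one, Units.val_mul, map_mul, Module.End.mul_apply, val_piUnit_inv, rep_gen,
      genOp_piInv, ih, zpow_sub_one, mul_assoc]

/-- With x = s_i x', applying T_i to the leading term of T_{x'} e_1 produces e_x with exactly the
factor of the new inversion, and T_i raises the length of the other terms by at most one. -/
theorem rep_Tw_sub_mem (x : AffPerm n) :
    rep K n q t (Tw q t x) (ev 1) - (kap q t x : Frac K n) • ev x ∈ lowM K n (len x) := by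
  induction hm : len x generalizing x with
  | zero =>
    have h0 : (invSet x).ncard = 0 := by rw [← len_eq_ncard, hm]
    have hk : (kap q t x : Frac K n) = 1 := by
      rw [kap, Finset.prod_eq_one]
      intro z hz
      rw [Set.ncard_eq_zero (finite_invSet x)] at h0
      rw [Set.Finite.mem_toFinset, h0] at hz
      exact absurd hz (Set.notMem_empty z)
    rw [hk, one_smul, eq_rot_of_ncard_eq_zero h0, Tw_rot_zpow, rep_piUnit_zpow, mul_one, sub_self]
    exact zero_mem _
  | succ m ih =>
    obtain ⟨i, hi⟩ := exists_desc (w := x) (by rw [← len_eq_ncard]; omega)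
    obtain ⟨x', rfl⟩ : ∃ x', x = s n i * x' := ⟨s n i * x, by simp⟩
    simp only [inv_s_mul_apply, s_self, s_succ] at hi
    have hl := len_s_mul hi
    have h := ih x' (by omega)
    rw [← gen_T_mul_Tw hi, map_mul, Module.End.mul_apply, rep_gen, kap_s_mul hi]
    have e : genOp q t (.T i) (rep K n q t (Tw q t x') (ev 1)) -
        (cc q t (x'⁻¹ i) (x'⁻¹ (i + 1)) * kap q t x' : Frac K n) • ev (s n i * x') =
        genOp q t (.T i) (rep K n q t (Tw q t x') (ev 1) - (kap q t x' : Frac K n) • ev x') +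
          (kap q t x' * (cF (t : K) - cc q t (x'⁻¹ i) (x'⁻¹ (i + 1))) : Frac K n) • ev x' := by
      rw [map_sub, map_smul, genOp_T]
      module
    rw [e]
    exact add_mem (genOp_T_mem_lowM i h) (Submodule.smul_mem _ _ (ev_mem_lowM (by omega)))

variable (K n) in
/-- The map `∑ e_x g_x ↦ ∑ T_x e_1 g_x`. -/
def theta (q t : Kˣ) : Module.End (Frac K n) (Mod K n) :=
  linMap K fun x => rep K n q t (Tw q t x) (ev 1)

theorem ev_self (x : AffPerm n) : (ev x : Mod K n) x = 1 := Finsupp.single_eq_same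

theorem ev_of_ne {x y : AffPerm n} (h : x ≠ y) : (ev y : Mod K n) x = 0 :=
  Finsupp.single_eq_of_ne h

theorem rep_Tw_ev_apply {x y : AffPerm n} (h : len y ≤ len x) :
    (rep K n q t (Tw q t y) (ev 1)) x = kap q t y * (ev y : Mod K n) x := by
  have h1 := mem_lowM.1 (rep_Tw_sub_mem (K := K) (q := q) (t := t) y) x h
  rwa [Finsupp.sub_apply, sub_eq_zero, Finsupp.smul_apply, smul_eq_mul] at h1

/-- At an index of maximal length in the support, the lower terms of the other T_y e_1 do not
contribute. -/
theorem theta_apply_top {g : Mod K n} {x : AffPerm n} (h : ∀ y, g y ≠ 0 → len y ≤ len x) :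
    theta K n q t g x = g x * kap q t x := by
  rw [theta, linMap, Finsupp.linearCombination_apply, Finsupp.sum_apply, Finsupp.sum,
    Finset.sum_eq_single x]
  · rw [Finsupp.smul_apply, rep_Tw_ev_apply le_rfl, ev_self, mul_one, smul_eq_mul]
  · intro y hy hne
    rw [Finsupp.smul_apply, rep_Tw_ev_apply (h y (Finsupp.mem_support_iff.1 hy)),
      ev_of_ne (Ne.symm hne), mul_zero, smul_zero]
  · intro hx
    rw [Finsupp.notMem_support_iff.1 hx, zero_smul, Finsupp.zero_apply]

theorem exists_top {R : Type*} [Zero R] {g : AffPerm n →₀ R} (hg : g ≠ 0) :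
    ∃ x, g x ≠ 0 ∧ ∀ y, g y ≠ 0 → len y ≤ len x := by
  obtain ⟨x, hx, hmax⟩ := g.support.exists_max_image len (Finsupp.support_nonempty_iff.2 hg)
  exact ⟨x, Finsupp.mem_support_iff.1 hx, fun y hy => hmax y (Finsupp.mem_support_iff.2 hy)⟩

/-- Triangularity with nonzero diagonal. Both the independence half of PBW and the uniqueness of
normal orderings are read off from this. -/
theorem theta_injective : Function.Injective (theta K n q t) := by
  rw [injective_iff_map_eq_zero]
  intro g hg
  by_contra hne
  obtain ⟨x, hx, hmax⟩ := exists_top hne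
  have := theta_apply_top (q := q) (t := t) hmax
  rw [hg, Finsupp.zero_apply] at this
  exact mul_ne_zero hx (kap_ne_zero x) this.symm

/-- The expansion of `e_u` in the basis `T_x e_1` has leading term at `u`. -/
theorem theta_eq_ev {g : Mod K n} {u : AffPerm n} (h : theta K n q t g = ev u) :
    g u * kap q t u = 1 ∧ ∀ x, g x ≠ 0 → x = u ∨ len x < len u := by
  have hne : g ≠ 0 := by
    rintro rfl
    rw [map_zero, ev, eq_comm, Finsupp.single_eq_zero] at h
    exact one_ne_zero h
  have key : ∀ x, g x ≠ 0 → (∀ y, g y ≠ 0 → len y ≤ len x) → x = u := by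
    intro x hx hmax
    have := theta_apply_top (q := q) (t := t) hmax
    rw [h] at this
    by_contra hxu
    rw [ev_of_ne hxu] at this
    exact mul_ne_zero hx (kap_ne_zero x) this.symm
  obtain ⟨x, hx, hmax⟩ := exists_top hne
  obtain rfl := key x hx hmax
  refine ⟨?_, fun y hy => ?_⟩
  · rw [← theta_apply_top (q := q) (t := t) hmax, h, ev_self]
  · rcases (hmax y hy).lt_or_eq with h' | h'
    · exact Or.inr h'
    · exact Or.inl (key y hy fun z hz => (hmax z hz).trans h'.ge)

/-! ### The action of Laurent polynomials and of the intertwiners -/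

variable (K n) in
/-- Diagonal operators. -/
def diagHom : (AffPerm n → Frac K n) →ₐ[K] Module.End (Frac K n) (Mod K n) where
  toFun d := linMap K fun v => d v • ev v
  map_one' := linMap_ext fun v => by simp
  map_mul' d d' := linMap_ext fun v => by
    rw [Module.End.mul_apply, linMap_ev, linMap_ev, map_smul, linMap_ev, smul_smul, Pi.mul_apply,
      mul_comm]
  map_zero' := linMap_ext fun v => by simp
  map_add' d d' := linMap_ext fun v => by simp [add_smul]
  commutes' c := linMap_ext fun v => by
    rw [linMap_ev, Algebra.algebraMap_eq_smul_one, Algebra.algebraMap_eq_smul_one, ← cF_smul_end,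
      Pi.smul_apply, Pi.one_apply, ← Algebra.algebraMap_eq_smul_one]
    rfl

theorem rep_laurentToH (P : Laurent K n) (v : AffPerm n) :
    rep K n q t (laurentToH n q t P) (ev v) =
      algebraMap (Laurent K n) (Frac K n) (actL q v⁻¹ P) • ev v := by
  have h : (rep K n q t).comp (laurentToH n q t) = (diagHom K n).comp
      (AlgHom.pi fun v : AffPerm n =>
        (IsScalarTower.toAlgHom K (Laurent K n) (Frac K n)).comp (actL q v⁻¹)) := by
    refine laurent_hom_ext q fun i => linMap_ext fun v => ?_
    simp only [AlgHom.comp_apply]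
    rw [laurentToH_yL, rep_gen, genOp_Y]
    change _ = linMap K _ (ev v)
    rw [linMap_ev]
    change _ = algebraMap (Laurent K n) (Frac K n) (actL q v⁻¹ (yL q i)) • ev v
    rw [actL_yL]
    rfl
  have h1 := congrArg (fun φ : Module.End (Frac K n) (Mod K n) => φ (ev v))
    (DFunLike.congr_fun h P)
  refine h1.trans ?_
  change linMap K _ (ev v) = _
  rw [linMap_ev]
  rfl

theorem rep_laurentToH_one (P : Laurent K n) :
    rep K n q t (laurentToH n q t P) (ev 1) =
      algebraMap (Laurent K n) (Frac K n) P • ev 1 := by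
  have : actL q (1 : AffPerm n)⁻¹ = AlgHom.id K (Laurent K n) :=
    laurent_hom_ext q fun i => by simp
  rw [rep_laurentToH, this]
  rfl

/-- Taking the commutator with Y_i kills the diagonal part of T_i and multiplies the other part by a
difference of eigenvalues, which clears the denominator of `cc`. -/
theorem rep_phi (i : ℤ) (v : AffPerm n) :
    rep K n q t (phi n q t i) (ev v) =
      (fF q t (v⁻¹ i) (v⁻¹ (i + 1)) : Frac K n) • ev (s n i * v) := by
  have h : (cc q t (v⁻¹ i) (v⁻¹ (i + 1)) : Frac K n) * (yF q (v⁻¹ i) - yF q (v⁻¹ (i + 1))) =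
      fF q t (v⁻¹ i) (v⁻¹ (i + 1)) :=
    div_mul_cancel₀ _ (inv_sub_ne_zero v (not_dvd_sub_succ i))
  rw [← h, phi, map_sub, map_mul, map_mul, rep_gen, rep_gen, LinearMap.sub_apply,
    Module.End.mul_apply, Module.End.mul_apply, genOp_Y, LinearMap.map_smul, genOp_T,
    LinearMap.map_add, LinearMap.map_smul, LinearMap.map_smul, genOp_Y, genOp_Y, inv_s_mul_apply, s_self]
  module

theorem repL_nu (i : ℤ) (v : AffPerm n) : repL K n q t (nu n q t i) (ev v) = ev (s n i * v) := by
  have hu := isUnit_fL n q t i (i + 1) (not_dvd_sub_succ i)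
  have h1 : nu n q t i * toLoc n q t (laurentToH n q t (fL n q t i (i + 1))) =
      toLoc n q t (phi n q t i) := by
    rw [nu, mul_assoc, Ring.inverse_mul_cancel _ hu, mul_one]
  have h2 := congrArg (fun h => repL K n q t h (ev v)) h1
  simp only [map_mul, repL_toLoc, Module.End.mul_apply, rep_laurentToH, rep_phi, map_smul] at h2
  have h3 : algebraMap (Laurent K n) (Frac K n) (actL q v⁻¹ (fL n q t i (i + 1))) =
      fF q t (v⁻¹ i) (v⁻¹ (i + 1)) := by
    rw [← algebraMap_fL]
    simp [fL]
  rw [h3] at h2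
  exact smul_right_injective _ (fF_ne_zero q t (not_dvd_apply v⁻¹ (not_dvd_sub_succ i))) h2

/-- The purpose of the representation: a normal ordering of ν_w is an expansion of e_w in the
vectors T_x e_1. The computation works for every word, so the chosen reduced word plays no role. -/
theorem repL_nuW (w : AffPerm n) : repL K n q t (nuW q t w) (ev 1) = ev w := by
  have key : ∀ (l : List ℤ) (k : ℤ), repL K n q t ((l.map (nu n q t)).prod *
      toLoc n q t ((piUnit n q t ^ k : (H n q t)ˣ) : H n q t)) (ev 1) = ev (wordVal n (l, k)) := by
    intro l k
    induction l with
    | nil => rw [List.map_nil, List.prod_nil, one_mul, repL_toLoc, rep_piUnit_zpow, mul_one,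
        wordVal_nil]
    | cons i l ih => rw [List.map_cons, List.prod_cons, mul_assoc, map_mul, Module.End.mul_apply,
        ih, repL_nu, wordVal_cons]
  have := key (redWord w).1 (redWord w).2
  rwa [wordVal_redWord] at this

/-! ### Uniqueness of normal orderings -/

variable (n q t) in
/-- The inclusion of the localized Laurent polynomials in the rational functions. -/
def locToF : LaurentLoc n q t →+* Frac K n :=
  IsLocalization.lift (M := fSet n q t) (g := algebraMap (Laurent K n) (Frac K n)) fun f => by
    obtain ⟨f, hf⟩ := f
    rw [isUnit_iff_ne_zero]
    change algebraMap (Laurent K n) (Frac K n) f ≠ 0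
    induction hf using Submonoid.closure_induction with
    | mem x hx =>
      obtain ⟨i, j, h, rfl⟩ := hx
      rw [algebraMap_fL]
      exact fF_ne_zero q t h
    | one => simp
    | mul x y _ _ hx hy => rw [map_mul]; exact mul_ne_zero hx hy

theorem locToF_algebraMap (P : Laurent K n) :
    locToF n q t (algebraMap _ _ P) = algebraMap (Laurent K n) (Frac K n) P :=
  IsLocalization.lift_eq _ _

theorem locToF_mem_ne_zero (f : fSet n q t) :
    algebraMap (Laurent K n) (Frac K n) f ≠ 0 := by
  rw [← locToF_algebraMap (q := q) (t := t)]
  exact ((IsLocalization.map_units (LaurentLoc n q t) f).map (locToF n q t)).ne_zero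

theorem locToF_injective : Function.Injective (locToF (K := K) n q t) := by
  rw [injective_iff_map_eq_zero]
  intro c hc
  obtain ⟨⟨P, Q⟩, h⟩ := IsLocalization.surj (fSet n q t) c
  have h1 := congrArg (locToF n q t) h
  simp only [map_mul, hc, zero_mul, locToF_algebraMap] at h1
  have h2 : P = 0 := algebraMap_F_injective (by rw [← h1, map_zero])
  simp only [h2, map_zero] at h
  exact (IsLocalization.map_units (LaurentLoc n q t) Q).mul_left_eq_zero.1 h

/-- Clear the denominator, which acts on e_1 by a nonzero scalar. -/
theorem repL_laurentLocToHLoc (c : LaurentLoc n q t) :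
    repL K n q t (laurentLocToHLoc n q t c) (ev 1) = locToF n q t c • ev 1 := by
  obtain ⟨⟨P, Q⟩, h⟩ := IsLocalization.surj (fSet n q t) c
  have h1 := congrArg (locToF n q t) h
  have h2 := congrArg (fun c => repL K n q t (laurentLocToHLoc n q t c) (ev 1)) h
  simp only [map_mul, locToF_algebraMap] at h1
  simp only [map_mul, laurentLocToHLoc_algebraMap, Module.End.mul_apply, repL_toLoc,
    rep_laurentToH_one, map_smul] at h2
  refine smul_right_injective _ (locToF_mem_ne_zero Q) ?_
  simp only
  rw [h2, smul_smul, mul_comm, h1]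

theorem theta_of_isNormalOrdering {h : HLoc n q t} {g : AffPerm n →₀ LaurentLoc n q t}
    (hg : IsNormalOrdering h g) :
    theta K n q t (g.mapRange (locToF n q t) (map_zero _)) = repL K n q t h (ev 1) := by
  have hg' : h = _ := hg
  rw [hg', theta, linMap, Finsupp.linearCombination_apply, Finsupp.sum_mapRange_index (by simp),
    Finsupp.sum, Finsupp.sum, map_sum, LinearMap.sum_apply]
  refine Finset.sum_congr rfl fun x _ => ?_
  rw [map_mul, Module.End.mul_apply, repL_laurentLocToHLoc, map_smul, repL_toLoc]

theorem isNormalOrdering_unique {h : HLoc n q t} {g g' : AffPerm n →₀ LaurentLoc n q t}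
    (hg : IsNormalOrdering h g) (hg' : IsNormalOrdering h g') : g' = g := by
  have h1 := theta_injective ((theta_of_isNormalOrdering hg').trans
    (theta_of_isNormalOrdering hg).symm)
  exact Finsupp.mapRange_injective _ (map_zero _) locToF_injective h1

/-! ### The PBW basis -/

variable (K n) in
/-- The map `∑ x, g x ↦ ∑ T_x g_x`. -/
def pbw (q t : Kˣ) : (AffPerm n →₀ Laurent K n) →ₗ[K] H n q t :=
  Finsupp.lsum K fun x => (LinearMap.mulLeft K (Tw q t x)) ∘ₗ (laurentToH n q t).toLinearMap

theorem pbw_apply (g : AffPerm n →₀ Laurent K n) :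
    pbw K n q t g = g.sum fun x b => Tw q t x * laurentToH n q t b := by
  rw [pbw, Finsupp.lsum_apply]; rfl

theorem pbw_single (x : AffPerm n) (b : Laurent K n) :
    pbw K n q t (Finsupp.single x b) = Tw q t x * laurentToH n q t b := by
  rw [pbw_apply, Finsupp.sum_single_index]
  rw [map_zero, mul_zero]

theorem rep_pbw (g : AffPerm n →₀ Laurent K n) :
    rep K n q t (pbw K n q t g) (ev 1) =
      theta K n q t (g.mapRange (algebraMap (Laurent K n) (Frac K n)) (map_zero _)) := by
  rw [theta, linMap, Finsupp.linearCombination_apply, Finsupp.sum_mapRange_index (by simp),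
    pbw_apply, Finsupp.sum, Finsupp.sum, map_sum, LinearMap.sum_apply]
  refine Finset.sum_congr rfl fun x _ => ?_
  rw [map_mul, Module.End.mul_apply, rep_laurentToH_one, map_smul]

theorem pbw_injective : Function.Injective (pbw K n q t) := by
  refine (injective_iff_map_eq_zero (pbw K n q t)).2 fun g hg => ?_
  have h1 := rep_pbw (q := q) (t := t) g
  rw [hg, map_zero, LinearMap.zero_apply, ← map_zero (theta K n q t)] at h1
  have h2 := theta_injective h1
  refine Finsupp.mapRange_injective (algebraMap (Laurent K n) (Frac K n)) (map_zero _)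
    algebraMap_F_injective ?_
  rw [← h2, Finsupp.mapRange_zero]

theorem pbw_surjective : Function.Surjective (pbw K n q t) := fun h => by
  obtain ⟨g, hg⟩ := exists_finsupp_of_mem_filTop (mem_filTop_H h)
  exact ⟨g, by rw [pbw_apply, hg]; rfl⟩

variable (K n) in
/-- The PBW isomorphism. -/
def pbwEquiv (q t : Kˣ) : (AffPerm n →₀ Laurent K n) ≃ₗ[K] H n q t :=
  LinearEquiv.ofBijective (pbw K n q t) ⟨pbw_injective, pbw_surjective⟩

theorem pbw_mul_laurent (g : AffPerm n →₀ Laurent K n) (P : Laurent K n) :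
    pbw K n q t g * laurentToH n q t P =
      pbw K n q t (g.mapRange (· * P) (zero_mul P)) := by
  rw [pbw_apply, pbw_apply, Finsupp.sum_mapRange_index, Finsupp.sum, Finsupp.sum, Finset.sum_mul]
  · exact Finset.sum_congr rfl fun x _ => by rw [map_mul, mul_assoc]
  · intro x; rw [map_zero, mul_zero]

/-! ### Right translations -/

theorem rep_algebraMap (c : K) (m : Mod K n) :
    rep K n q t (algebraMap K _ c) m = (cF c : Frac K n) • m := by
  rw [AlgHom.commutes, Algebra.algebraMap_eq_smul_one, ← cF_smul_end]
  rfl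

/-- The operator `e_v g ↦ e_{v u} u⁻¹(g)`. -/
def rightT (q : Kˣ) (u : AffPerm n) : Mod K n →+ Mod K n :=
  (Finsupp.mapDomain.addMonoidHom fun v => v * u).comp
    (Finsupp.mapRange.addMonoidHom (actF q u⁻¹).toAddMonoidHom)

theorem smul_ev (g : Frac K n) (v : AffPerm n) : g • (ev v : Mod K n) = Finsupp.single v g := by
  rw [ev, Finsupp.smul_single, smul_eq_mul, mul_one]

theorem rightT_smul_ev (u v : AffPerm n) (g : Frac K n) :
    rightT q u (g • ev v) = actF q u⁻¹ g • ev (v * u) := by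
  rw [smul_ev, smul_ev, rightT, AddMonoidHom.comp_apply, Finsupp.mapRange.addMonoidHom_apply,
    Finsupp.mapRange_single]
  exact Finsupp.mapDomain_single

theorem mod_induction {p : Mod K n → Prop} (m : Mod K n) (h0 : p 0)
    (hadd : ∀ m m', p m → p m' → p (m + m')) (h1 : ∀ (g : Frac K n) v, p (g • ev v)) : p m := by
  induction m using Finsupp.induction_linear with
  | zero => exact h0
  | add m m' h h' => exact hadd m m' h h'
  | single v g => rw [← smul_ev]; exact h1 g v

theorem rightT_smul (u : AffPerm n) (g : Frac K n) (m : Mod K n) :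
    rightT q u (g • m) = actF q u⁻¹ g • rightT q u m := by
  induction m using mod_induction with
  | h0 => simp
  | hadd m m' h h' => rw [smul_add, map_add, h, h', map_add, smul_add]
  | h1 g' v => rw [smul_smul, rightT_smul_ev, rightT_smul_ev, map_mul, smul_smul]

theorem rightT_ev (u v : AffPerm n) : rightT q u (ev v : Mod K n) = ev (v * u) := by
  have := rightT_smul_ev (q := q) u v (1 : Frac K n)
  rwa [one_smul, map_one, one_smul] at this

theorem mul_inv_apply' (u v : AffPerm n) (i : ℤ) : (v * u)⁻¹ i = u⁻¹ (v⁻¹ i) := by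
  rw [mul_inv_rev, mul_apply']

theorem rightT_genOp (u : AffPerm n) (g : Gen) (m : Mod K n) :
    rightT q u (genOp q t g m) = genOp q t g (rightT q u m) := by
  induction m using mod_induction with
  | h0 => simp
  | hadd m m' h h' => rw [map_add, map_add, h, h', map_add, map_add]
  | h1 c v =>
    rw [map_smul, rightT_smul, rightT_smul_ev, map_smul]
    congr 1
    match g with
    | .T i =>
      rw [genOp_T, map_add, rightT_smul_ev, rightT_smul_ev, genOp_T, map_sub, actF_cF, actF_cc,
        mul_inv_apply', mul_inv_apply', mul_assoc]
    | .pi => rw [genOp_pi, genOp_pi, rightT_ev, mul_assoc]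
    | .piInv => rw [genOp_piInv, genOp_piInv, rightT_ev, mul_assoc]
    | .Y i => rw [genOp_Y, genOp_Y, rightT_smul_ev, actF_yF, mul_inv_apply']
    | .YInv i => rw [genOp_YInv, genOp_YInv, rightT_smul_ev, map_inv₀, actF_yF, mul_inv_apply']

/-- The algebra acts on the left index v with coefficients in the Y_{v⁻¹ i}, and u⁻¹ turns these
into the Y_{(v u)⁻¹ i}. Right translations are thus generic endomorphisms, semilinear over the
rational functions. -/
theorem rightT_rep (u : AffPerm n) (h : H n q t) (m : Mod K n) :
    rightT q u (rep K n q t h m) = rep K n q t h (rightT q u m) := by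
  obtain ⟨z, rfl⟩ := RingQuot.mkAlgHom_surjective K (Rel n q t) h
  rw [rep_mkAlgHom]
  induction z using FreeAlgebra.induction generalizing m with
  | grade0 c =>
    rw [← rep_mkAlgHom, AlgHom.commutes, rep_algebraMap, rep_algebraMap, rightT_smul, actF_cF]
  | grade1 g => rw [FreeAlgebra.lift_ι_apply, rightT_genOp]
  | mul x y hx hy => rw [map_mul, Module.End.mul_apply, Module.End.mul_apply, hx, hy]
  | add x y hx hy => rw [map_add, LinearMap.add_apply, LinearMap.add_apply, map_add, hx, hy]

/-- The formula for T_k e_v solved for e_{s_k v}. A step from e_v to e_{s_k v} can create a pole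
only through the inverse of `cc`. -/
theorem ev_s_mul (k : ℤ) (v : AffPerm n) : (ev (s n k * v) : Mod K n) = ev v +
    (cc q t (v⁻¹ k) (v⁻¹ (k + 1)) : Frac K n)⁻¹ •
      rep K n q t (gen n q t (Gen.T k) - algebraMap K _ (t : K)) (ev v) := by
  have h := cc_ne_zero (K := K) (n := n) q t (not_dvd_apply v⁻¹ (not_dvd_sub_succ k))
  rw [map_sub (rep K n q t), LinearMap.sub_apply, rep_algebraMap, rep_gen, genOp_T]
  set c : Frac K n := cc q t (v⁻¹ k) (v⁻¹ (k + 1))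
  have e : (cF (t : K) - c) • (ev v : Mod K n) + c • ev (s n k * v) -
      (cF (t : K) : Frac K n) • ev v =
      c • (ev (s n k * v) - ev v) := by module
  rw [e, smul_smul, inv_mul_cancel₀ h, one_smul]
  abel

end Triangularity
end DAHA

namespace DAHA

/-! ### Values of rational functions and coordinates on the induced module -/

section Specialization

variable {K : Type*} [Field K] {n : ℕ} {q t : Kˣ} [n.AtLeastTwo] {a : Fin n → Kˣ}

variable (a) in
/-- The rational function `f` is regular at `a`, with value `c`. -/
def Val (f : Frac K n) (c : K) : Prop :=
  ∃ P Q : Laurent K n, evalAt a Q ≠ 0 ∧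
    f * algebraMap (Laurent K n) (Frac K n) Q = algebraMap (Laurent K n) (Frac K n) P ∧
    c = evalAt a P / evalAt a Q

theorem val_algebraMap (P : Laurent K n) :
    Val a (algebraMap (Laurent K n) (Frac K n) P) (evalAt a P) :=
  ⟨P, 1, by simp, by simp, by simp⟩

theorem val_zero : Val a (0 : Frac K n) 0 := by simpa using val_algebraMap (a := a) 0

theorem val_one : Val a (1 : Frac K n) 1 := by simpa using val_algebraMap (a := a) 1

theorem val_cF (c : K) : Val a (cF c : Frac K n) c := by
  have := val_algebraMap (a := a) (algebraMap K (Laurent K n) c)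
  rwa [algebraMap_algebraMap_F, AlgHom.commutes] at this

theorem val_yF (i : ℤ) : Val a (yF q i : Frac K n) (extTuple q a i) := by
  rw [← evalAt_yL]; exact val_algebraMap _

theorem Val.add {f g : Frac K n} {c d : K} (hf : Val a f c) (hg : Val a g d) :
    Val a (f + g) (c + d) := by
  obtain ⟨P, Q, h1, h2, rfl⟩ := hf
  obtain ⟨P', Q', h1', h2', rfl⟩ := hg
  refine ⟨P * Q' + P' * Q, Q * Q', by rw [map_mul]; exact mul_ne_zero h1 h1', ?_, ?_⟩
  · rw [map_mul, map_add, map_mul, map_mul, ← h2, ← h2']; ring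
  · rw [map_mul, map_add, map_mul, map_mul]; field_simp

theorem Val.mul {f g : Frac K n} {c d : K} (hf : Val a f c) (hg : Val a g d) :
    Val a (f * g) (c * d) := by
  obtain ⟨P, Q, h1, h2, rfl⟩ := hf
  obtain ⟨P', Q', h1', h2', rfl⟩ := hg
  refine ⟨P * P', Q * Q', by rw [map_mul]; exact mul_ne_zero h1 h1', ?_, ?_⟩
  · rw [map_mul, map_mul, ← h2, ← h2']; ring
  · rw [map_mul, map_mul]; field_simp

theorem Val.neg {f : Frac K n} {c : K} (hf : Val a f c) : Val a (-f) (-c) := by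
  simpa using (val_cF (a := a) (-1)).mul hf

theorem Val.sub {f g : Frac K n} {c d : K} (hf : Val a f c) (hg : Val a g d) :
    Val a (f - g) (c - d) := by
  simpa [sub_eq_add_neg] using hf.add hg.neg

theorem Val.unique {f : Frac K n} {c d : K} (hf : Val a f c) (hg : Val a f d) : c = d := by
  obtain ⟨P, Q, h1, h2, rfl⟩ := hf
  obtain ⟨P', Q', h1', h2', rfl⟩ := hg
  have h : P * Q' = P' * Q := by
    apply algebraMap_F_injective
    rw [map_mul, map_mul, ← h2, ← h2']; ring
  have := congrArg (evalAt a) h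
  rw [map_mul, map_mul] at this
  field_simp
  linear_combination this

theorem Val.ne_zero {f : Frac K n} {c : K} (hf : Val a f c) (hc : c ≠ 0) : f ≠ 0 := by
  rintro rfl
  exact hc (hf.unique val_zero)

theorem Val.inv {f : Frac K n} {c : K} (hf : Val a f c) (hc : c ≠ 0) : Val a f⁻¹ c⁻¹ := by
  have hf0 := hf.ne_zero hc
  obtain ⟨P, Q, h1, h2, rfl⟩ := hf
  have hP : evalAt a P ≠ 0 := fun h => hc (by rw [h, zero_div])
  exact ⟨Q, P, hP, by rw [← h2, inv_mul_cancel_left₀ hf0], by rw [inv_div]⟩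

theorem Val.div {f g : Frac K n} {c d : K} (hf : Val a f c) (hg : Val a g d) (hd : d ≠ 0) :
    Val a (f / g) (c / d) := by
  rw [div_eq_mul_inv, div_eq_mul_inv]; exact hf.mul (hg.inv hd)

theorem val_prod {ι : Type*} (S : Finset ι) {f : ι → Frac K n} {c : ι → K}
    (h : ∀ i ∈ S, Val a (f i) (c i)) : Val a (∏ i ∈ S, f i) (∏ i ∈ S, c i) := by
  classical
  induction S using Finset.induction_on with
  | empty => simpa using val_one
  | insert i S hi ih =>
    rw [Finset.prod_insert hi, Finset.prod_insert hi]
    exact (h i (by simp)).mul (ih fun j hj => h j (by simp [hj]))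

theorem mem_stab_iff {u : AffPerm n} :
    u ∈ stab q a ↔ ∀ i, extTuple q a (u⁻¹ i) = extTuple q a i := Iff.rfl

theorem extTuple_apply_of_mem {u : AffPerm n} (hu : u ∈ stab q a) (i : ℤ) :
    extTuple q a (u i) = extTuple q a i := by
  have := mem_stab_iff.1 (inv_mem hu) i
  rwa [inv_inv] at this

theorem evalAt_actL {u : AffPerm n} (hu : u ∈ stab q a) (P : Laurent K n) :
    evalAt a (actL q u P) = evalAt a P := by
  have : (evalAt a).comp (actL q u) = evalAt a := by
    refine laurent_hom_ext q fun i => ?_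
    rw [AlgHom.comp_apply, actL_yL, evalAt_yL, evalAt_yL, extTuple_apply_of_mem hu]
  exact DFunLike.congr_fun this P

/-- Evaluation at `a` is invariant under its stabilizer, so numerator and denominator keep their
values. -/
theorem Val.act {u : AffPerm n} (hu : u ∈ stab q a) {f : Frac K n} {c : K} (hf : Val a f c) :
    Val a (actF q u f) c := by
  obtain ⟨P, Q, h1, h2, rfl⟩ := hf
  refine ⟨actL q u P, actL q u Q, by rwa [evalAt_actL hu], ?_, ?_⟩
  · rw [← actF_algebraMap, ← actF_algebraMap, ← map_mul, h2]
  · rw [evalAt_actL hu, evalAt_actL hu]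

/-! ### Coordinates on the induced module -/

theorem gen_Y_sub_mem (k : Fin n) :
    gen n q t (Gen.Y ((k : ℤ) + 1)) - algebraMap K (H n q t) (a k : K) ∈ indIdeal q t a :=
  Ideal.subset_span ⟨k, rfl⟩

/-- The Laurent polynomials sent into the left ideal form an ideal J, so it suffices to compare two
algebra maps into the quotient by J on the variables. -/
theorem laurentToH_sub_mem (P : Laurent K n) :
    laurentToH n q t P - algebraMap K _ (evalAt a P) ∈ indIdeal q t a := by
  let J : Ideal (Laurent K n) :=
    { carrier := {P | laurentToH n q t P ∈ indIdeal q t a}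
      add_mem' := fun {P R} hP hR => by
        change laurentToH n q t (P + R) ∈ indIdeal q t a
        rw [map_add]; exact add_mem hP hR
      zero_mem' := by
        change laurentToH n q t 0 ∈ indIdeal q t a
        rw [map_zero]; exact zero_mem _
      smul_mem' := fun R P hP => by
        change laurentToH n q t (R * P) ∈ indIdeal q t a
        rw [map_mul]; exact Ideal.mul_mem_left _ _ hP }
  have h : Ideal.Quotient.mkₐ K J =
      (Algebra.ofId K (Laurent K n ⧸ J)).comp (evalAt a) := by
    refine laurent_hom_ext q (map_yL _ q (fun i => ((Algebra.ofId K (Laurent K n ⧸ J)).comp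
      (evalAt a)) (yL q i)) (fun i m => ?_) fun k => ?_)
    · rw [yL_add_mul, map_smul]
    · rw [AlgHom.comp_apply, evalAt_yL, extTuple, ext_succ, Algebra.ofId_apply,
        Ideal.Quotient.mkₐ_eq_mk, IsScalarTower.algebraMap_apply K (Laurent K n) (Laurent K n ⧸ J),
        Ideal.Quotient.algebraMap_eq, Ideal.Quotient.eq]
      change laurentToH n q t _ ∈ indIdeal q t a
      rw [map_sub, laurentToH_yL, AlgHom.commutes]
      exact gen_Y_sub_mem k
  have h1 := DFunLike.congr_fun h P
  rw [AlgHom.comp_apply, Algebra.ofId_apply, Ideal.Quotient.mkₐ_eq_mk,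
    IsScalarTower.algebraMap_apply K (Laurent K n) (Laurent K n ⧸ J),
    Ideal.Quotient.algebraMap_eq, Ideal.Quotient.eq] at h1
  have h2 : laurentToH n q t (P - algebraMap K _ (evalAt a P)) ∈ indIdeal q t a := h1
  rwa [map_sub, AlgHom.commutes] at h2

variable (a) in
theorem tmulV_smul (c : K) (h : H n q t) : tmulV a (c • h) = c • tmulV a h := rfl

variable (a) in
theorem smul_tmulV (h h' : H n q t) : h • tmulV a h' = tmulV a (h * h') := rfl

theorem tmulV_surjective (z : Ind q t a) : ∃ h, tmulV a h = z := Submodule.Quotient.mk_surjective _ z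

theorem ind_zero_smul (z : Ind q t a) : (0 : K) • z = 0 := by
  obtain ⟨h, rfl⟩ := tmulV_surjective z
  rw [← tmulV_smul]
  exact congrArg (tmulV a) (zero_smul K h)

theorem tmulV_eq_iff {h h' : H n q t} : tmulV a h = tmulV a h' ↔ h - h' ∈ indIdeal q t a :=
  Submodule.Quotient.eq _

theorem tmulV_mul_laurent (h : H n q t) (P : Laurent K n) :
    tmulV a (h * laurentToH n q t P) = evalAt a P • tmulV a h := by
  rw [← tmulV_smul, tmulV_eq_iff, Algebra.smul_def, Algebra.commutes, ← mul_sub]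
  exact Ideal.mul_mem_left _ _ (laurentToH_sub_mem P)

theorem tmulV_sum {ι : Type*} (S : Finset ι) (f : ι → H n q t) :
    tmulV a (∑ x ∈ S, f x) = ∑ x ∈ S, tmulV a (f x) :=
  map_sum (Submodule.mkQ (indIdeal q t a)) f S

variable (q t a) in
/-- Coordinates of elements of `ℍ`, evaluated at `a`. -/
def coefH : H n q t →ₗ[K] (AffPerm n →₀ K) :=
  (Finsupp.mapRange.linearMap (evalAt a).toLinearMap) ∘ₗ (pbwEquiv K n q t).symm.toLinearMap

theorem coefH_pbw (g : AffPerm n →₀ Laurent K n) :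
    coefH q t a (pbw K n q t g) = g.mapRange (evalAt a) (map_zero _) := by
  have : (pbwEquiv K n q t).symm (pbw K n q t g) = g := (pbwEquiv K n q t).symm_apply_apply g
  rw [coefH, LinearMap.comp_apply, LinearEquiv.coe_coe, this]
  rfl

theorem coefH_mul_laurent (h : H n q t) (P : Laurent K n) :
    coefH q t a (h * laurentToH n q t P) = evalAt a P • coefH q t a h := by
  obtain ⟨g, rfl⟩ := pbw_surjective h
  rw [pbw_mul_laurent, coefH_pbw, coefH_pbw]
  ext x
  simp [mul_comm]

/-- Right multiplication by Y_k multiplies every PBW coefficient by Y_k, and after evaluation this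
is multiplication by a_k. Hence the coordinates descend to the quotient and the T_x ⊗ v stay
independent. -/
theorem coefH_eq_zero {h : H n q t} (hh : h ∈ indIdeal q t a) : coefH q t a h = 0 := by
  rw [indIdeal, Ideal.span, Submodule.mem_span_range_iff_exists_fun] at hh
  obtain ⟨c, rfl⟩ := hh
  rw [map_sum]
  refine Finset.sum_eq_zero fun k _ => ?_
  rw [smul_eq_mul, mul_sub, map_sub, ← laurentToH_yL, coefH_mul_laurent, ← Algebra.commutes,
    ← Algebra.smul_def, map_smul, evalAt_yL, extTuple, ext_succ, sub_self]

variable (q t a) in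
/-- The coordinates of an element of the induced module with respect to the `T_x ⊗ v`. -/
def coef : Ind q t a →ₗ[K] (AffPerm n →₀ K) where
  toFun z := Quotient.liftOn' z (coefH q t a) fun h h' hh => by
    have : h - h' ∈ indIdeal q t a := (Submodule.quotientRel_def _).1 hh
    rw [← sub_eq_zero, ← map_sub]
    exact coefH_eq_zero this
  map_add' z z' := by
    obtain ⟨h, rfl⟩ := tmulV_surjective z
    obtain ⟨h', rfl⟩ := tmulV_surjective z'
    exact map_add (coefH q t a) h h'
  map_smul' c z := by
    obtain ⟨h, rfl⟩ := tmulV_surjective z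
    exact map_smul (coefH q t a) c h

@[simp] theorem coef_tmulV (h : H n q t) : coef q t a (tmulV a h) = coefH q t a h := rfl

theorem coef_tmulV_pbw (g : AffPerm n →₀ Laurent K n) :
    coef q t a (tmulV a (pbw K n q t g)) = g.mapRange (evalAt a) (map_zero _) := coefH_pbw g

theorem sum_coef (z : Ind q t a) :
    (coef q t a z).sum (fun x c => c • tmulV a (Tw q t x)) = z := by
  obtain ⟨h, rfl⟩ := tmulV_surjective z
  obtain ⟨g, rfl⟩ := pbw_surjective h
  rw [coef_tmulV_pbw, Finsupp.sum_mapRange_index (h := fun x c => c • tmulV a (Tw q t x))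
    (fun x => ind_zero_smul _), pbw_apply,
    Finsupp.sum, Finsupp.sum, tmulV_sum]
  exact Finset.sum_congr rfl fun x _ => (tmulV_mul_laurent _ _).symm

theorem coef_injective : Function.Injective (coef q t a) := fun z z' h => by
  rw [← sum_coef z, ← sum_coef z', h]

theorem coef_tmulV_Tw (x : AffPerm n) : coef q t a (tmulV a (Tw q t x)) = Finsupp.single x 1 := by
  have : Tw q t x = pbw K n q t (Finsupp.single x 1) := by
    rw [pbw_single, map_one, mul_one]
  rw [this, coef_tmulV_pbw, Finsupp.mapRange_single, map_one]

/-! ### Specialization -/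

variable (t a) in
/-- The element `m = ∑ T_x e_1 g_x` has coefficients regular at `a`, and `z = ∑ g_x(a) T_x ⊗ v`. -/
def Spec (q : Kˣ) (m : Mod K n) (z : Ind q t a) : Prop :=
  ∃ g : Mod K n, theta K n q t g = m ∧ ∀ x, Val a (g x) (coef q t a z x)

theorem Spec.unique {m : Mod K n} {z z' : Ind q t a} (h : Spec t a q m z) (h' : Spec t a q m z') :
    z = z' := by
  obtain ⟨g, h1, h2⟩ := h
  obtain ⟨g', h1', h2'⟩ := h'
  obtain rfl : g = g' := theta_injective (h1.trans h1'.symm)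
  exact coef_injective (Finsupp.ext fun x => (h2 x).unique (h2' x))

theorem spec_zero : Spec t a q (0 : Mod K n) 0 :=
  ⟨0, map_zero _, fun x => by rw [map_zero]; exact val_zero⟩

theorem Spec.add {m m' : Mod K n} {z z' : Ind q t a} (h : Spec t a q m z)
    (h' : Spec t a q m' z') : Spec t a q (m + m') (z + z') := by
  obtain ⟨g, h1, h2⟩ := h
  obtain ⟨g', h1', h2'⟩ := h'
  refine ⟨g + g', by rw [map_add, h1, h1'], fun x => ?_⟩
  rw [map_add]
  exact (h2 x).add (h2' x)

theorem Spec.smul {m : Mod K n} {z : Ind q t a} (h : Spec t a q m z) {f : Frac K n} {c : K}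
    (hf : Val a f c) : Spec t a q (f • m) (c • z) := by
  obtain ⟨g, h1, h2⟩ := h
  refine ⟨f • g, by rw [map_smul, h1], fun x => ?_⟩
  rw [map_smul]
  exact hf.mul (h2 x)

theorem spec_sum {ι : Type*} (S : Finset ι) {m : ι → Mod K n} {z : ι → Ind q t a}
    (h : ∀ i ∈ S, Spec t a q (m i) (z i)) : Spec t a q (∑ i ∈ S, m i) (∑ i ∈ S, z i) := by
  classical
  induction S using Finset.induction_on with
  | empty => exact spec_zero
  | insert i S hi ih =>
    rw [Finset.sum_insert hi, Finset.sum_insert hi]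
    exact (h i (by simp)).add (ih fun j hj => h j (by simp [hj]))

theorem spec_rep_ev_one (h : H n q t) : Spec t a q (rep K n q t h (ev 1)) (tmulV a h) := by
  obtain ⟨g, rfl⟩ := pbw_surjective h
  refine ⟨_, (rep_pbw g).symm, fun x => ?_⟩
  rw [coef_tmulV_pbw, Finsupp.mapRange_apply, Finsupp.mapRange_apply]
  exact val_algebraMap _

theorem spec_ev_one : Spec t a q (ev 1 : Mod K n) (tmulV a 1) := by
  simpa using spec_rep_ev_one (K := K) (q := q) (t := t) (a := a) 1

theorem Spec.exists_sum {m : Mod K n} {z : Ind q t a} (h : Spec t a q m z) :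
    ∃ (S : Finset (AffPerm n)) (f : AffPerm n → Frac K n) (c : AffPerm n → K),
      (∀ x, Val a (f x) (c x)) ∧ m = ∑ x ∈ S, f x • rep K n q t (Tw q t x) (ev 1) ∧
      z = ∑ x ∈ S, c x • tmulV a (Tw q t x) := by
  obtain ⟨g, rfl, h2⟩ := h
  refine ⟨g.support, g, coef q t a z, h2, ?_, ?_⟩
  · rw [theta, linMap, Finsupp.linearCombination_apply, Finsupp.sum]
  · conv_lhs => rw [← sum_coef z]
    refine Finsupp.sum_of_support_subset _ ?_ _ fun x _ => ind_zero_smul _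
    intro x hx
    rw [Finsupp.mem_support_iff] at hx ⊢
    exact (h2 x).ne_zero hx

theorem Spec.rep {m : Mod K n} {z : Ind q t a} (h : Spec t a q m z) (y : H n q t) :
    Spec t a q (rep K n q t y m) (y • z) := by
  obtain ⟨S, f, c, hv, rfl, rfl⟩ := h.exists_sum
  rw [map_sum, Finset.smul_sum]
  refine spec_sum S fun x _ => ?_
  have e : y • c x • tmulV a (Tw q t x) = c x • tmulV a (y * Tw q t x) := by
    rw [← tmulV_smul, smul_tmulV, ← tmulV_smul, mul_smul_comm]
  rw [e, map_smul, ← Module.End.mul_apply, ← map_mul]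
  exact (spec_rep_ev_one _).smul (hv x)

/-- Translating ∑ g_x T_x e_1 gives ∑ u⁻¹(g_x) T_x e_u, and u⁻¹(g_x) has the same value at `a` as
g_x. The resulting vector is the image of z under the endomorphism sending 1 ⊗ v to z'. -/
theorem Spec.rightT {m : Mod K n} {z z' : Ind q t a} (h : Spec t a q m z) {u : AffPerm n}
    (hu : u ∈ stab q a) (hz' : Spec t a q (ev u) z') :
    Spec t a q (rightT q u m) ((coef q t a z).sum fun x c => c • (Tw q t x • z')) := by
  obtain ⟨g, rfl, h2⟩ := h
  have e : (coef q t a z).sum (fun x c => c • (Tw q t x • z')) =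
      ∑ x ∈ g.support, coef q t a z x • (Tw q t x • z') := by
    refine Finsupp.sum_of_support_subset _ ?_ _ fun x _ => ind_zero_smul _
    intro x hx
    rw [Finsupp.mem_support_iff] at hx ⊢
    exact (h2 x).ne_zero hx
  rw [e, theta, linMap, Finsupp.linearCombination_apply, Finsupp.sum, map_sum]
  refine spec_sum _ fun x _ => ?_
  rw [rightT_smul, rightT_rep, rightT_ev, one_mul]
  exact (hz'.rep _).smul ((h2 x).act (inv_mem hu))

end Specialization
end DAHA

namespace DAHA

/-! ### Regularity at `a` of the basis vectors indexed by the stabilizer -/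

section Regularity

variable {K : Type*} [Field K] {n : ℕ} {q t : Kˣ} [n.AtLeastTwo] {a : Fin n → Kˣ}

variable (q a) in
/-- Different subscripts at which the extended tuple takes the same value differ by more than
`n`. -/
def Separated : Prop := ∀ i j : ℤ, i < j → extTuple q a i = extTuple q a j → i + n < j

variable (t) in
/-- The standing assumption on the parameters. -/
structure Generic (q : Kˣ) (a : Fin n → Kˣ) : Prop where
  pow_ne_one : ∀ m : ℕ, 0 < m → t ^ m ≠ 1
  q_eq : q = (t ^ 2)⁻¹
  sep : Separated q a

theorem extTuple_add_mul (q : Kˣ) (a : Fin n → Kˣ) (i m : ℤ) :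
    extTuple q a (i + m * n) = ((q ^ (-m) : Kˣ) : K) * extTuple q a i := ext_add_mul q _ i m

theorem extTuple_ne_zero (q : Kˣ) (a : Fin n → Kˣ) (i : ℤ) : extTuple q a i ≠ 0 := by
  rw [extTuple, ext, smul_eq_mul]
  exact mul_ne_zero (Units.ne_zero _) (Units.ne_zero _)

theorem zpow_eq_one {t : Kˣ} (ht : ∀ m : ℕ, 0 < m → t ^ m ≠ 1) {z : ℤ} (h : t ^ z = 1) :
    z = 0 := by
  by_contra hz
  refine ht z.natAbs (Int.natAbs_pos.2 hz) ?_
  rcases Int.natAbs_eq z with h' | h' <;> rw [h'] at h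
  · rwa [zpow_natCast] at h
  · rwa [zpow_neg, zpow_natCast, inv_eq_one] at h

/-- Let k, l be the residues of i, j in the window and m, m' their periods, so that a_k / a_l =
t^(2(m' - m)). If k < l, descent gives m' ≥ m and transversality excludes equality, so j - i > n. If
k = l, then m = m' and i = j. If k > l, descent gives m ≥ m', which contradicts i < j. -/
theorem separated (ht : ∀ m : ℕ, 0 < m → t ^ m ≠ 1) (hq : q = (t ^ 2)⁻¹)
    (hdesc : IsDescending t a) (htrans : Function.Injective a) : Separated q a := by
  intro i j hij h
  have hn := n_pos (n := n)
  have key : ∀ k l : Fin n, ∀ m m' : ℤ, ((q ^ (-m) : Kˣ) : K) * a k = ((q ^ (-m') : Kˣ) : K) * a l →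
      a k / a l = t ^ (2 * (m' - m)) := by
    intro k l m m' h
    have h' : q ^ (-m) * a k = q ^ (-m') * a l := Units.ext h
    have e : ∀ z : ℤ, q ^ (-z) = t ^ (2 * z) := fun z => by
      rw [hq, inv_zpow, zpow_neg, inv_inv, zpow_mul]; rfl
    rw [e, e] at h'
    rw [mul_sub, zpow_sub, div_eq_iff_eq_mul, mul_assoc, mul_comm _ (a l), ← mul_assoc, ← h',
      mul_comm, inv_mul_cancel_left]
  have hi := idx_spec (n := n) i
  have hj := idx_spec (n := n) j
  have h' := key _ _ _ _ h
  have h'' := key _ _ _ _ h.symm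
  set k := idx n i
  set l := idx n j
  set m := (i - 1) / (n : ℤ)
  set m' := (j - 1) / (n : ℤ)
  have hk : ((k : ℕ) : ℤ) < n := by exact_mod_cast k.2
  have hl : ((l : ℕ) : ℤ) < n := by exact_mod_cast l.2
  rcases lt_trichotomy k l with hkl | hkl | hkl
  · have h1 := hdesc k l hkl _ h'
    have h2 : m' - m ≠ 0 := fun h0 => hkl.ne (htrans (by
      rwa [h0, mul_zero, zpow_zero, div_eq_one] at h'))
    have h3 : ((k : ℕ) : ℤ) < l := by exact_mod_cast hkl
    have h4 : 1 ≤ m' - m := by omega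
    nlinarith [mul_le_mul_of_nonneg_right h4 hn.le]
  · rw [hkl, div_self'] at h'
    have h2 := zpow_eq_one ht h'.symm
    have h3 : m' = m := by omega
    rw [hkl] at hi
    rw [h3] at hj
    omega
  · have h1 := hdesc l k hkl _ h''
    have h3 : ((l : ℕ) : ℤ) < k := by exact_mod_cast hkl
    nlinarith

theorem Generic.extTuple_add (hg : Generic t q a) (i : ℤ) :
    extTuple q a (i + n) = (t : K) ^ 2 * extTuple q a i := by
  have := extTuple_add_mul q a i 1
  rw [one_mul] at this
  rw [this, zpow_neg_one, hg.q_eq, inv_inv, Units.val_pow_eq_pow_val]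

theorem Generic.extTuple_sub (hg : Generic t q a) (i : ℤ) :
    extTuple q a i = (t : K) ^ 2 * extTuple q a (i - n) := by
  rw [← hg.extTuple_add, sub_add_cancel]

theorem Generic.eq_add_iff (hg : Generic t q a) (i j : ℤ) :
    extTuple q a i = extTuple q a (j + n) ↔ extTuple q a (i - n) = extTuple q a j := by
  have ht : (t : K) ^ 2 ≠ 0 := pow_ne_zero _ t.ne_zero
  rw [hg.extTuple_sub i, hg.extTuple_add j]
  exact ⟨fun h => mul_left_cancel₀ ht h, fun h => by rw [h]⟩

theorem Generic.eq_of_dvd (hg : Generic t q a) {i j : ℤ} (h : (n : ℤ) ∣ j - i)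
    (hA : extTuple q a i = extTuple q a j) : i = j := by
  obtain ⟨m, hm⟩ := h
  rw [show j = i + m * n by linarith [mul_comm m (n : ℤ)], extTuple_add_mul, eq_comm,
    mul_eq_right₀ (extTuple_ne_zero q a i)] at hA
  have h1 : q ^ (-m) = 1 := Units.ext hA
  have h2 : t ^ (2 * m) = 1 := by
    rw [← h1, hg.q_eq, inv_zpow, zpow_neg, inv_inv, zpow_mul]; rfl
  have := zpow_eq_one hg.pow_ne_one h2
  obtain rfl : m = 0 := by omega
  linarith

/-- Since q = t⁻², f_{ij} vanishes at `a` only if a_j = t² a_i = a_{i+n}. Zeros of the f_{ij} are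
therefore also coincidences in the extended tuple, which `Separated` controls. -/
theorem Generic.f_ne_zero (hg : Generic t q a) {i j : ℤ}
    (h : extTuple q a j ≠ extTuple q a (i + n)) :
    (t : K) * extTuple q a i - (t : K)⁻¹ * extTuple q a j ≠ 0 := by
  intro h0
  rw [hg.extTuple_add] at h
  have := t.ne_zero
  field_simp at h0
  exact h (by linear_combination -h0)

theorem val_fF (i j : ℤ) : Val a (fF q t i j : Frac K n)
    ((t : K) * extTuple q a i - (t : K)⁻¹ * extTuple q a j) :=
  ((val_cF _).mul (val_yF i)).sub ((val_cF _).mul (val_yF j))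

theorem Generic.val_cc_inv (hg : Generic t q a) {i j : ℤ}
    (h : extTuple q a j ≠ extTuple q a (i + n)) :
    Val a (cc q t i j : Frac K n)⁻¹ ((extTuple q a i - extTuple q a j) /
      ((t : K) * extTuple q a i - (t : K)⁻¹ * extTuple q a j)) := by
  rw [cc, inv_div]
  exact ((val_yF i).sub (val_yF j)).div (val_fF i j) (hg.f_ne_zero h)

variable (a) in
/-- `f` is regular at `a`. -/
def RegF (f : Frac K n) : Prop := ∃ c, Val a f c

theorem RegF.sub {f g : Frac K n} (hf : RegF a f) (hg : RegF a g) : RegF a (f - g) :=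
  let ⟨_, h⟩ := hf; let ⟨_, h'⟩ := hg; ⟨_, h.sub h'⟩

theorem RegF.mul {f g : Frac K n} (hf : RegF a f) (hg : RegF a g) : RegF a (f * g) :=
  let ⟨_, h⟩ := hf; let ⟨_, h'⟩ := hg; ⟨_, h.mul h'⟩

theorem regF_yF (q : Kˣ) (i : ℤ) : RegF a (yF q i : Frac K n) := ⟨_, val_yF i⟩

theorem Generic.regF_cc_inv (hg : Generic t q a) {i j : ℤ}
    (h : extTuple q a j ≠ extTuple q a (i + n)) : RegF a (cc q t i j : Frac K n)⁻¹ :=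
  ⟨_, hg.val_cc_inv h⟩

variable (t a) in
/-- All coefficients of `m` with respect to the vectors `T_x e_1` are regular at `a`. -/
def Reg (q : Kˣ) (m : Mod K n) : Prop := ∃ z : Ind q t a, Spec t a q m z

theorem Reg.add {m m' : Mod K n} (h : Reg t a q m) (h' : Reg t a q m') : Reg t a q (m + m') :=
  let ⟨_, h⟩ := h; let ⟨_, h'⟩ := h'; ⟨_, h.add h'⟩

theorem Reg.smul {m : Mod K n} (h : Reg t a q m) {f : Frac K n} (hf : RegF a f) :
    Reg t a q (f • m) :=
  let ⟨_, h⟩ := h; let ⟨_, hf⟩ := hf; ⟨_, h.smul hf⟩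

theorem Reg.neg {m : Mod K n} (h : Reg t a q m) : Reg t a q (-m) := by
  simpa using h.smul (f := -1) ⟨_, val_one.neg⟩

theorem Reg.rep {m : Mod K n} (h : Reg t a q m) (y : H n q t) : Reg t a q (rep K n q t y m) :=
  let ⟨_, h⟩ := h; ⟨_, h.rep y⟩

theorem reg_zero : Reg t a q (0 : Mod K n) := ⟨_, spec_zero⟩

theorem reg_ev_one : Reg t a q (ev 1 : Mod K n) := ⟨_, spec_ev_one⟩

/-- Right translation by u' sends e_u to e_{u u'} and preserves regularity once e_{u'} is regular.
-/
theorem Reg.ev_mul {u u' : AffPerm n} (h : Reg t a q (ev u : Mod K n)) (hu' : u' ∈ stab q a)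
    (h' : Reg t a q (ev u' : Mod K n)) : Reg t a q (ev (u * u') : Mod K n) := by
  obtain ⟨z, hz⟩ := h
  obtain ⟨z', hz'⟩ := h'
  have := hz.rightT hu' hz'
  rw [rightT_ev] at this
  exact ⟨_, this⟩

/-- The span over `ℍ` of the vectors `g • e_v`, where `g` satisfies `I`. -/
def spanEv (q t : Kˣ) (v : AffPerm n) (I : Frac K n → Prop) : AddSubgroup (Mod K n) :=
  AddSubgroup.closure {m | ∃ h g, I g ∧ m = rep K n q t h (g • ev v)}

theorem rep_mem_spanEv {v : AffPerm n} {I : Frac K n → Prop} (h : H n q t) {g : Frac K n}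
    (hg : I g) : rep K n q t h (g • ev v) ∈ spanEv q t v I :=
  AddSubgroup.subset_closure ⟨h, g, hg, rfl⟩

/-- Rewriting e_{s_k v} through e_v multiplies coefficients by 1 or by the inverse of `cc`. The
condition I' has to absorb both. -/
theorem spanEv_s_mul_le (v : AffPerm n) (k : ℤ) {I I' : Frac K n → Prop}
    (h : ∀ g, I g → I' g ∧ I' (g * (cc q t (v⁻¹ k) (v⁻¹ (k + 1)))⁻¹)) :
    spanEv q t (s n k * v) I ≤ spanEv q t v I' := by
  rw [spanEv, AddSubgroup.closure_le]
  rintro _ ⟨y, g, hg, rfl⟩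
  obtain ⟨h1, h2⟩ := h g hg
  rw [ev_s_mul (q := q) (t := t), smul_add, map_add, smul_smul, ← map_smul,
    ← Module.End.mul_apply, ← map_mul]
  exact add_mem (rep_mem_spanEv y h1) (rep_mem_spanEv _ h2)

end Regularity
end DAHA

namespace DAHA

/-! ### Regularity at `a` of the basis vectors indexed by reflections in the stabilizer -/

section Reflections

variable {K : Type*} [Field K] {n : ℕ} {q t : Kˣ} [n.AtLeastTwo] {a : Fin n → Kˣ}

variable (q a) in
/-- `i < j` are neighbours among the subscripts at which the extended tuple takes a given value. -/
structure Neighbours (i j : ℤ) : Prop where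
  lt : i < j
  eq : extTuple q a i = extTuple q a j
  ne : ∀ m, i < m → m < j → extTuple q a m ≠ extTuple q a i

theorem Neighbours.not_dvd {i j : ℤ} (h : Neighbours q a i j) (hg : Generic t q a) :
    ¬ (n : ℤ) ∣ j - i := fun hd => h.lt.ne (hg.eq_of_dvd hd h.eq)

/-- Since Y_{j-n} = t⁻² Y_j, one has f_{j-n,i} = t⁻¹ (Y_j - Y_i). The inverse of `cc` therefore has
a simple pole along Y_i = Y_j, the only pole met on the path. -/
theorem Generic.cc_inv_mul_sub (hg : Generic t q a) {i j : ℤ} (h : ¬ (n : ℤ) ∣ j - i) :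
    (cc q t (j - n) i : Frac K n)⁻¹ * (yF q i - yF q j) =
      cF (-(t : K)) * (yF q (j - n) - yF q i) := by
  have h1 : (yF q (j - n) : Frac K n) = cF ((t : K)⁻¹) * (cF ((t : K)⁻¹) * yF q j) := by
    have := yF_add_mul (K := K) (n := n) q j (-1)
    rw [show j + -1 * (n : ℤ) = j - n by ring] at this
    rw [this, ← mul_assoc, ← map_mul, neg_neg, zpow_one, hg.q_eq, Units.val_inv_eq_inv_val,
      Units.val_pow_eq_pow_val]
    congr 2
    have := t.ne_zero
    field_simp
  have h2 : (cF (t : K) : Frac K n) * cF ((t : K)⁻¹) = 1 := by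
    rw [← map_mul, mul_inv_cancel₀ t.ne_zero, map_one]
  have h3 : (fF q t (j - n) i : Frac K n) = cF ((t : K)⁻¹) * (yF q j - yF q i) := by
    rw [fF, h1]
    linear_combination (cF ((t : K)⁻¹) * yF q j) * h2
  have h4 := yF_sub_ne_zero (K := K) q h
  have h5 : (cF ((t : K)⁻¹) : Frac K n) ≠ 0 := right_ne_zero_of_mul_eq_one h2
  rw [cc, inv_div, h3, div_mul_eq_mul_div, div_eq_iff (mul_ne_zero h5 h4), map_neg]
  linear_combination ((yF q (j - n) - yF q i) * (yF q j - yF q i)) * h2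

variable (t a) in
/-- The invariant along a path from `1` that moves `i` up to the place before `j`. -/
structure PathInv (q : Kˣ) (i j : ℤ) (v : AffPerm n) : Prop where
  lt : v i < v j
  between : ∀ m, v i < v m → v m < v j → i < m ∧ m < j
  reg : Reg t a q (ev v : Mod K n)
  -- The alternatives say whether i has already overtaken j - n; it is at that step that the simple
  -- pole appears.
  mem : (v i < v (j - n) ∧ (ev 1 : Mod K n) ∈ spanEv q t v (RegF a)) ∨
    (v (j - n) < v i ∧ (ev 1 : Mod K n) ∈ spanEv q t v fun g => RegF a (g * (yF q i - yF q j)))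

theorem apply_sub_n (v : AffPerm n) (j : ℤ) : v (j - n) = v j - n := by
  have := apply_sub_mul v j 1
  simpa using this

theorem pathInv_one {i j : ℤ} (h : Neighbours q a i j) (hg : Generic t q a) :
    PathInv t a q i j 1 where
  lt := h.lt
  between m h1 h2 := ⟨h1, h2⟩
  reg := reg_ev_one
  mem := by
    refine Or.inl ⟨?_, ?_⟩
    · have := hg.sep i j h.lt h.eq
      rw [one_apply', one_apply']; linarith
    · have := rep_mem_spanEv (q := q) (t := t) (v := (1 : AffPerm n)) (I := RegF a) 1
        (g := (1 : Frac K n)) ⟨_, val_one⟩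
      rwa [map_one, one_smul] at this

/-- The step lets i overtake the subscript m standing just above it. Going forward costs the inverse
of `cc` at (i, m), and expressing the old vector through the new one costs the inverse at (m, i).
Separation and neighbourhood exclude poles in both, except for m = j - n in the second. -/
theorem PathInv.step {i j : ℤ} (h : Neighbours q a i j) (hg : Generic t q a) {v : AffPerm n}
    (hv : PathInv t a q i j v) (hne : v j ≠ v i + 1) :
    PathInv t a q i j (s n (v i) * v) ∧
      (s n (v i) * v) j - (s n (v i) * v) i < v j - v i := by
  have hn := n_pos (n := n)
  have hij := h.not_dvd hg
  have hvij := not_dvd_apply v hij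
  obtain ⟨m, hm⟩ : ∃ m, v m = v i + 1 := ⟨v⁻¹ (v i + 1), apply_inv_self' v _⟩
  have hlt := hv.lt
  obtain ⟨him, hmj⟩ := hv.between m (by omega) (by omega)
  have hvi : s n (v i) (v i) = v i + 1 := s_self _
  have hvm : s n (v i) (v m) = v i := by rw [hm, s_succ]
  have hmi : ¬ (n : ℤ) ∣ m - i := fun hd => by
    have := dvd_apply_sub v hd
    rw [hm] at this
    exact not_dvd_succ_sub _ this
  have hvj : s n (v i) (v j) ≤ v j := by
    by_cases hd : (n : ℤ) ∣ v j - (v i + 1)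
    · rw [s_apply_of_dvd_succ hd]; linarith
    · rw [s_apply_of_not hvij hd]
  -- Otherwise m - n has the same value as i. Being below i it is too close to i, and being above i
  -- it lies between the neighbours i and j.
  have hAm : extTuple q a m ≠ extTuple q a (i + n) := fun hA => by
    rw [hg.eq_add_iff] at hA
    rcases lt_trichotomy m (i + n) with h1 | h1 | h1
    · have := hg.sep _ _ (show m - n < i by omega) hA; omega
    · exact hmi ⟨1, by omega⟩
    · exact h.ne (m - n) (by omega) (by omega) hA
  have hdec : (s n (v i) * v) j - (s n (v i) * v) i < v j - v i := by
    rw [mul_apply', mul_apply', hvi]; omega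
  refine ⟨⟨?_, fun x hx1 hx2 => ?_, ?_, ?_⟩, hdec⟩
  · rw [mul_apply', mul_apply']
    refine lt_of_le_of_ne (not_lt.1 fun h' => hne ((s_lt_iff hlt).1 h').2) fun h' => ?_
    exact hlt.ne (apply_injective _ h')
  · rw [mul_apply', mul_apply'] at hx1 hx2
    refine hv.between x ?_ ?_
    · by_contra! h'
      rcases h'.lt_or_eq with h' | h'
      · have := ((s_lt_iff h').1 hx1)
        exact not_dvd_one n (by
          have h1 := this.1
          rw [show v x - v i = -1 by linarith [this.2]] at h1
          exact (dvd_neg.1 h1))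
      · rw [h'] at hx1; exact lt_irrefl _ hx1
    · by_contra! h'
      rcases h'.lt_or_eq with h' | h'
      · exact hvij ((s_lt_iff h').1 hx2).1
      · rw [h'] at hx2; exact lt_irrefl _ hx2
  · rw [ev_s_mul (q := q) (t := t), inv_apply_self', ← hm, inv_apply_self']
    exact hv.reg.add ((hv.reg.rep _).smul (hg.regF_cc_inv hAm))
  · have e : s n (v i) * (s n (v i) * v) = v := s_mul_self_mul _ _
    have e1 : (s n (v i) * v)⁻¹ (v i) = m := by
      rw [inv_apply_eq, mul_apply', hvm]
    have e2 : (s n (v i) * v)⁻¹ (v i + 1) = i := by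
      rw [inv_apply_eq, mul_apply', hvi]
    have key : ∀ {I I' : Frac K n → Prop}, (∀ g, I g → I' g ∧ I' (g * (cc q t m i)⁻¹)) →
        (ev 1 : Mod K n) ∈ spanEv q t v I → ev 1 ∈ spanEv q t (s n (v i) * v) I' := by
      intro I I' hI hmem
      refine spanEv_s_mul_le (s n (v i) * v) (v i) ?_ ?_ (I := I)
      · rwa [e1, e2]
      · rwa [e]
    -- At m = j - n the coefficients pass from regular to regular after multiplication by Y_i - Y_j.
    -- All other steps preserve the alternative that holds.
    by_cases hmj' : m = j - n
    · right
      refine ⟨by rw [mul_apply', mul_apply', hvi, ← hmj', hvm]; linarith, ?_⟩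
      rcases hv.mem with ⟨-, h2⟩ | ⟨h1, -⟩
      · refine key (fun g hg' => ⟨hg'.mul ((regF_yF q i).sub (regF_yF q j)), ?_⟩) h2
        rw [hmj', mul_assoc, hg.cc_inv_mul_sub hij]
        exact hg'.mul (RegF.mul ⟨_, val_cF _⟩ ((regF_yF q _).sub (regF_yF q i)))
      · rw [← hmj', hm] at h1; omega
    -- An equality would put m + n strictly between the neighbours i and j, or above j at a distance
    -- less than n.
    · have hAi : extTuple q a i ≠ extTuple q a (m + n) := fun hA => by
        rcases lt_trichotomy (m + n) j with h1 | h1 | h1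
        · exact h.ne (m + n) (by omega) h1 hA.symm
        · exact hmj' (by omega)
        · have := hg.sep _ _ h1 (h.eq.symm.trans hA); omega
      have hreg := hg.regF_cc_inv hAi
      rcases hv.mem with ⟨h1, h2⟩ | ⟨h1, h2⟩
      · refine Or.inl ⟨?_, key (fun g hg' => ⟨hg', hg'.mul hreg⟩) h2⟩
        rw [mul_apply', mul_apply']
        refine lt_of_le_of_ne (not_lt.1 fun h' => hmj' ?_) fun h' => ?_
        · have := ((s_lt_iff h1).1 h').2
          rw [← hm] at this
          exact (apply_injective _ this).symm
        · exact h1.ne (apply_injective _ h')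
      · refine Or.inr ⟨?_, key (fun g hg' => ⟨hg', ?_⟩) h2⟩
        · rw [mul_apply', mul_apply']
          refine lt_of_le_of_ne (not_lt.1 fun h' => hvij ?_) fun h' => ?_
          · have h3 := ((s_lt_iff h1).1 h').1
            rw [apply_sub_n] at h3
            have := dvd_add h3 (dvd_refl (n : ℤ))
            rwa [show v j - n - v i + n = v j - v i by ring] at this
          · exact h1.ne (apply_injective _ h')
        · rw [mul_right_comm]; exact hg'.mul hreg

/-- Each step shrinks the positive distance v j - v i. -/
theorem PathInv.exists_adjacent {i j : ℤ} (h : Neighbours q a i j) (hg : Generic t q a)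
    {v : AffPerm n} (hv : PathInv t a q i j v) :
    ∃ v, PathInv t a q i j v ∧ v j = v i + 1 := by
  by_cases hne : v j = v i + 1
  · exact ⟨v, hv, hne⟩
  · obtain ⟨h1, h2⟩ := hv.step h hg hne
    exact h1.exists_adjacent h hg
termination_by (v j - v i).toNat
decreasing_by
  have := h1.lt
  omega

/-- Modulo Y_i - Y_j the reflection fixes every variable. -/
theorem actL_sub_mem {i j : ℤ} (h : ¬ (n : ℤ) ∣ j - i) (P : Laurent K n) :
    actL q (refl h) P - P ∈ Ideal.span {(yL q i - yL q j : Laurent K n)} := by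
  have key : (Ideal.Quotient.mkₐ K (Ideal.span {(yL q i - yL q j : Laurent K n)})).comp
      (actL q (refl h)) = Ideal.Quotient.mkₐ K _ := by
    have hm : yL q i - yL q j ∈ Ideal.span {(yL q i - yL q j : Laurent K n)} :=
      Ideal.mem_span_singleton_self _
    refine laurent_hom_ext q fun x => ?_
    rw [AlgHom.comp_apply, actL_yL, Ideal.Quotient.mkₐ_eq_mk, Ideal.Quotient.eq]
    by_cases hA : (n : ℤ) ∣ x - i
    · rw [refl_of_dvd h hA]
      obtain ⟨m, hx⟩ := hA
      obtain rfl : x = i + m * n := by linarith [mul_comm m (n : ℤ)]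
      rw [show i + m * n + (j - i) = j + m * n by ring, yL_add_mul, yL_add_mul, ← smul_sub,
        Algebra.smul_def]
      exact Ideal.mul_mem_left _ _ (by simpa using neg_mem hm)
    · by_cases hB : (n : ℤ) ∣ x - j
      · rw [refl_of_dvd' h hB]
        obtain ⟨m, hx⟩ := hB
        obtain rfl : x = j + m * n := by linarith [mul_comm m (n : ℤ)]
        rw [show j + m * n - (j - i) = i + m * n by ring, yL_add_mul, yL_add_mul, ← smul_sub,
          Algebra.smul_def]
        exact Ideal.mul_mem_left _ _ hm
      · rw [refl_of_not h hA hB, sub_self]; exact zero_mem _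
  have := DFunLike.congr_fun key P
  rwa [AlgHom.comp_apply, Ideal.Quotient.mkₐ_eq_mk, Ideal.Quotient.eq] at this

theorem refl_mem_stab {i j : ℤ} (h : ¬ (n : ℤ) ∣ j - i) (hA : extTuple q a i = extTuple q a j) :
    refl h ∈ stab q a := by
  intro x
  rw [refl_inv]
  by_cases h1 : (n : ℤ) ∣ x - i
  · rw [refl_of_dvd h h1]
    obtain ⟨m, hx⟩ := h1
    obtain rfl : x = i + m * n := by linarith [mul_comm m (n : ℤ)]
    rw [show i + m * n + (j - i) = j + m * n by ring, extTuple_add_mul, extTuple_add_mul, hA]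
  · by_cases h2 : (n : ℤ) ∣ x - j
    · rw [refl_of_dvd' h h2]
      obtain ⟨m, hx⟩ := h2
      obtain rfl : x = j + m * n := by linarith [mul_comm m (n : ℤ)]
      rw [show j + m * n - (j - i) = i + m * n by ring, extTuple_add_mul, extTuple_add_mul, hA]
    · rw [refl_of_not h h1 h2]

/-- The reflection changes the sign of Y_i - Y_j, so the polar parts of g and of its image cancel.
-/
theorem regF_add_actF {i j : ℤ} (h : ¬ (n : ℤ) ∣ j - i) (hA : extTuple q a i = extTuple q a j)
    {g : Frac K n} (hg : RegF a (g * (yF q i - yF q j))) : RegF a (g + actF q (refl h) g) := by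
  have hst := refl_mem_stab h hA
  obtain ⟨c, P, Q, h1, h2, -⟩ := hg
  -- For g = P / (Q (Y_i - Y_j)) this is the numerator of the sum over the common denominator. It is
  -- divisible by Y_i - Y_j because P and Q are fixed by the reflection modulo that element.
  have h3 : P * actL q (refl h) Q - actL q (refl h) P * Q ∈
      Ideal.span {(yL q i - yL q j : Laurent K n)} := by
    have := sub_mem (Ideal.mul_mem_left _ P (actL_sub_mem (q := q) h Q))
      (Ideal.mul_mem_right Q _ (actL_sub_mem (q := q) h P))
    convert this using 1
    ring
  obtain ⟨R, hR⟩ := Ideal.mem_span_singleton'.1 h3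
  have hR' := congrArg (algebraMap (Laurent K n) (Frac K n)) hR
  have h4 := congrArg (actF q (refl h)) h2
  simp only [map_mul, map_sub, actF_algebraMap, actF_yF, refl_left, refl_right] at h4 hR'
  refine ⟨_, R, Q * actL q (refl h) Q, ?_, ?_, rfl⟩
  · rw [map_mul, evalAt_actL hst]; exact mul_ne_zero h1 h1
  · have h5 : (yF q i : Frac K n) - yF q j ≠ 0 := yF_sub_ne_zero q fun hd => h (by
      rw [← neg_sub]; exact dvd_neg.2 hd)
    refine mul_right_cancel₀ h5 ?_
    rw [map_mul, yF, yF] at *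
    linear_combination algebraMap (Laurent K n) (Frac K n) (actL q (refl h) Q) * h2 -
      algebraMap (Laurent K n) (Frac K n) Q * h4 - hR'

/-- Since v j = v i + 1, the translate of g e_v lies over e_{s v} with s = s_{v i}, and e_{s v} is
e_v plus a term with the inverse of `cc` at (i, j). The coefficients of e_v add up to g plus its
reflection, where the pole cancels. In the other term the factor Y_i - Y_j in the inverse of `cc`
absorbs the pole. -/
theorem Generic.reg_rightT_add (hg : Generic t q a) {i j : ℤ} (h : ¬ (n : ℤ) ∣ j - i)
    (hA : extTuple q a i = extTuple q a j) {v : AffPerm n} (hv : v j = v i + 1)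
    (hreg : Reg t a q (ev v : Mod K n)) {m : Mod K n}
    (hm : m ∈ spanEv q t v fun g => RegF a (g * (yF q i - yF q j))) :
    Reg t a q (rightT q (refl h) m + m) := by
  have hst := refl_mem_stab h hA
  have hvu : v * refl h = s n (v i) * v := by
    rw [s_eq_refl]; exact mul_refl_of_eq v h _ rfl hv
  induction hm using AddSubgroup.closure_induction with
  | mem m hm =>
    obtain ⟨y, g, hg', rfl⟩ := hm
    rw [rightT_rep, rightT_smul_ev, refl_inv, hvu, ev_s_mul (q := q) (t := t), inv_apply_self',
      ← hv, inv_apply_self', ← map_add, smul_add, add_right_comm, ← add_smul, smul_smul]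
    refine Reg.rep (((hreg.smul ?_).add ((hreg.rep _).smul ?_))) y
    · rw [add_comm]; exact regF_add_actF h hA hg'
    · obtain ⟨c, hc⟩ := hg'
      have h1 := hc.act hst
      rw [map_mul, map_sub, actF_yF, actF_yF, refl_left, refl_right] at h1
      -- The denominator f_{ij} does not vanish at `a`: otherwise i and i + n would have equal
      -- values, which separation forbids.
      have h2 : extTuple q a j ≠ extTuple q a (i + n) := fun h' => by
        have := hg.sep i (i + n) (by linarith [n_pos (n := n)]) (hA.trans h')
        omega
      have h3 := (h1.mul (val_cF (-1))).div (val_fF (t := t) i j) (hg.f_ne_zero h2)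
      have e : actF q (refl h) g * (cc q t i j)⁻¹ =
          actF q (refl h) g * (yF q j - yF q i) * cF (-1) / fF q t i j := by
        rw [cc, inv_div, map_neg, map_one]
        ring
      exact ⟨_, by rw [e]; exact h3⟩
  | zero => rw [map_zero, add_zero]; exact reg_zero
  | add x y _ _ hx hy =>
    rw [map_add, add_add_add_comm]; exact hx.add hy
  | neg x _ hx =>
    rw [map_neg, ← neg_add]; exact hx.neg

/-- At the end of the path e_1 has only a simple pole when written through e_v, so e_1 plus its
translate e_{(i j)} is regular, and e_1 itself is regular. -/
theorem Neighbours.reg {i j : ℤ} (h : Neighbours q a i j) (hg : Generic t q a) :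
    Reg t a q (ev (refl (h.not_dvd hg)) : Mod K n) := by
  obtain ⟨v, hv, hvj⟩ := (pathInv_one h hg).exists_adjacent h hg
  -- When v j = v i + 1 and n ≥ 2, v (j - n) = v i + 1 - n lies below v i.
  have hmem := hv.mem.resolve_left fun ⟨h1, _⟩ => by
    rw [apply_sub_n, hvj] at h1
    have := two_le n
    omega
  have h1 := hg.reg_rightT_add (h.not_dvd hg) h.eq hvj hv.reg hmem.2
  rw [rightT_ev, one_mul] at h1
  simpa using h1.add reg_ev_one.neg

/-- If m between i and j has the same value, then (i j) = (i m)(m j)(i m). Induction on j - i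
reduces to neighbours. -/
theorem Generic.reg_refl (hg : Generic t q a) {i j : ℤ} (h : ¬ (n : ℤ) ∣ j - i) (hij : i < j)
    (hA : extTuple q a i = extTuple q a j) : Reg t a q (ev (refl h) : Mod K n) := by
  by_cases hne : ∀ m, i < m → m < j → extTuple q a m ≠ extTuple q a i
  · exact Neighbours.reg ⟨hij, hA, hne⟩ hg
  · push Not at hne
    obtain ⟨m, him, hmj, hm⟩ := hne
    have h1 : ¬ (n : ℤ) ∣ m - i := fun hd => him.ne (hg.eq_of_dvd hd hm.symm)
    have h2 : ¬ (n : ℤ) ∣ j - m := fun hd => hmj.ne (hg.eq_of_dvd hd (hm.trans hA))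
    have e1 : refl h1 * refl h2 = refl h * refl h1 :=
      mul_refl_of_eq _ h2 h (refl_right h1) (refl_of_not h1 h h2)
    have e : refl h = refl h1 * refl h2 * refl h1 := by
      rw [e1, mul_assoc, refl_mul_self, mul_one]
    rw [e]
    have hr1 := hg.reg_refl h1 him hm.symm
    have hr2 := hg.reg_refl h2 hmj (hm.trans hA)
    exact (hr1.ev_mul (refl_mem_stab h2 (hm.trans hA)) hr2).ev_mul
      (refl_mem_stab h1 hm.symm) hr1
termination_by (j - i).toNat

theorem refl_symm {i j : ℤ} (h : ¬ (n : ℤ) ∣ j - i) (h' : ¬ (n : ℤ) ∣ i - j) :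
    refl h = refl h' := by
  refine AffPerm.ext' fun x => ?_
  by_cases h1 : (n : ℤ) ∣ x - i
  · rw [refl_of_dvd h h1, refl_of_dvd' h' h1]; ring
  · by_cases h2 : (n : ℤ) ∣ x - j
    · rw [refl_of_dvd' h h2, refl_of_dvd h' h2]; ring
    · rw [refl_of_not h h1 h2, refl_of_not h' h2 h1]

theorem conj_s (γ : AffPerm n) (j : ℤ) :
    γ⁻¹ * s n j * γ = refl (not_dvd_apply γ⁻¹ (not_dvd_succ_sub j)) := by
  rw [s_eq_refl, mul_refl, inv_mul_cancel_right]

theorem conj_mem_stab {J : Set ℤ} {γ : AffPerm n} (hJ : Conjugates q a J γ) {w : AffPerm n}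
    (hw : w ∈ parabolic n J) : γ⁻¹ * w * γ ∈ stab q a := by
  rw [← hJ.2] at hw
  obtain ⟨u, hu, rfl⟩ := hw
  convert hu using 1
  simp [mul_assoc]

theorem Generic.reg_conj_s (hg : Generic t q a) {J : Set ℤ} {γ : AffPerm n}
    (hJ : Conjugates q a J γ) {j : ℤ} (hj : j ∈ J) :
    Reg t a q (ev (γ⁻¹ * s n j * γ) : Mod K n) := by
  have hst := conj_mem_stab hJ (Subgroup.subset_closure ⟨j, hj, rfl⟩)
  have h := not_dvd_apply γ⁻¹ (not_dvd_succ_sub j)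
  have hA : extTuple q a (γ⁻¹ (j + 1)) = extTuple q a (γ⁻¹ j) := by
    have := extTuple_apply_of_mem hst (γ⁻¹ j)
    rwa [conj_s, refl_left] at this
  rw [conj_s]
  rcases lt_trichotomy (γ⁻¹ j) (γ⁻¹ (j + 1)) with h1 | h1 | h1
  · exact hg.reg_refl _ h1 hA.symm
  · exact absurd (by rw [h1, sub_self]; exact dvd_zero _) h
  · have h' : ¬ (n : ℤ) ∣ γ⁻¹ j - γ⁻¹ (j + 1) := fun hd => h (by
      rw [← neg_sub]; exact dvd_neg.2 hd)
    rw [refl_symm h h']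
    exact hg.reg_refl _ h1 hA

/-- The generators of the parabolic subgroup conjugate to reflections in Stab(a), and `Reg.ev_mul`
passes to products. -/
theorem Generic.reg_conj (hg : Generic t q a) {J : Set ℤ} {γ : AffPerm n}
    (hJ : Conjugates q a J γ) {w : AffPerm n} (hw : w ∈ parabolic n J) :
    Reg t a q (ev (γ⁻¹ * w * γ) : Mod K n) := by
  induction hw using Subgroup.closure_induction'' with
  | mem x hx =>
    obtain ⟨j, hj, rfl⟩ := hx
    exact hg.reg_conj_s hJ hj
  | inv_mem x hx =>
    obtain ⟨j, hj, rfl⟩ := hx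
    rw [s_inv]
    exact hg.reg_conj_s hJ hj
  | one => simpa using reg_ev_one
  | mul x y hx hy h1 h2 =>
    have := h1.ev_mul (conj_mem_stab hJ hy) h2
    rwa [show γ⁻¹ * x * γ * (γ⁻¹ * y * γ) = γ⁻¹ * (x * y) * γ by group] at this

theorem Generic.reg_of_mem (hg : Generic t q a) {J : Set ℤ} {γ : AffPerm n}
    (hJ : Conjugates q a J γ) {u : AffPerm n} (hu : u ∈ stab q a) :
    Reg t a q (ev u : Mod K n) := by
  have : γ * u * γ⁻¹ ∈ parabolic n J := by
    rw [← hJ.2]; exact ⟨u, hu, rfl⟩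
  have := hg.reg_conj hJ this
  rwa [show γ⁻¹ * (γ * u * γ⁻¹) * γ = u by group] at this

end Reflections
end DAHA

namespace DAHA

/-! ### Weight vectors of the induced module -/

section WeightVectors

variable {K : Type*} [Field K] {n : ℕ} {q t : Kˣ} [n.AtLeastTwo] {a : Fin n → Kˣ}

theorem Generic.fF_add (hg : Generic t q a) (i j : ℤ) :
    (fF q t i (j + n) : Frac K n) = cF (t : K) * (yF q i - yF q j) := by
  have h1 := yF_add_mul (K := K) (n := n) q j 1
  rw [one_mul] at h1
  have h2 : ((q ^ (-1 : ℤ) : Kˣ) : K) = t * t := by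
    rw [hg.q_eq, zpow_neg_one, inv_inv, Units.val_pow_eq_pow_val, sq]
  rw [fF, h1, h2, map_mul]
  linear_combination (-cF (t : K) * yF q j) * cF_mul_inv (K := K) (n := n) (t := t)

/-- Write Z for the inversions (p, r) with a_p = a_r, where the denominator vanishes, and P for
those with a_r = a_{p+n}, where the numerator vanishes. Shifting r by n is a bijection from Z to P,
and f_{p,r+n} = t (Y_p - Y_r), so the vanishing factors cancel and leave a power of t. -/
theorem Generic.val_kap (hg : Generic t q a) {u : AffPerm n} (hu : u ∈ stab q a) :
    ∃ c, c ≠ 0 ∧ Val a (kap q t u : Frac K n) c := by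
  classical
  have hn := n_pos (n := n)
  set S := (finite_invSet u).toFinset with hS
  let A := extTuple q a
  have hA : ∀ i, A (u i) = A i := extTuple_apply_of_mem hu
  let Z := S.filter fun z => A z.1 = A z.2
  let P := S.filter fun z => A z.2 = A (z.1 + n)
  have hbij : ∏ z ∈ P, (fF q t z.1 z.2 : Frac K n) = ∏ z ∈ Z, fF q t z.1 (z.2 + n) := by
    refine Finset.prod_bij' (fun z _ => (z.1, z.2 - n)) (fun z _ => (z.1, z.2 + n)) ?_ ?_ ?_ ?_ ?_
    · intro z hz
      obtain ⟨h1, h2⟩ := Finset.mem_filter.1 hz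
      obtain ⟨h3, h4, h5⟩ := (finite_invSet u).mem_toFinset.1 h1
      replace h2 := (hg.eq_add_iff _ _).1 h2
      have hlt : z.1 < z.2 - n := by
        rcases lt_trichotomy z.1 (z.2 - n) with h | h | h
        · exact h
        · rw [h, apply_sub_n] at h5; omega
        · have := hg.sep _ _ h h2; omega
      refine Finset.mem_filter.2 ⟨(finite_invSet u).mem_toFinset.2 ⟨h3, hlt, ?_⟩, h2.symm⟩
      change u (z.2 - n) < u z.1
      rw [apply_sub_n]; omega
    · intro z hz
      obtain ⟨h1, h2⟩ := Finset.mem_filter.1 hz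
      obtain ⟨h3, h4, h5⟩ := (finite_invSet u).mem_toFinset.1 h1
      refine Finset.mem_filter.2 ⟨(finite_invSet u).mem_toFinset.2 ⟨h3, ?_, ?_⟩, ?_⟩
      · change z.1 < z.2 + n; omega
      · change u (z.2 + n) < u z.1
        rw [apply_add_n]
        -- Since u stabilizes `a`, the values at u r and u p agree. Separation then gives u r + n <
        -- u p, so the shifted pair is still an inversion.
        exact hg.sep _ _ h5 (by change A (u z.2) = A (u z.1); rw [hA, hA, h2])
      · change A (z.2 + n) = A (z.1 + n)
        rw [hg.eq_add_iff, add_sub_cancel_right]; exact h2.symm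
    · intro z _; simp
    · intro z _; simp
    · intro z _; simp
  have hkap : (kap q t u : Frac K n) = (∏ z ∈ Z, cF (t : K)) *
      ((∏ z ∈ S.filter fun z => ¬ A z.2 = A (z.1 + n), fF q t z.1 z.2) /
        ∏ z ∈ S.filter fun z => ¬ A z.1 = A z.2, (yF q z.1 - yF q z.2)) := by
    have hne : ∀ z ∈ S, (yF q z.1 - yF q z.2 : Frac K n) ≠ 0 := fun z hz h0 => by
      have h1 : (kap q t u : Frac K n) ≠ 0 := kap_ne_zero u
      refine h1 (Finset.prod_eq_zero hz ?_)
      rw [cc, h0, div_zero]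
    have h1 : (∏ z ∈ Z, (yF q z.1 - yF q z.2 : Frac K n)) ≠ 0 :=
      Finset.prod_ne_zero_iff.2 fun z hz => hne z (Finset.mem_filter.1 hz).1
    rw [kap, Finset.prod_congr rfl fun z _ => cc.eq_1 q t z.1 z.2, Finset.prod_div_distrib,
      ← Finset.prod_filter_mul_prod_filter_not S (fun z => A z.2 = A (z.1 + n)), hbij,
      Finset.prod_congr rfl fun z _ => hg.fF_add z.1 z.2, Finset.prod_mul_distrib,
      ← Finset.prod_filter_mul_prod_filter_not S (fun z => A z.1 = A z.2)
        (fun z => (yF q z.1 - yF q z.2 : Frac K n)), mul_right_comm, mul_comm _ (∏ z ∈ Z, (_ - _)),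
      mul_div_mul_left _ _ h1, mul_div_assoc]
  have hy : ∀ z ∈ S.filter fun z => ¬ A z.1 = A z.2, A z.1 - A z.2 ≠ 0 := fun z hz =>
    sub_ne_zero.2 (Finset.mem_filter.1 hz).2
  have hf : ∀ z ∈ S.filter fun z => ¬ A z.2 = A (z.1 + n),
      (t : K) * A z.1 - (t : K)⁻¹ * A z.2 ≠ 0 := fun z hz =>
    hg.f_ne_zero (Finset.mem_filter.1 hz).2
  rw [hkap]
  refine ⟨_, ?_, (val_prod Z fun _ _ => val_cF _).mul
    ((val_prod _ fun z _ => val_fF z.1 z.2).div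
      (val_prod _ fun z _ => (val_yF z.1).sub (val_yF z.2)) (Finset.prod_ne_zero_iff.2 hy))⟩
  exact mul_ne_zero (Finset.prod_ne_zero_iff.2 fun _ _ => t.ne_zero)
    (div_ne_zero (Finset.prod_ne_zero_iff.2 hf) (Finset.prod_ne_zero_iff.2 hy))

/-- The leading coefficient of e_u times `kap u` is 1, and both factors are regular at `a`. -/
theorem Generic.coef_self_ne_zero (hg : Generic t q a) {u : AffPerm n} (hu : u ∈ stab q a)
    {z : Ind q t a} (hz : Spec t a q (ev u : Mod K n) z) : coef q t a z u ≠ 0 := by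
  obtain ⟨g, h1, h2⟩ := hz
  obtain ⟨c, hc, hv⟩ := hg.val_kap hu
  have h3 := (h2 u).mul hv
  rw [(theta_eq_ev h1).1] at h3
  intro h0
  rw [h0, zero_mul] at h3
  exact one_ne_zero (val_one.unique h3)

theorem Spec.coef_ne_zero {u : AffPerm n} {z : Ind q t a} (hz : Spec t a q (ev u : Mod K n) z)
    {x : AffPerm n} (hx : coef q t a z x ≠ 0) : x = u ∨ len x < len u := by
  obtain ⟨g, h1, h2⟩ := hz
  exact (theta_eq_ev h1).2 x ((h2 x).ne_zero hx)

variable (q t a) in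
/-- The vectors of weight `a`. -/
def IsWeight (z : Ind q t a) : Prop :=
  ∀ j : ℤ, gen n q t (Gen.Y j) • z = extTuple q a j • z

/-- Y_j acts on e_u by Y_{u⁻¹ j}, whose value at `a` is a_j because u stabilizes `a`. -/
theorem isWeight_of_spec {u : AffPerm n} (hu : u ∈ stab q a) {z : Ind q t a}
    (hz : Spec t a q (ev u : Mod K n) z) : IsWeight q t a z := by
  intro j
  have h1 := hz.rep (gen n q t (Gen.Y j))
  rw [rep_gen, genOp_Y] at h1
  rw [← mem_stab_iff.1 hu j]
  exact h1.unique (hz.smul (val_yF _))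

theorem isWeight_tmulV_one : IsWeight q t a (tmulV a 1) := by
  intro j
  rw [smul_tmulV, mul_one, ← laurentToH_yL, ← one_mul (laurentToH n q t _), tmulV_mul_laurent,
    evalAt_yL]

theorem coefH_eq_zero_of_mem_filH {m : ℕ} {h : H n q t} (hh : h ∈ filH n q t m) {x : AffPerm n}
    (hx : m ≤ len x) : coefH q t a h x = 0 := by
  obtain ⟨g, h1, rfl⟩ := exists_finsupp_of_mem_fil hh
  have := pbw_apply (K := K) (q := q) (t := t) g
  rw [RingHom.coe_coe, ← this, coefH_pbw, Finsupp.mapRange_apply, h1 x hx, map_zero]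

/-- By `isTriangular_Y` the action of Y_j is diagonal on coordinates of maximal length. -/
theorem coef_gen_Y_smul {z : Ind q t a} {x : AffPerm n}
    (hx : ∀ y, coef q t a z y ≠ 0 → len y ≤ len x) (j : ℤ) :
    coef q t a (gen n q t (Gen.Y j) • z) x = extTuple q a (x⁻¹ j) * coef q t a z x := by
  classical
  have key : ∀ y, len y ≤ len x → coef q t a (gen n q t (Gen.Y j) • tmulV a (Tw q t y)) x =
      extTuple q a (x⁻¹ j) * (Finsupp.single y (1 : K)) x := by
    intro y hy
    have h1 := coefH_eq_zero_of_mem_filH (a := a) (isTriangular_Y (q := q) (t := t) j y) hy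
    rw [RingHom.coe_coe, map_sub, Finsupp.sub_apply, sub_eq_zero] at h1
    rw [smul_tmulV, coef_tmulV, h1, coefH_mul_laurent, ← coef_tmulV, coef_tmulV_Tw,
      Finsupp.smul_apply, smul_eq_mul, evalAt_yL, Finsupp.single_apply]
    split_ifs with hxy
    · rw [hxy]
    · rw [mul_zero, mul_zero]
  conv_lhs => rw [← sum_coef z]
  rw [Finsupp.sum, Finset.smul_sum, map_sum, Finsupp.finsetSum_apply]
  have h2 : ∀ y ∈ (coef q t a z).support,
      coef q t a (gen n q t (Gen.Y j) • coef q t a z y • tmulV a (Tw q t y)) x =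
        extTuple q a (x⁻¹ j) * (coef q t a z y * (Finsupp.single y (1 : K)) x) := by
    intro y hy
    have e : gen n q t (Gen.Y j) • coef q t a z y • tmulV a (Tw q t y) =
        coef q t a z y • gen n q t (Gen.Y j) • tmulV a (Tw q t y) := by
      rw [← tmulV_smul, smul_tmulV, smul_tmulV, ← tmulV_smul, mul_smul_comm]
    rw [e, map_smul, Finsupp.smul_apply, smul_eq_mul, key y (hx y (Finsupp.mem_support_iff.1 hy))]
    ring
  rw [Finset.sum_congr rfl h2, ← Finset.mul_sum]
  congr 1
  by_cases hxs : x ∈ (coef q t a z).support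
  · rw [Finset.sum_eq_single_of_mem x hxs fun y _ hy => by
      rw [Finsupp.single_eq_of_ne' hy, mul_zero], Finsupp.single_eq_same, mul_one]
  · rw [Finsupp.notMem_support_iff.1 hxs]
    refine Finset.sum_eq_zero fun y hy => ?_
    rw [Finsupp.single_eq_of_ne' (fun h : y = x => hxs (h ▸ hy)), mul_zero]

/-- Comparing the two eigenvalues of Y_j on a nonzero top coordinate gives a_{x⁻¹ j} = a_j for all
j. -/
theorem IsWeight.mem_stab {z : Ind q t a} (hz : IsWeight q t a z) {x : AffPerm n}
    (hx : ∀ y, coef q t a z y ≠ 0 → len y ≤ len x) (h0 : coef q t a z x ≠ 0) : x ∈ stab q a := by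
  intro j
  have h1 := coef_gen_Y_smul hx j
  rw [hz j, map_smul, Finsupp.smul_apply, smul_eq_mul] at h1
  exact (mul_right_cancel₀ h0 h1).symm

/-- In a relation take an index v of maximal length with nonzero coefficient. Only z_v contributes
to the coordinate at v. -/
theorem Generic.linearIndependent (hg : Generic t q a) {z : stab q a → Ind q t a}
    (hz : ∀ u : stab q a, Spec t a q (ev (u : AffPerm n) : Mod K n) (z u)) : LinearIndependent K z := by
  classical
  rw [linearIndependent_iff']
  intro S d hd u hu
  by_contra hne
  obtain ⟨v, hv, hmax⟩ := Finset.exists_max_image (S.filter fun u => d u ≠ 0)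
    (fun u => len (u : AffPerm n)) ⟨u, Finset.mem_filter.2 ⟨hu, hne⟩⟩
  obtain ⟨hvS, hv0⟩ := Finset.mem_filter.1 hv
  have h1 := congrArg (fun z => coef q t a z v) hd
  simp only [map_sum, map_smul, Finsupp.finsetSum_apply, Finsupp.smul_apply, smul_eq_mul, map_zero,
    Finsupp.zero_apply] at h1
  rw [Finset.sum_eq_single_of_mem v hvS fun w hw hwv => ?_] at h1
  · exact mul_ne_zero hv0 (hg.coef_self_ne_zero v.2 (hz v)) h1
  · by_cases hdw : d w = 0
    · rw [hdw, zero_mul]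
    · by_contra hc
      rcases (hz w).coef_ne_zero (right_ne_zero_of_mul hc) with h | h
      · exact hwv (Subtype.ext h).symm
      · exact (hmax w (Finset.mem_filter.2 ⟨hw, hdw⟩)).not_gt h

theorem isWeight_zero : IsWeight q t a 0 := fun j =>
  (smul_zero (gen n q t (Gen.Y j))).trans
    (coef_injective (by rw [map_smul, map_zero, smul_zero]))

theorem IsWeight.add {z z' : Ind q t a} (hz : IsWeight q t a z) (hz' : IsWeight q t a z') :
    IsWeight q t a (z + z') := fun j => by
  rw [smul_add, hz j, hz' j]
  exact (smul_add (extTuple q a j) z z').symm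

theorem IsWeight.smul {z : Ind q t a} (hz : IsWeight q t a z) (c : K) :
    IsWeight q t a (c • z) := fun j => by
  have h1 := hz j
  obtain ⟨h, rfl⟩ := tmulV_surjective z
  rw [← tmulV_smul, smul_tmulV, mul_smul_comm, tmulV_smul, ← smul_tmulV, h1, ← tmulV_smul,
    ← tmulV_smul, ← tmulV_smul, smul_comm]

theorem isWeight_sum {ι : Type*} (S : Finset ι) {c : ι → K} {z : ι → Ind q t a}
    (h : ∀ i ∈ S, IsWeight q t a (z i)) : IsWeight q t a (∑ i ∈ S, c i • z i) :=
  Finset.sum_induction _ _ (fun _ _ => IsWeight.add) isWeight_zero fun i hi => (h i hi).smul (c i)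

/-- Induction on a strict bound m for the lengths in y: subtracting multiples of the z_u cancels all
coordinates of top length and leaves a weight vector with a smaller bound. -/
theorem Generic.mem_span (hg : Generic t q a) {z : stab q a → Ind q t a}
    (hz : ∀ u : stab q a, Spec t a q (ev (u : AffPerm n) : Mod K n) (z u)) (m : ℕ) (y : Ind q t a)
    (hy : IsWeight q t a y) (hm : ∀ x, coef q t a y x ≠ 0 → len x < m) :
    y ∈ Submodule.span K (Set.range z) := by
  classical
  induction m generalizing y with
  | zero =>
    have : y = 0 := coef_injective (Finsupp.ext fun x => by
      rw [map_zero, Finsupp.zero_apply]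
      by_contra h
      exact absurd (hm x h) (Nat.not_lt_zero _))
    rw [this]; exact zero_mem _
  | succ m ih =>
    have hle : ∀ x, coef q t a y x ≠ 0 → len x ≤ m := fun x hx => Nat.lt_succ_iff.1 (hm x hx)
    -- Restricting to the stabilizer loses no index of length m, by `IsWeight.mem_stab`.
    let S : Finset (stab q a) := ((coef q t a y).support.filter fun x => len x = m).subtype _
    have hS : ∀ u, u ∈ S ↔ coef q t a y u ≠ 0 ∧ len (u : AffPerm n) = m := fun u => by simp [S]
    let y' := ∑ u ∈ S, (coef q t a y u * (coef q t a (z u) u)⁻¹) • z u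
    have hy' : y' ∈ Submodule.span K (Set.range z) :=
      sum_mem fun u _ => Submodule.smul_mem _ _ (Submodule.subset_span ⟨u, rfl⟩)
    have hw' : IsWeight q t a y' := isWeight_sum S fun u _ => isWeight_of_spec u.2 (hz u)
    rw [← sub_add_cancel y y']
    have hsub : IsWeight q t a (y - y') := by
      have := hy.add (hw'.smul (-1))
      rwa [show y + (-1 : K) • y' = y - y' from coef_injective (by
        rw [map_add, map_smul, map_sub]; module)] at this
    refine add_mem (ih _ hsub fun x hx => ?_) hy'
    rw [map_sub, Finsupp.sub_apply] at hx
    by_contra! hlen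
    have hcoef : ∀ u ∈ S, x ≠ u → coef q t a (z u) x = 0 := fun u hu hne => by
      by_contra hc
      rcases (hz u).coef_ne_zero hc with h | h
      · exact hne h
      · rw [((hS u).1 hu).2] at h; omega
    have hsum : coef q t a y' x = ∑ u ∈ S, coef q t a y u * (coef q t a (z u) u)⁻¹ *
        coef q t a (z u) x := by
      simp only [y', map_sum, map_smul, Finsupp.finsetSum_apply, Finsupp.smul_apply, smul_eq_mul]
    rw [hsum] at hx
    by_cases hyx : coef q t a y x = 0
    · rw [hyx, zero_sub, neg_ne_zero] at hx
      refine hx (Finset.sum_eq_zero fun u hu => ?_)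
      rw [hcoef u hu (fun h => ((hS u).1 hu).1 (h ▸ hyx)), mul_zero]
    · have hlx : len x = m := le_antisymm (hle x hyx) hlen
      have hxs : x ∈ stab q a := hy.mem_stab (fun v hv => hlx ▸ hle v hv) hyx
      have hxS : (⟨x, hxs⟩ : stab q a) ∈ S := (hS _).2 ⟨hyx, hlx⟩
      rw [Finset.sum_eq_single_of_mem _ hxS fun u hu hne => by
        rw [hcoef u hu (fun h => hne (Subtype.ext h.symm)), mul_zero],
        inv_mul_cancel_right₀ (hg.coef_self_ne_zero hxs (hz ⟨x, hxs⟩)), sub_self] at hx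
      exact hx rfl

theorem Generic.span_eq (hg : Generic t q a) {z : stab q a → Ind q t a}
    (hz : ∀ u : stab q a, Spec t a q (ev (u : AffPerm n) : Mod K n) (z u)) {y : Ind q t a}
    (hy : IsWeight q t a y) : y ∈ Submodule.span K (Set.range z) :=
  hg.mem_span hz (((coef q t a y).support.sup len) + 1) y hy fun _ hx =>
    Nat.lt_succ_of_le (Finset.le_sup (Finsupp.mem_support_iff.2 hx))

end WeightVectors

/-! ### Endomorphisms of the induced module -/

section Endomorphisms

variable {K : Type*} [Field K] {n : ℕ} {q t : Kˣ} [n.AtLeastTwo] {a : Fin n → Kˣ}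

/-- The endomorphism that sends `1 ⊗ v` to a vector of weight `a`. -/
def endOf {z : Ind q t a} (hz : IsWeight q t a z) : Module.End (H n q t) (Ind q t a) :=
  Submodule.liftQ (indIdeal q t a) (LinearMap.toSpanSingleton (H n q t) (Ind q t a) z) <| by
    refine Submodule.span_le.2 ?_
    rintro _ ⟨k, rfl⟩
    have h1 := hz ((k : ℤ) + 1)
    rw [extTuple, ext_succ] at h1
    obtain ⟨h, rfl⟩ := tmulV_surjective z
    change tmulV a ((gen n q t (Gen.Y ((k : ℤ) + 1)) - algebraMap K (H n q t) (a k : K)) * h) = 0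
    rw [sub_mul, ← Algebra.smul_def]
    exact sub_eq_zero.2 h1

theorem endOf_tmulV {z : Ind q t a} (hz : IsWeight q t a z) (h : H n q t) :
    endOf hz (tmulV a h) = h • z := rfl

theorem end_ext {f f' : Module.End (H n q t) (Ind q t a)} (h : f (tmulV a 1) = f' (tmulV a 1)) :
    f = f' := by
  refine LinearMap.ext fun y => ?_
  obtain ⟨y, rfl⟩ := tmulV_surjective y
  rw [← mul_one y, ← smul_tmulV, map_smul, map_smul, h]

theorem end_smul_apply (f : Module.End (H n q t) (Ind q t a)) (c : K) (y : Ind q t a) :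
    f (c • y) = c • f y := by
  rw [← algebraMap_smul (H n q t) c y, map_smul, algebraMap_smul]

/-- Together with `endOf` and `end_ext` this identifies endomorphisms with vectors of weight `a`. -/
theorem isWeight_apply (f : Module.End (H n q t) (Ind q t a)) :
    IsWeight q t a (f (tmulV a 1)) := fun j => by
  rw [← map_smul, isWeight_tmulV_one j, end_smul_apply]

/-- Applying the endomorphism of u' to z = ∑ c_x T_x ⊗ v gives ∑ c_x T_x z', which is the value of
the right translate e_{u u'} of e_u. This is the source of the opposite algebra. -/
theorem endOf_mul {u u' u'' : AffPerm n} (hu : u ∈ stab q a) (hu' : u' ∈ stab q a)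
    (hu'' : u'' ∈ stab q a) (h : u'' = u * u') {z z' z'' : Ind q t a}
    (hz : Spec t a q (ev u : Mod K n) z) (hz' : Spec t a q (ev u' : Mod K n) z')
    (hz'' : Spec t a q (ev u'' : Mod K n) z'') :
    endOf (isWeight_of_spec hu'' hz'') =
      endOf (isWeight_of_spec hu' hz') * endOf (isWeight_of_spec hu hz) := by
  subst h
  have h1 := hz.rightT hu' hz'
  rw [rightT_ev] at h1
  refine end_ext ?_
  rw [Module.End.mul_apply, endOf_tmulV, endOf_tmulV, one_smul, one_smul, hz''.unique h1]
  conv_rhs => rw [← sum_coef z, Finsupp.sum, map_sum]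
  refine Finset.sum_congr rfl fun x _ => ?_
  rw [end_smul_apply, endOf_tmulV]

end Endomorphisms
end DAHA

namespace DAHA

/-! ### The endomorphism algebra of the induced module -/

section EndomorphismAlgebra

variable {K : Type*} [Field K] {n : ℕ} {q t : Kˣ} [n.AtLeastTwo] {a : Fin n → Kˣ}
  {J : Set ℤ} {γ : AffPerm n}

/-- Conjugation by `γ⁻¹`, from the parabolic subgroup to the stabilizer. -/
def toStab (hJ : Conjugates q a J γ) (w : parabolic n J) : stab q a :=
  ⟨γ⁻¹ * w * γ, conj_mem_stab hJ w.2⟩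

theorem toStab_bijective (hJ : Conjugates q a J γ) : Function.Bijective (toStab hJ) := by
  constructor
  · intro w w' h
    have h1 : γ⁻¹ * (w : AffPerm n) * γ = γ⁻¹ * w' * γ := congrArg Subtype.val h
    exact Subtype.ext (mul_left_cancel (mul_right_cancel h1))
  · intro u
    refine ⟨⟨γ * u * γ⁻¹, ?_⟩, ?_⟩
    · rw [← hJ.2]; exact ⟨u, u.2, rfl⟩
    · exact Subtype.ext (by simp only [toStab]; group)

theorem Generic.exists_spec (hg : Generic t q a) (hJ : Conjugates q a J γ) :
    ∃ z : stab q a → Ind q t a,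
      ∀ u : stab q a, Spec t a q (ev (u : AffPerm n) : Mod K n) (z u) :=
  ⟨fun u => (hg.reg_of_mem (K := K) hJ u.2).choose,
    fun u => (hg.reg_of_mem (K := K) hJ u.2).choose_spec⟩

theorem unop_sum' {ι A : Type*} [AddCommMonoid A] (S : Finset ι) (f : ι → Aᵐᵒᵖ) :
    (∑ i ∈ S, f i).unop = ∑ i ∈ S, (f i).unop :=
  map_sum (MulOpposite.opAddEquiv.symm : Aᵐᵒᵖ ≃+ A) f S

/-- The homomorphism `w ↦ Φ_w`. -/
def endHom (hJ : Conjugates q a J γ) {z : stab q a → Ind q t a}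
    (hz : ∀ u : stab q a, Spec t a q (ev (u : AffPerm n) : Mod K n) (z u)) :
    parabolic n J →* (Module.End (H n q t) (Ind q t a))ᵐᵒᵖ where
  toFun w := MulOpposite.op (endOf (isWeight_of_spec (toStab hJ w).2 (hz (toStab hJ w))))
  map_one' := by
    rw [← MulOpposite.op_one]
    refine congrArg MulOpposite.op (end_ext ?_)
    have h : ((toStab hJ 1 : stab q a) : AffPerm n) = 1 := by simp [toStab]
    have h1 := hz (toStab hJ 1)
    rw [h] at h1
    rw [endOf_tmulV, one_smul, h1.unique spec_ev_one]
    rfl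
  map_mul' w w' := by
    rw [← MulOpposite.op_mul]
    exact congrArg MulOpposite.op (endOf_mul (toStab hJ w).2 (toStab hJ w').2 (toStab hJ (w * w')).2
      (by simp only [toStab, Subgroup.coe_mul]; group) (hz _) (hz _) (hz _))

theorem lift_endHom_apply (hJ : Conjugates q a J γ) {z : stab q a → Ind q t a}
    (hz : ∀ u : stab q a, Spec t a q (ev (u : AffPerm n) : Mod K n) (z u))
    (x : MonoidAlgebra K (parabolic n J)) :
    (MonoidAlgebra.lift K (Module.End (H n q t) (Ind q t a))ᵐᵒᵖ (parabolic n J) (endHom hJ hz) x).unop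
      (tmulV a 1) = Finsupp.linearCombination K (fun w => z (toStab hJ w)) x.coeff := by
  rw [MonoidAlgebra.lift_apply, Finsupp.linearCombination_apply, Finsupp.sum, Finsupp.sum,
    unop_sum', LinearMap.sum_apply]
  refine Finset.sum_congr rfl fun w _ => ?_
  rw [MulOpposite.unop_smul, LinearMap.smul_apply]
  change _ • endOf (isWeight_of_spec (toStab hJ w).2 (hz (toStab hJ w))) (tmulV a 1) = _
  rw [endOf_tmulV, one_smul]

/-- Evaluation at 1 ⊗ v turns the map into the linear extension of w ↦ z_{γ⁻¹ w γ}, and these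
vectors form a basis of the weight space. -/
theorem Generic.lift_endHom_bijective (hg : Generic t q a) (hJ : Conjugates q a J γ)
    {z : stab q a → Ind q t a}
    (hz : ∀ u : stab q a, Spec t a q (ev (u : AffPerm n) : Mod K n) (z u)) :
    Function.Bijective (MonoidAlgebra.lift K (Module.End (H n q t) (Ind q t a))ᵐᵒᵖ
      (parabolic n J) (endHom hJ hz)) := by
  constructor
  · intro x x' h
    have h1 := congrArg (fun f => f.unop (tmulV a 1)) h
    simp only [lift_endHom_apply] at h1
    have h2 := (hg.linearIndependent hz).comp _ (toStab_bijective hJ).1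
    have h3 : x.coeff = x'.coeff := h2 h1
    cases x; cases x'; exact congrArg _ h3
  · intro f
    have h1 := hg.span_eq hz (isWeight_apply f.unop)
    rw [← (toStab_bijective hJ).2.range_comp z, Finsupp.mem_span_range_iff_exists_finsupp] at h1
    obtain ⟨c, hc⟩ := h1
    refine ⟨MonoidAlgebra.ofCoeff c, MulOpposite.unop_injective (end_ext ?_)⟩
    rw [lift_endHom_apply, Finsupp.linearCombination_apply]
    exact hc

theorem hasValueAt_of_val {g : LaurentLoc n q t} {c : K} (h : Val a (locToF n q t g) c) :
    HasValueAt a g c := by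
  obtain ⟨P, Q, h1, h2, h3⟩ := h
  refine ⟨P, Q, h1, locToF_injective ?_, h3⟩
  rw [map_mul, locToF_algebraMap, locToF_algebraMap, h2]

/-- Both the normal ordering of ν_u and the specialization of e_u come from the unique expansion of
e_u = ν_u e_1 in the T_x e_1. -/
theorem Spec.exists_normalOrdering {u : AffPerm n} {z : Ind q t a}
    (hz : Spec t a q (ev u : Mod K n) z) :
    ∃ (g : AffPerm n →₀ LaurentLoc n q t) (c : AffPerm n → K),
      (∀ g', IsNormalOrdering (nuW q t u) g' ↔ g' = g) ∧ (∀ x, HasValueAt a (g x) (c x)) ∧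
      z = tmulV a (∑ x ∈ g.support, c x • Tw q t x) := by
  obtain ⟨g, hg⟩ := exists_isNormalOrdering (nuW q t u)
  obtain ⟨g', h1, h2⟩ := hz
  have h3 := theta_of_isNormalOrdering hg
  rw [repL_nuW, ← h1] at h3
  obtain rfl := theta_injective h3
  refine ⟨g, coef q t a z, fun g' => ⟨fun h => isNormalOrdering_unique hg h, fun h => h ▸ hg⟩,
    fun x => hasValueAt_of_val (by simpa using h2 x), ?_⟩
  conv_lhs => rw [← sum_coef z]
  rw [tmulV_sum]
  -- A nonzero g_x may vanish at `a`, so the support of g can be larger than the set of nonzero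
  -- values.
  refine Finsupp.sum_of_support_subset _ ?_ _ fun x _ => ind_zero_smul _
  intro x hx
  have := (h2 x).ne_zero (Finsupp.mem_support_iff.1 hx)
  rw [Finsupp.mem_support_iff]
  rintro h0
  rw [Finsupp.mapRange_apply, h0, map_zero] at this
  exact this rfl

theorem Generic.exists_end_equiv (hg : Generic t q a) (hJ : Conjugates q a J γ) :
    ∃ Φ : (MonoidAlgebra K (parabolic n J))ᵐᵒᵖ ≃ₐ[K] Module.End (H n q t) (Ind q t a),
      ∀ w : parabolic n J,
        ∃ (g : AffPerm n →₀ LaurentLoc n q t) (c : AffPerm n → K),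
          (∀ g', IsNormalOrdering (nuW q t (γ⁻¹ * (w : AffPerm n) * γ)) g' ↔ g' = g) ∧
          (∀ x, HasValueAt a (g x) (c x)) ∧
          ∀ h : H n q t,
            Φ (MulOpposite.op (MonoidAlgebra.of K (parabolic n J) w)) (tmulV a h) =
              tmulV a (h * ∑ x ∈ g.support, c x • Tw q t x) := by
  obtain ⟨z, hz⟩ := hg.exists_spec (K := K) hJ
  refine ⟨AlgEquiv.opComm (AlgEquiv.ofBijective _ (hg.lift_endHom_bijective hJ hz)), fun w => ?_⟩
  obtain ⟨g, c, h1, h2, h3⟩ := (hz (toStab hJ w)).exists_normalOrdering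
  refine ⟨g, c, h1, h2, fun h => ?_⟩
  have e : AlgEquiv.opComm (AlgEquiv.ofBijective _ (hg.lift_endHom_bijective hJ hz))
      (MulOpposite.op (MonoidAlgebra.of K (parabolic n J) w)) =
      (MonoidAlgebra.lift K (Module.End (H n q t) (Ind q t a))ᵐᵒᵖ (parabolic n J) (endHom hJ hz)
        (MonoidAlgebra.of K (parabolic n J) w)).unop := rfl
  rw [e, MonoidAlgebra.lift_of]
  change endOf (isWeight_of_spec (toStab hJ w).2 (hz (toStab hJ w))) (tmulV a h) = _
  rw [endOf_tmulV, h3, smul_tmulV]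

end EndomorphismAlgebra
end DAHA

namespace DAHA

/-! ### Conjugating the stabilizer to a standard parabolic subgroup -/

section Parabolic

variable {K : Type*} [Field K] {n : ℕ} {q t : Kˣ} [n.AtLeastTwo] {a : Fin n → Kˣ}

theorem idx_add_mul (i m : ℤ) : (idx n (i + m * n) : Fin n) = idx n i := by
  unfold idx
  congr 2
  rw [show i + m * n - 1 = (i - 1) + m * n by ring, Int.add_mul_emod_self_right]

/-- The translation `k + 1 ↦ k + 1 + d k n`. -/
def translation (d : Fin n → ℤ) : AffPerm n :=
  ⟨{ toFun i := i + d (idx n i) * n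
     invFun i := i + -d (idx n i) * n
     left_inv i := by
      change i + _ + -d (idx n (i + _)) * n = i
      rw [idx_add_mul]; ring
     right_inv i := by
      change i + _ + d (idx n (i + _)) * n = i
      rw [idx_add_mul]; ring }, fun i => by
    change i + n + d (idx n (i + n)) * n = i + d (idx n i) * n + n
    have := idx_add_mul (n := n) i 1
    rw [one_mul] at this
    rw [this]; ring⟩

theorem translation_apply (d : Fin n → ℤ) (k : Fin n) :
    translation d ((k : ℤ) + 1) = (k : ℤ) + 1 + d k * n := by
  change (k : ℤ) + 1 + d (idx n ((k : ℤ) + 1)) * n = _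
  rw [idx_succ]

/-- A quasi-periodic sequence whose entries in the window `1, …, n` with ratio an integral power
of `r` are equal and stand in consecutive positions. -/
structure IsBlock (n : ℕ) (r : Kˣ) (b : ℤ → K) : Prop where
  add_mul : ∀ i m : ℤ, b (i + m * n) = ((r ^ m : Kˣ) : K) * b i
  eq_zero : ∀ i j m : ℤ, 1 ≤ i → i ≤ n → 1 ≤ j → j ≤ n → b i = ((r ^ m : Kˣ) : K) * b j → m = 0
  between : ∀ i l j : ℤ, 1 ≤ i → i ≤ l → l ≤ j → j ≤ n → b i = b j → b i = b l

variable {r : Kˣ} {b : ℤ → K}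

/-- If w i is m periods away from its residue k in the window, then b_i = r^m b_k, which forces m =
0. -/
theorem IsBlock.window (hb : IsBlock n r b) {w : AffPerm n} (hw : ∀ i, b (w i) = b i) {i : ℤ}
    (h1 : 1 ≤ i) (h2 : i ≤ n) : 1 ≤ w i ∧ w i ≤ n := by
  have h := idx_spec (n := n) (w i)
  have hlt : (((idx n (w i) : Fin n) : ℕ) : ℤ) < n := by exact_mod_cast (idx n (w i)).2
  have h0 := hw i
  rw [← h, hb.add_mul] at h0
  have := hb.eq_zero _ _ _ h1 h2 (by omega) (by omega) h0.symm
  rw [this] at h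
  omega

theorem IsBlock.inv_apply (hw : ∀ i, b ((w : AffPerm n) i) = b i) (i : ℤ) : b (w⁻¹ i) = b i := by
  rw [← hw, apply_inv_self']

/-- The positions in the window with equal neighbours. -/
def equalPositions (n : ℕ) (b : ℤ → K) : Set ℤ := {j | (1 ≤ j ∧ j ≤ (n : ℤ) - 1) ∧ b j = b (j + 1)}

theorem IsBlock.apply_s (hb : IsBlock n r b) {j : ℤ} (hj : b j = b (j + 1)) (i : ℤ) :
    b (s n j i) = b i := by
  by_cases h1 : (n : ℤ) ∣ i - j
  · rw [s_apply_of_dvd h1]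
    obtain ⟨m, hm⟩ := h1
    obtain rfl : i = j + m * n := by linarith [mul_comm m (n : ℤ)]
    rw [add_right_comm, hb.add_mul, hb.add_mul, hj]
  · by_cases h2 : (n : ℤ) ∣ i - (j + 1)
    · rw [s_apply_of_dvd_succ h2]
      obtain ⟨m, hm⟩ := h2
      obtain rfl : i = j + 1 + m * n := by linarith [mul_comm m (n : ℤ)]
      rw [show j + 1 + m * n - 1 = j + m * n by ring, hb.add_mul, hb.add_mul, hj]
    · rw [s_apply_of_not h1 h2]

/-- A descent exists by the general lemma and can be moved into the window; consecutiveness of equal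
entries forces it to lie inside a block. -/
theorem IsBlock.exists_desc (hb : IsBlock n r b) {w : AffPerm n} (hw : ∀ i, b (w i) = b i)
    (hne : (invSet w).ncard ≠ 0) :
    ∃ j ∈ equalPositions n b, w⁻¹ (j + 1) < w⁻¹ j := by
  have hn := n_pos (n := n)
  obtain ⟨i, hi⟩ := DAHA.exists_desc hne
  have hw' : ∀ i, b (w⁻¹ i) = b i := IsBlock.inv_apply hw
  obtain ⟨j, hj1, hj2, hj⟩ : ∃ j, 1 ≤ j ∧ j ≤ (n : ℤ) ∧ w⁻¹ (j + 1) < w⁻¹ j := by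
    have h := idx_spec (n := n) i
    have hlt : (((idx n i : Fin n) : ℕ) : ℤ) < n := by exact_mod_cast (idx n i).2
    refine ⟨((idx n i : Fin n) : ℤ) + 1, by omega, by omega, ?_⟩
    rw [← h, add_right_comm _ _ (1 : ℤ), inv_apply_add_mul, inv_apply_add_mul] at hi
    omega
  have hk := hb.window hw' hj1 hj2
  -- At j = n the value w⁻¹ (n + 1) = w⁻¹ 1 + n lies beyond the window, while w⁻¹ n lies in it.
  have hjn : j ≠ n := by
    rintro rfl
    have h1 := inv_apply_add_mul w 1 1
    rw [one_mul, add_comm] at h1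
    rw [h1] at hj
    have := (hb.window hw' le_rfl (by omega)).1
    omega
  have hk' := hb.window hw' (i := j + 1) (by omega) (by omega)
  refine ⟨j, ⟨⟨hj1, by omega⟩, ?_⟩, hj⟩
  -- If w⁻¹ (j + 1) < w⁻¹ j ≤ j, the block of j + 1 reaches down past j. Otherwise w⁻¹ j ≥ j + 1,
  -- and the block of j reaches up to j + 1.
  rcases le_or_gt (w⁻¹ j) j with h | h
  · have := hb.between _ j (j + 1) hk'.1 (by omega) (by omega) (by omega) (hw' (j + 1))
    rw [← this, hw']
  · exact hb.between j (j + 1) _ hj1 (by omega) (by omega) hk.2 (hw' j).symm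

/-- Descents within blocks are stripped off one by one. What remains has length zero, hence is a
shift, and only the trivial shift preserves the window. -/
theorem IsBlock.mem_parabolic (hb : IsBlock n r b) {w : AffPerm n} (hw : ∀ i, b (w i) = b i) :
    w ∈ parabolic n (equalPositions n b) := by
  have hn := n_pos (n := n)
  induction hm : len w using Nat.strong_induction_on generalizing w with
  | _ m ih =>
    by_cases hne : (invSet w).ncard = 0
    · have h1 := eq_rot_of_ncard_eq_zero hne
      have h2 := hb.window hw le_rfl (by omega)
      have h3 := hb.window hw (by omega) (le_refl (n : ℤ))
      have h4 : ∀ i, w i = i + w 0 := fun i => by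
        conv_lhs => rw [h1]
        exact rot_zpow_apply _ _
      rw [h4] at h2 h3
      have h5 : w 0 = 0 := by omega
      rw [h1, h5, zpow_zero]
      exact one_mem _
    · obtain ⟨j, hj, hlt⟩ := hb.exists_desc hw hne
      have h1 := len_s_mul_of_desc hlt
      have h2 := ih (len (s n j * w)) (by omega) (w := s n j * w)
        (fun i => by rw [mul_apply', hb.apply_s hj.2, hw]) rfl
      rw [← s_mul_self_mul j w]
      exact mul_mem (Subgroup.subset_closure ⟨j, hj, rfl⟩) h2

theorem IsBlock.mem_parabolic_iff (hb : IsBlock n r b) {w : AffPerm n} :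
    w ∈ parabolic n (equalPositions n b) ↔ ∀ i, b (w i) = b i := by
  refine ⟨fun hw => ?_, hb.mem_parabolic⟩
  induction hw using Subgroup.closure_induction with
  | mem x hx =>
    obtain ⟨j, hj, rfl⟩ := hx
    exact hb.apply_s hj.2
  | one => exact fun i => rfl
  | mul x y _ _ hx hy => exact fun i => by rw [mul_apply', hx, hy]
  | inv x _ hx => exact IsBlock.inv_apply hx

variable (t a) in
/-- The relation of lying in the same `t ^ 2`-line. -/
def lineSetoid : Setoid (Fin n) where
  r k l := SameLine (t ^ 2) (a k) (a l)
  iseqv :=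
    { refl k := ⟨0, by simp⟩
      symm := fun ⟨z, hz⟩ => ⟨-z, by rw [zpow_neg, ← hz, inv_div]⟩
      trans := fun ⟨z, hz⟩ ⟨z', hz'⟩ => ⟨z + z', by rw [zpow_add, ← hz, ← hz', div_mul_div_cancel]⟩ }

/-- Moving a position by a multiple of n multiplies its entry by a power of t², so each entry can be
replaced by a chosen representative ι of its line. Entries of the same line, consecutive by
hypothesis, become equal. -/
theorem exists_isBlock (ht : ∀ m : ℕ, 0 < m → t ^ m ≠ 1) (hq : q = (t ^ 2)⁻¹)
    (hlines : LinesConsecutive t a) :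
    ∃ δ : AffPerm n, IsBlock n (t ^ 2) fun i => extTuple q a (δ i) := by
  let ι : Fin n → Fin n := fun k => (Quotient.mk (lineSetoid t a) k).out
  have hι : ∀ k, SameLine (t ^ 2) (a (ι k)) (a k) := fun k =>
    Quotient.exact (Quotient.out_eq (Quotient.mk (lineSetoid t a) k))
  have hι' : ∀ k l, SameLine (t ^ 2) (a k) (a l) → ι k = ι l := fun k l h =>
    congrArg Quotient.out (Quotient.sound (s := lineSetoid t a) h)
  choose d hd using hι
  have hA : ∀ i m : ℤ, extTuple q a (i + m * n) = (((t ^ 2) ^ m : Kˣ) : K) * extTuple q a i := by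
    intro i m
    rw [extTuple_add_mul, hq, inv_zpow, zpow_neg, inv_inv]
  have hval : ∀ k : Fin n, extTuple q a (translation d ((k : ℤ) + 1)) = a (ι k) := by
    intro k
    rw [translation_apply, hA, ← hd k, extTuple, ext_succ, ← Units.val_mul, div_mul_cancel]
  have hidx : ∀ i : ℤ, 1 ≤ i → i ≤ n → ∃ k : Fin n, (k : ℤ) + 1 = i := fun i h1 h2 =>
    ⟨⟨(i - 1).toNat, by omega⟩, by change (((i - 1).toNat : ℕ) : ℤ) + 1 = i; omega⟩
  have hline : ∀ k l, SameLine (t ^ 2) (a (ι k)) (a (ι l)) → ι k = ι l := fun k l h =>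
    hι' k l ((lineSetoid t a).trans ((lineSetoid t a).symm ⟨d k, hd k⟩)
      ((lineSetoid t a).trans h ⟨d l, hd l⟩))
  refine ⟨translation d, ⟨fun i m => by rw [apply_add_mul, hA], ?_, ?_⟩⟩
  · intro i j m hi hi' hj hj' h
    obtain ⟨k, rfl⟩ := hidx i hi hi'
    obtain ⟨l, rfl⟩ := hidx j hj hj'
    rw [hval, hval] at h
    have h1 : a (ι k) = (t ^ 2) ^ m * a (ι l) := Units.ext h
    have h2 := hline k l ⟨m, by rw [h1, mul_div_cancel_right]⟩
    rw [h2, right_eq_mul] at h1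
    have h3 := zpow_eq_one ht (z := 2 * m) (by rw [← h1, zpow_mul]; rfl)
    omega
  · intro i l j hi hil hlj hj h
    obtain ⟨k, rfl⟩ := hidx i hi (by omega)
    obtain ⟨p, rfl⟩ := hidx l (by omega) (by omega)
    obtain ⟨m, rfl⟩ := hidx j (by omega) hj
    rw [hval, hval] at h ⊢
    have h1 : a (ι k) = a (ι m) := Units.ext h
    have h2 := hι' _ _ (hlines k p m (by rw [Fin.le_def]; omega) (by rw [Fin.le_def]; omega)
      ((lineSetoid t a).trans ((lineSetoid t a).symm ⟨d k, hd k⟩) ⟨d m, by rw [h1]; exact hd m⟩))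
    rw [h2]

/-- The stabilizer of the block tuple i ↦ a_{δ i} is δ⁻¹ Stab(a) δ, so γ = δ⁻¹ conjugates Stab(a) to
a standard parabolic subgroup. -/
theorem exists_conjugates (ht : ∀ m : ℕ, 0 < m → t ^ m ≠ 1) (hq : q = (t ^ 2)⁻¹)
    (hlines : LinesConsecutive t a) : ∃ (J : Set ℤ) (γ : AffPerm n), Conjugates q a J γ := by
  obtain ⟨δ, hδ⟩ := exists_isBlock ht hq hlines
  refine ⟨equalPositions n fun i => extTuple q a (δ i), δ⁻¹, fun j hj => hj.1, Subgroup.ext fun w => ?_⟩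
  rw [hδ.mem_parabolic_iff]
  constructor
  · rintro ⟨u, hu, rfl⟩ i
    change extTuple q a (δ ((δ⁻¹ * u * δ⁻¹⁻¹) i)) = _
    rw [inv_inv, mul_apply', mul_apply', apply_inv_self', extTuple_apply_of_mem hu]
  · intro h
    refine ⟨δ * w * δ⁻¹, ?_, by simp [mul_assoc]⟩
    -- Membership in `stab` is phrased with the inverse element, so the inverse is the convenient
    -- one to test.
    refine (inv_mem_iff (S := Subgroup (AffPerm n))).1 ?_
    intro i
    change extTuple q a ((δ * w * δ⁻¹)⁻¹⁻¹ i) = _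
    rw [inv_inv, mul_apply', mul_apply', h, apply_inv_self']

theorem exists_minimal_conjugates (ht : ∀ m : ℕ, 0 < m → t ^ m ≠ 1) (hq : q = (t ^ 2)⁻¹)
    (hlines : LinesConsecutive t a) : ∃ (J : Set ℤ) (γ : AffPerm n), Conjugates q a J γ ∧
      ∀ (J' : Set ℤ) (γ' : AffPerm n), Conjugates q a J' γ' → len γ ≤ len γ' := by
  classical
  obtain ⟨J, γ, h⟩ := exists_conjugates ht hq hlines
  have hex : ∃ m, ∃ (J : Set ℤ) (γ : AffPerm n), Conjugates q a J γ ∧ len γ = m :=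
    ⟨_, J, γ, h, rfl⟩
  obtain ⟨J₀, γ₀, h₀, hm⟩ := Nat.find_spec hex
  exact ⟨J₀, γ₀, h₀, fun J' γ' h' => hm ▸ Nat.find_min' hex ⟨J', γ', h', rfl⟩⟩

end Parabolic
end DAHA

end
open DAHA in
theorem mainTheorem8 {K : Type*} [Field K] [CharZero K] (n : ℕ) [n.AtLeastTwo]
    (q t : Kˣ) (ht : ∀ m : ℕ, 0 < m → t ^ m ≠ 1) (hq : q = (t ^ 2)⁻¹)
    (a : Fin n → Kˣ) (hdesc : IsDescending t a) (hlines : LinesConsecutive t a)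
    (htrans : Function.Injective a) :
    (∃ (J : Set ℤ) (γ : AffPerm n), Conjugates q a J γ ∧
      ∀ (J' : Set ℤ) (γ' : AffPerm n), Conjugates q a J' γ' → len γ ≤ len γ') ∧
    ∀ (J : Set ℤ) (γ : AffPerm n), Conjugates q a J γ →
      ∃ Φ : (MonoidAlgebra K (parabolic n J))ᵐᵒᵖ ≃ₐ[K] Module.End (H n q t) (Ind q t a),
        ∀ w : parabolic n J,
          ∃ (g : AffPerm n →₀ LaurentLoc n q t) (c : AffPerm n → K),
            (∀ g', IsNormalOrdering (nuW q t (γ⁻¹ * (w : AffPerm n) * γ)) g' ↔ g' = g) ∧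
            (∀ x, HasValueAt a (g x) (c x)) ∧
            ∀ h : H n q t,
              Φ (MulOpposite.op (MonoidAlgebra.of K (parabolic n J) w)) (tmulV a h) =
                tmulV a (h * ∑ x ∈ g.support, c x • Tw q t x) := by
  -- Descent and transversality of `a` enter through `Separated`; consecutiveness of lines is used
  -- to produce a pair (J, γ).
  have hg : Generic t q a := ⟨ht, hq, separated ht hq hdesc htrans⟩
  exact ⟨exists_minimal_conjugates ht hq hlines, fun _ _ hJ => hg.exists_end_equiv hJ⟩
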